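/- Let $n$ be even and let $\mathbb C^{m|n}$ carry its standard nondegenerate even supersymmetric bilinear form $(\cdot|\cdot)$ (symmetric on the even part, symplectic on the odd part). Let $\mathfrak g=\mathfrak{osp}_{m|n}$ be the corresponding orthosymplectic Lie superalgebra, and assume $m>4$ if $n=0$. Let $\{e,h,f\}\subset\mathfrak g_{\bar 0}$ be an $\mathfrak{sl}_2$-triple, $\mathfrak s=\mathbb Ce\oplus\mathbb Ch\oplus\mathbb Cf$, and let $\mathfrak g^\natural$ be the centralizer of $\mathfrak s$ in $\mathfrak g$. Assume that $\mathfrak g^\natural$ is a direct sum of a reductive (even) Lie algebra and of finitely many (possibly no) Lie superalgebras of type $\mathfrak{osp}_{1|2r}$. Let $f$ be encoded by the pair of partitions $(\alpha|\beta)$, $\alpha\vdash m$, $\beta\vdash n$; that is, as an $\mathfrak s$-module, $\mathbb C^{m|n}_{\bar 0}$ (resp. $\mathbb C^{m|n}_{\bar 1}$) is the direct sum of the irreducible modules $V(d-1)$ of dimension $d$, where $d$ runs over the parts of $\alpha$ (resp. $\beta$) with multiplicity. For a positive integer $q$ let $\mu_q$, $\nu_q$ be the multiplicities of $q$ in $\alpha$,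 $\beta$, and let $D=\{q:\mu_q+\nu_q>0\}$ be the set of distinct parts. Let $\mathrm{mult}(\mathbb C\otimes\mathrm{adj})$ be the multiplicity, in the $\mathfrak g^\natural\oplus\mathfrak s$-module $\Lambda^2(\mathbb C^{m|n})$ (super exterior square), of the tensor product of the trivial representation $\mathbb C$ of $\mathfrak g^\natural$ with the adjoint representation $\mathrm{adj}$ of $\mathfrak s$, i.e. the dimension of the space of $\mathfrak g^\natural\oplus\mathfrak s$-homomorphisms $\mathbb C\otimes\mathrm{adj}\to\Lambda^2(\mathbb C^{m|n})$. Then $$\begin{aligned}\mathrm{mult}(\mathbb C\otimes\mathrm{adj})=\;&|\{q\in D: q>1\}|\\ &+|\{(q,q')\in D^2: q=q'+2,\ \mu_q=\mu_{q'}=1,\ \nu_q=\nu_{q'}=0,\ q,q'\text{ odd}\}|\\ &+|\{(q,q')\in D^2: q=q'+2,\ \nu_q=\nu_{q'}=1,\ \mu_q=\mu_{q'}=0,\ q,q'\text{ even}\}|.\end{aligned}$$ In particular, $\mathrm{mult}(\mathbb C\otimes\mathrm{adj})=1$ if and only if, for some integers $q\ge2$, $l\ge1$, $r\ge0$, the pair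 $(\alpha|\beta)$ is one of the following: 1. $(q^l,1^r|0)$, $n=0$, $m>4$, $l$ even if $q$ is even; 2. $(0|q^l,1^r)$, $m=0$, $l$ even if $q$ is odd, $r$ even; 3. $(q^l|1^n)$, $l$ even if $q$ is even; 4. $(q^l,1|1^n)$, $l$ even if $q$ is even; 5. $(1^m|q^l)$, $l$ even if $q$ is odd; 6. $(1|q^l,1^r)$, $l$ even if $q$ is odd, $r$ even; 7. $(q,1^r|q^l)$, $l$ even, $q$ odd; 8. $(q^l|q,1^r)$, $q$, $l$ and $r$ even; 9. $(q^l,1^r|q)$, $l$ and $q$ even; 10. $(q,1|q^l,1^r)$, $l$ even, $q$ odd, $r$ even; 11. $(q^l,1|q,1^r)$, $q$, $l$ and $r$ even; 12. $(q|q^l,1^r)$, $l$ even, $q$ odd, $r$ even. (Here $0$ denotes the empty partition, and the parts of $\alpha$ sum to $m$, those of $\beta$ to $n$.) -/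

import Mathlib

open scoped TensorProduct

attribute [local instance 100] LieRing.ofAssociativeRing

namespace OspW

/-- Index set of the standard basis of `ℂ^{m|2k}`: the first `m` vectors are even, the last
`2k` are odd. -/
abbrev Idx (m k : ℕ) : Type := Fin m ⊕ (Fin k ⊕ Fin k)

/-- The superspace `ℂ^{m|n}` with `n = 2k`. -/
abbrev SV (m k : ℕ) : Type := Idx m k → ℂ

/-- Parity of a basis vector. -/
def par {m k : ℕ} : Idx m k → ZMod 2
  | Sum.inl _ => 0
  | Sum.inr _ => 1

/-- The sign `(-1)^{pr}` for parities `p`, `r`. -/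
def ksign (p r : ZMod 2) : ℂ := if p = 1 ∧ r = 1 then -1 else 1

theorem ksign_add_right (p q r : ZMod 2) : ksign p (q + r) = ksign p q * ksign p r := by
  have h : ∀ p : ZMod 2, p = 0 ∨ p = 1 := by decide
  rcases h p with rfl | rfl <;> rcases h q with rfl | rfl <;> rcases h r with rfl | rfl <;>
    simp [ksign, show (1 + 1 : ZMod 2) = 0 by decide]

theorem ksign_comm (p q : ZMod 2) : ksign p q = ksign q p := by
  simp only [ksign, and_comm]

theorem ksign_mul_self (p q : ZMod 2) : ksign p q * ksign p q = 1 := by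
  unfold ksign
  split_ifs <;> norm_num

/-- The homogeneous component of parity `p` of `ℂ^{m|2k}`. -/
def homog (m k : ℕ) (p : ZMod 2) : Submodule ℂ (SV m k) where
  carrier := {v | ∀ i, par i ≠ p → v i = 0}
  add_mem' := fun {a b} ha hb i hi => by simp [ha i hi, hb i hi]
  zero_mem' := fun i _ => rfl
  smul_mem' := fun c v hv i hi => by simp [hv i hi]

/-- The component of parity `p` of `𝔤𝔩_{m|2k}`: operators shifting the parity by `p`. -/
def glPart (m k : ℕ) (p : ZMod 2) : Submodule ℂ (Module.End ℂ (SV m k)) where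
  carrier := {X | ∀ r, ∀ v ∈ homog m k r, X v ∈ homog m k (r + p)}
  add_mem' := fun {a b} ha hb r v hv => by
    simpa using (homog m k (r + p)).add_mem (ha r v hv) (hb r v hv)
  zero_mem' := fun r v _ => by simp
  smul_mem' := fun c X hX r v hv => by
    simpa using (homog m k (r + p)).smul_mem c (hX r v hv)

/-- The `p × p` matrix with `1` on the anti-diagonal and `0` elsewhere. -/
def antiDiag (p : ℕ) : Matrix (Fin p) (Fin p) ℂ :=
  Matrix.of fun i j => if j = Fin.rev i then 1 else 0

/-- The supersymmetric bilinear form on `ℂ^{m|2k}`. -/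
noncomputable def form (m k : ℕ) : LinearMap.BilinForm ℂ (SV m k) :=
  Matrix.toBilin' (Matrix.fromBlocks (antiDiag m) 0 0
    (Matrix.fromBlocks 0 (antiDiag k) (-antiDiag k) 0))

/-- The component of parity `p` of `𝔬𝔰𝔭_{m|2k}`: operators `X` of parity `p` with
`(Xv|w) = -(-1)^{p r} (v|Xw)` for `v` of parity `r`. -/
def osp (m k : ℕ) (p : ZMod 2) : Submodule ℂ (Module.End ℂ (SV m k)) where
  carrier := {X | X ∈ glPart m k p ∧ ∀ r, ∀ v ∈ homog m k r, ∀ w,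
    form m k (X v) w = -(ksign p r * form m k v (X w))}
  add_mem' := fun {a b} ha hb => ⟨(glPart m k p).add_mem ha.1 hb.1, fun r v hv w => by
    simp only [LinearMap.add_apply, map_add, ha.2 r v hv w, hb.2 r v hv w]; ring⟩
  zero_mem' := ⟨(glPart m k p).zero_mem, fun r v _ w => by simp⟩
  smul_mem' := fun c X hX => ⟨(glPart m k p).smul_mem c hX.1, fun r v hv w => by
    simp only [LinearMap.smul_apply, map_smul, smul_eq_mul, hX.2 r v hv w]; ring⟩

/-- The superbracket `[X,Y] = XY - (-1)^{pq} YX` of operators of parities `p` and `q`. -/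
noncomputable def sbr {m k : ℕ} (p q : ZMod 2) (X Y : Module.End ℂ (SV m k)) :
    Module.End ℂ (SV m k) :=
  X * Y - ksign p q • (Y * X)

theorem sbr_mem_osp {m k : ℕ} {p q : ZMod 2} {X Y : Module.End ℂ (SV m k)}
    (hX : X ∈ osp m k p) (hY : Y ∈ osp m k q) : sbr p q X Y ∈ osp m k (p + q) := by
  refine ⟨fun r v hv => ?_, fun r v hv w => ?_⟩
  · have h1 : X (Y v) ∈ homog m k (r + (p + q)) := by
      have := hX.1 _ _ (hY.1 r v hv)
      rwa [show r + q + p = r + (p + q) by ring] at this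
    have h2 : Y (X v) ∈ homog m k (r + (p + q)) := by
      have := hY.1 _ _ (hX.1 r v hv)
      rwa [show r + p + q = r + (p + q) by ring] at this
    simpa [sbr] using (homog m k _).sub_mem h1 ((homog m k _).smul_mem (ksign p q) h2)
  · have h1 : form m k (X (Y v)) w = ksign p (r + q) * ksign q r * form m k v (Y (X w)) := by
      rw [hX.2 _ _ (hY.1 r v hv) w, hY.2 r v hv]; ring
    have h2 : form m k (Y (X v)) w = ksign q (r + p) * ksign p r * form m k v (X (Y w)) := by
      rw [hY.2 _ _ (hX.1 r v hv) w, hX.2 r v hv]; ring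
    simp only [sbr, LinearMap.sub_apply, LinearMap.smul_apply, Module.End.mul_apply, map_sub,
      map_smul, smul_eq_mul, h1, h2]
    generalize form m k v (Y (X w)) = a
    generalize form m k v (X (Y w)) = b
    rw [ksign_comm (p + q) r, ksign_add_right, ksign_add_right, ksign_add_right,
      ksign_comm r p, ksign_comm r q, ksign_comm q p]
    linear_combination (-(ksign p r * ksign q r * b)) * ksign_mul_self p q

/-- The bracket of the Lie superalgebra `𝔬𝔰𝔭_{m|2k}` on homogeneous elements. -/
noncomputable def ospBr {m k : ℕ} {p q : ZMod 2} (X : osp m k p) (Y : osp m k q) :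
    osp m k (p + q) :=
  ⟨sbr p q X Y, sbr_mem_osp X.2 Y.2⟩

/-- The component of parity `p` of `𝔤^♮`, the centralizer in `𝔬𝔰𝔭_{m|2k}` of the (even)
elements `e`, `h`, `f`. -/
def gnat {m k : ℕ} (e h f : Module.End ℂ (SV m k)) (p : ZMod 2) :
    Submodule ℂ (Module.End ℂ (SV m k)) where
  carrier := {X | X ∈ osp m k p ∧ ⁅X, e⁆ = 0 ∧ ⁅X, h⁆ = 0 ∧ ⁅X, f⁆ = 0}
  add_mem' := fun {a b} ha hb => ⟨(osp m k p).add_mem ha.1 hb.1, by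
    simp [add_lie, ha.2.1, hb.2.1], by simp [add_lie, ha.2.2.1, hb.2.2.1], by
    simp [add_lie, ha.2.2.2, hb.2.2.2]⟩
  zero_mem' := ⟨(osp m k p).zero_mem, by simp, by simp, by simp⟩
  smul_mem' := fun c X hX => ⟨(osp m k p).smul_mem c hX.1, by
    simp [smul_lie, hX.2.1], by simp [smul_lie, hX.2.2.1], by simp [smul_lie, hX.2.2.2]⟩

/-- `L` (given by its even and odd parts, inside `𝔤𝔩_{m|2k}` with the superbracket) is
isomorphic, as a Lie superalgebra, to `𝔬𝔰𝔭_{1|2r}`. -/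
def IsoOspOne {m k : ℕ} (L : ZMod 2 → Submodule ℂ (Module.End ℂ (SV m k))) (r : ℕ) : Prop :=
  ∃ φ : ∀ p, osp 1 r p ≃ₗ[ℂ] L p, ∀ (p q : ZMod 2) (X : osp 1 r p) (Y : osp 1 r q),
    (φ (p + q) (ospBr X Y) : Module.End ℂ (SV m k)) = sbr p q (φ p X) (φ q Y)

/-- `L` is the direct sum, as a Lie superalgebra, of a reductive Lie algebra (the summand
`none`, purely even, with radical equal to its centre) and of finitely many (possibly no) Lie
superalgebras `𝔬𝔰𝔭_{1|2r}`. -/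
def IsReductivePlusOspOne {m k : ℕ} (L : ZMod 2 → Submodule ℂ (Module.End ℂ (SV m k))) : Prop :=
  ∃ (s : ℕ) (A : Option (Fin s) → ZMod 2 → Submodule ℂ (Module.End ℂ (SV m k))),
    (∀ p, iSupIndep (fun o => A o p) ∧ ⨆ o, A o p = L p) ∧
    (∀ o o', o ≠ o' → ∀ p q, ∀ X ∈ A o p, ∀ Y ∈ A o' q, sbr p q X Y = 0) ∧
    A none 1 = ⊥ ∧
    (∃ a₀ : LieSubalgebra ℂ (Module.End ℂ (SV m k)), a₀.toSubmodule = A none 0 ∧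
      LieAlgebra.HasCentralRadical ℂ a₀) ∧
    ∀ c : Fin s, ∃ r : ℕ, IsoOspOne (A (some c)) r

/-- The homogeneous component of parity `p` of `ℂ^{m|2k}` decomposes under the span of `e, h, f`
as `⨁_d V(d-1)`, the sum being over the members `d` of `parts` (with multiplicity): it has a
basis `b (x, j)`, `0 ≤ j < d`, where for each fixed `x` the vectors `b (x, j)` form the standard
basis of the irreducible `d`-dimensional module of highest weight `d - 1`. -/
def Encodes {m k : ℕ} (e h f : Module.End ℂ (SV m k)) (p : ZMod 2) (parts : Multiset ℕ) : Prop :=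
  ∃ b : Module.Basis (Σ x : parts, Fin x.1) ℂ (homog m k p),
    ∀ (x : parts) (j : Fin x.1),
      h (b ⟨x, j⟩ : SV m k) = ((x.1 : ℂ) - 1 - 2 * (j : ℕ)) • (b ⟨x, j⟩ : SV m k) ∧
      f (b ⟨x, j⟩ : SV m k) =
        (if hj : (j : ℕ) + 1 < x.1 then (b ⟨x, ⟨j + 1, hj⟩⟩ : SV m k) else 0) ∧
      e (b ⟨x, j⟩ : SV m k) =
        (((j : ℕ) : ℂ) * ((x.1 : ℂ) - (j : ℕ))) •
          (b ⟨x, ⟨j - 1, lt_of_le_of_lt (Nat.sub_le _ _) j.2⟩⟩ : SV m k)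

/-- The super exterior square `Λ²(ℂ^{m|2k})`, realised as the subspace of `V ⊗ V` spanned by the
tensors `v ∧ w = v ⊗ w - (-1)^{pr} w ⊗ v` with `v`, `w` of parities `p`, `r`. -/
noncomputable def extSq (m k : ℕ) : Submodule ℂ (SV m k ⊗[ℂ] SV m k) :=
  Submodule.span ℂ {t | ∃ p r, ∃ v ∈ homog m k p, ∃ w ∈ homog m k r,
    t = v ⊗ₜ[ℂ] w - ksign p r • (w ⊗ₜ[ℂ] v)}

/-- The operator acting as `(-1)^{pr}` on vectors of parity `r`. -/
noncomputable def twist {m k : ℕ} (p : ZMod 2) : Module.End ℂ (SV m k) :=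
  LinearMap.pi fun i => ksign p (par i) • LinearMap.proj i

/-- The action of an operator `X` of parity `p` on `V ⊗ V`:
`X (v ⊗ w) = X v ⊗ w + (-1)^{pr} v ⊗ X w` for `v` of parity `r`. -/
noncomputable def tensAct {m k : ℕ} (p : ZMod 2) (X : Module.End ℂ (SV m k)) :
    Module.End ℂ (SV m k ⊗[ℂ] SV m k) :=
  TensorProduct.map X LinearMap.id + TensorProduct.map (twist p) X

theorem twist_apply {m k : ℕ} (p r : ZMod 2) {v : SV m k} (hv : v ∈ homog m k r) :
    twist p v = ksign p r • v := by
  funext i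
  by_cases hi : par i = r
  · simp [twist, hi]
  · simp [twist, hv i hi]

/-- `Λ²(ℂ^{m|2k})` is stable under the action of `𝔤𝔩_{m|2k}`. -/
theorem tensAct_mem_extSq {m k : ℕ} {p : ZMod 2} {X : Module.End ℂ (SV m k)}
    (hX : X ∈ glPart m k p) {t : SV m k ⊗[ℂ] SV m k} (ht : t ∈ extSq m k) :
    tensAct p X t ∈ extSq m k := by
  induction ht using Submodule.span_induction with
  | zero => simp
  | add a b _ _ ha hb => simpa using (extSq m k).add_mem ha hb
  | smul c a _ ha => simpa using (extSq m k).smul_mem c ha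
  | mem t ht =>
    obtain ⟨a, b, v, hv, w, hw, rfl⟩ := ht
    have h1 : X v ⊗ₜ[ℂ] w - ksign (a + p) b • (w ⊗ₜ[ℂ] X v) ∈ extSq m k :=
      Submodule.subset_span ⟨_, _, _, hX a v hv, w, hw, rfl⟩
    have h2 : v ⊗ₜ[ℂ] X w - ksign a (b + p) • (X w ⊗ₜ[ℂ] v) ∈ extSq m k :=
      Submodule.subset_span ⟨_, _, v, hv, _, hX b w hw, rfl⟩
    have h3 := (extSq m k).add_mem h1 ((extSq m k).smul_mem (ksign p a) h2)
    have e1 : ksign p a * ksign a (b + p) = ksign a b := by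
      rw [ksign_add_right, ksign_comm a p]
      linear_combination ksign a b * ksign_mul_self p a
    have e2 : ksign (a + p) b = ksign a b * ksign p b := by
      rw [ksign_comm, ksign_add_right, ksign_comm b a, ksign_comm b p]
    convert h3 using 1
    simp only [tensAct, LinearMap.add_apply, map_sub, map_smul, TensorProduct.map_tmul,
      LinearMap.id_apply, twist_apply p a hv, twist_apply p b hw, ← TensorProduct.smul_tmul',
      smul_add, smul_sub, smul_smul, e1, e2]
    abel

/-- The space of `𝔤^♮ ⊕ 𝔰`-module homomorphisms from `ℂ ⊗ adj` to `Λ²(ℂ^{m|2k})`, where `𝔰` is the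
Lie algebra generated by the triple `e, h, f`, `adj` its adjoint representation and `ℂ` the
trivial representation of `𝔤^♮`. -/
noncomputable def homTrivAdj {m k : ℕ} (e h f : Module.End ℂ (SV m k)) :
    Submodule ℂ (LieSubalgebra.lieSpan ℂ (Module.End ℂ (SV m k)) {e, h, f} →ₗ[ℂ] extSq m k) where
  carrier := {φ |
    (∀ y s : LieSubalgebra.lieSpan ℂ (Module.End ℂ (SV m k)) {e, h, f},
      (φ ⁅y, s⁆ : SV m k ⊗[ℂ] SV m k) = tensAct 0 (y : Module.End ℂ (SV m k)) (φ s)) ∧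
    ∀ p, ∀ X ∈ gnat e h f p, ∀ s, tensAct p X (φ s : SV m k ⊗[ℂ] SV m k) = 0}
  add_mem' := fun {a b} ha hb => ⟨fun y s => by
    simp [ha.1 y s, hb.1 y s], fun p X hX s => by simp [ha.2 p X hX s, hb.2 p X hX s]⟩
  zero_mem' := ⟨fun y s => by simp, fun p X _ s => by simp⟩
  smul_mem' := fun c φ hφ => ⟨fun y s => by simp [hφ.1 y s], fun p X hX s => by
    simp [hφ.2 p X hX s]⟩

/-- The multiplicity of the irreducible representation `ℂ ⊗ adj` of `𝔤^♮ ⊕ 𝔰` in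
`Λ²(ℂ^{m|2k})`. -/
noncomputable def multTrivAdj {m k : ℕ} (e h f : Module.End ℂ (SV m k)) : ℕ :=
  Module.finrank ℂ (homTrivAdj e h f)

/-- The set `{m_1, …, m_t}` of distinct parts occurring in a pair of partitions. -/
def distinctParts (α β : Multiset ℕ) : Finset ℕ := α.toFinset ∪ β.toFinset

/-- The multiplicity formula. With `μ_q`, `ν_q` the multiplicities of `q` in `α`, `β`: the number
of distinct parts `q > 1`, plus the number of pairs `(q, q')` of odd parts with `q = q' + 2`,
`μ_q = μ_{q'} = 1`, `ν_q = ν_{q'} = 0`, plus the number of pairs `(q, q')` of even parts with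
`q = q' + 2`, `ν_q = ν_{q'} = 1`, `μ_q = μ_{q'} = 0`. -/
def multFormula (α β : Multiset ℕ) : ℕ :=
  ((distinctParts α β).filter fun q => 1 < q).card +
  ((distinctParts α β ×ˢ distinctParts α β).filter fun x =>
    x.1 = x.2 + 2 ∧ α.count x.1 = 1 ∧ α.count x.2 = 1 ∧ β.count x.1 = 0 ∧ β.count x.2 = 0 ∧
      Odd x.1 ∧ Odd x.2).card +
  ((distinctParts α β ×ˢ distinctParts α β).filter fun x =>
    x.1 = x.2 + 2 ∧ β.count x.1 = 1 ∧ β.count x.2 = 1 ∧ α.count x.1 = 0 ∧ α.count x.2 = 0 ∧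
      Even x.1 ∧ Even x.2).card

/-- The partition `(q^l)`. -/
abbrev pw (q l : ℕ) : Multiset ℕ := Multiset.replicate l q

/-- The twelve families of pairs `(α|β)` of partitions of `m` and `n`, in order; here `q ≥ 2` and
`l ≥ 1`, while the other multiplicities may be zero. -/
def IsListed (m n : ℕ) (α β : Multiset ℕ) : Prop :=
  ∃ q l r : ℕ, 2 ≤ q ∧ 1 ≤ l ∧
    ((α = pw q l + pw 1 r ∧ β = 0 ∧ (Even q → Even l) ∧ 4 < m) ∨
     (α = 0 ∧ β = pw q l + pw 1 r ∧ (Odd q → Even l) ∧ Even r) ∨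
     (α = pw q l ∧ β = pw 1 n ∧ (Even q → Even l)) ∨
     (α = pw q l + {1} ∧ β = pw 1 n ∧ (Even q → Even l)) ∨
     (α = pw 1 m ∧ β = pw q l ∧ (Odd q → Even l)) ∨
     (α = {1} ∧ β = pw q l + pw 1 r ∧ (Odd q → Even l) ∧ Even r) ∨
     (α = {q} + pw 1 r ∧ β = pw q l ∧ Even l ∧ Odd q) ∨
     (α = pw q l ∧ β = {q} + pw 1 r ∧ Even q ∧ Even l ∧ Even r) ∨
     (α = pw q l + pw 1 r ∧ β = {q} ∧ Even l ∧ Even q) ∨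
     (α = {q} + {1} ∧ β = pw q l + pw 1 r ∧ Even l ∧ Odd q ∧ Even r) ∨
     (α = pw q l + {1} ∧ β = {q} + pw 1 r ∧ Even q ∧ Even l ∧ Even r) ∨
     (α = {q} ∧ β = pw q l + pw 1 r ∧ Even l ∧ Odd q ∧ Even r))

end OspW

/-! Write V for the superspace. The form identifies V ⊗ V with End V by sending v ⊗ w to (w|·)v
(`tensorEnd`). Under this map Λ²V becomes 𝔬𝔰𝔭, and the action on tensors becomes the superbracket. A
homomorphism ℂ ⊗ adj → Λ²V is determined by the image T of e, and T ranges exactly over the elements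
of 𝔬𝔰𝔭 with [e,T] = 0 and [h,T] = 2T that supercommute with 𝔤^♮. No nonzero odd T exists
(`odd_eq_zero`), so the multiplicity is the dimension of `adjHighest`.

To compute that dimension, V is decomposed into strings, one for each part of α or β. The form on V
induces a nondegenerate Gram matrix on the multiplicity spaces. On the space attached to (q, parity)
it is symmetric when the strings are even with q odd or odd with q even, and skew otherwise. The
algebra 𝔤^♮ acts through the multiplicity spaces and contains every element x ⊗ y ∓ y ⊗ x with x, y
of equal length.

Commutation with these elements has two consequences. If a length q carries at least two strings, T
does not mix them with other lengths. On the strings of a single length, skewness of T makes its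
multiplicity matrix self-adjoint, and commutation then makes it scalar, so T is a multiple of e
there. This gives one parameter for each part q > 1. If a length carries a single string, that
string has nonzero norm, so its parity is determined by q mod 2, and 𝔤^♮ kills it. Two such strings
can be mixed by T only when their lengths differ by 2, since otherwise V(a) ⊗ V(b) with a ≠ b
contains no copy of adj. Skewness leaves one parameter per pair, realised by `pairOp`. These
parameters are independent (`finrank_adjHighest`), which gives the formula.

For the second claim, a pair contributing to the formula involves a second part greater than 1
unless the lengths are 3 and 1. With only one part greater than 1, that pair forces m = 4 and n = 0,
which is excluded. So multiplicity one means exactly one part greater than 1. The structure of 𝔤^♮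
enters through one property: in a reductive algebra plus copies of 𝔬𝔰𝔭_{1|2r}, an odd element with
square zero vanishes. If some length had two strings of symmetric type and one of skew type, an
isotropic combination of the two would produce a nonzero odd element of square zero. Together with
the evenness of skew multiplicities, this leaves the twelve families. -/

namespace OspW

/-! ### The supersymmetric form and the parity operator. -/

section FormBasics

variable {m k : ℕ}

theorem zmod_two_cases (p : ZMod 2) : p = 0 ∨ p = 1 := by
  revert p; decide

theorem ksign_zero_left (p : ZMod 2) : ksign 0 p = 1 := by simp [ksign]

theorem ksign_zero_right (p : ZMod 2) : ksign p 0 = 1 := by simp [ksign]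

theorem ksign_one_one : ksign 1 1 = -1 := by simp [ksign]

theorem form_apply (v w : SV m k) :
    form m k v w = ∑ i, v (Sum.inl i) * w (Sum.inl (Fin.rev i)) +
      (∑ a, v (Sum.inr (Sum.inl a)) * w (Sum.inr (Sum.inr (Fin.rev a))) -
      ∑ a, v (Sum.inr (Sum.inr a)) * w (Sum.inr (Sum.inl (Fin.rev a)))) := by
  simp [form, Matrix.toBilin'_apply, Fintype.sum_sum_type, antiDiag, sub_eq_add_neg]

theorem form_nondegenerate : (form m k).Nondegenerate := by
  have hl : ∀ v : SV m k, (∀ w, form m k v w = 0) → v = 0 := by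
    intro v hv
    funext i
    rcases i with i | a | a
    · simpa [form_apply, Pi.single_apply] using hv (Pi.single (Sum.inl (Fin.rev i)) 1)
    · simpa [form_apply, Pi.single_apply] using hv (Pi.single (Sum.inr (Sum.inr (Fin.rev a))) 1)
    · simpa [form_apply, Pi.single_apply] using hv (Pi.single (Sum.inr (Sum.inl (Fin.rev a))) 1)
  have hr : ∀ w : SV m k, (∀ v, form m k v w = 0) → w = 0 := by
    intro v hv
    funext i
    rcases i with i | a | a
    · have := hv (Pi.single (Sum.inl (Fin.rev i)) 1)
      simpa [form_apply, Pi.single_apply] using this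
    · have := hv (Pi.single (Sum.inr (Sum.inr (Fin.rev a))) 1)
      simpa [form_apply, Pi.single_apply] using this
    · have := hv (Pi.single (Sum.inr (Sum.inl (Fin.rev a))) 1)
      simpa [form_apply, Pi.single_apply] using this
  exact ⟨hl, hr⟩

theorem eq_zero_of_form_left {v : SV m k} (hv : ∀ w, form m k v w = 0) : v = 0 :=
  form_nondegenerate.1 v hv

theorem eq_zero_of_form_right {w : SV m k} (hw : ∀ v, form m k v w = 0) : w = 0 :=
  form_nondegenerate.2 w hw

theorem eq_of_form_right {w w' : SV m k} (hw : ∀ v, form m k v w = form m k v w') : w = w' :=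
  sub_eq_zero.1 (eq_zero_of_form_right fun v => by rw [map_sub, hw, sub_self])

theorem twist_apply_apply (p : ZMod 2) (v : SV m k) (i : Idx m k) :
    twist p v i = ksign p (par i) * v i := by
  simp [twist]

theorem twist_zero : (twist 0 : Module.End ℂ (SV m k)) = 1 := by
  ext v i; simp [twist_apply_apply, ksign_zero_left]

theorem twist_twist (p : ZMod 2) (v : SV m k) : twist p (twist p v) = v := by
  funext i
  rw [twist_apply_apply, twist_apply_apply, ← mul_assoc, ksign_mul_self, one_mul]

theorem form_comm (v w : SV m k) : form m k v w = form m k w (twist 1 v) := by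
  simp only [form_apply, twist_apply_apply, par, ksign_one_one, ksign_zero_right]
  rw [← Equiv.sum_comp Fin.revPerm (fun i => v (Sum.inl i) * w (Sum.inl (Fin.rev i))),
    ← Equiv.sum_comp Fin.revPerm
      (fun i => v (Sum.inr (Sum.inl i)) * w (Sum.inr (Sum.inr (Fin.rev i)))),
    ← Equiv.sum_comp Fin.revPerm
      (fun i => v (Sum.inr (Sum.inr i)) * w (Sum.inr (Sum.inl (Fin.rev i))))]
  simp only [Fin.revPerm_apply, Fin.rev_rev, neg_mul, one_mul, mul_neg, Finset.sum_neg_distrib]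
  simp only [mul_comm]
  ring

theorem form_twist (p : ZMod 2) (v w : SV m k) :
    form m k (twist p v) w = form m k v (twist p w) := by
  simp only [form_apply, twist_apply_apply, par]
  congr 1
  · exact Finset.sum_congr rfl fun _ _ => by ring
  · congr 1 <;> exact Finset.sum_congr rfl fun _ _ => by ring

/-- The parity operator `twist 1` is self-adjoint, and the homogeneous components are its
eigenspaces for 1 and -1. -/
theorem form_eq_zero_of_ne {p r : ZMod 2} {v w : SV m k} (hv : v ∈ homog m k p)
    (hw : w ∈ homog m k r) (h : p ≠ r) : form m k v w = 0 := by
  have h1 := form_twist 1 v w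
  rw [twist_apply 1 _ hv, twist_apply 1 _ hw] at h1
  rw [map_smul, map_smul, LinearMap.smul_apply, smul_eq_mul, smul_eq_mul] at h1
  rcases zmod_two_cases p with rfl | rfl <;> rcases zmod_two_cases r with rfl | rfl
  · exact absurd rfl h
  · rw [ksign_one_one, ksign_zero_right] at h1
    linear_combination (1 / 2) * h1
  · rw [ksign_one_one, ksign_zero_right] at h1
    linear_combination (-1 / 2) * h1
  · exact absurd rfl h

theorem form_homog_comm {p r : ZMod 2} {v w : SV m k} (hv : v ∈ homog m k p)
    (hw : w ∈ homog m k r) : form m k v w = ksign p r * form m k w v := by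
  rw [form_comm, twist_apply 1 _ hv, map_smul, smul_eq_mul]
  by_cases h : p = r
  · subst h
    rcases zmod_two_cases p with rfl | rfl <;> simp [ksign]
  · rw [form_eq_zero_of_ne hw hv (Ne.symm h)]; simp

theorem add_twist_mem_homog (v : SV m k) : v + twist 1 v ∈ homog m k 0 := by
  intro i hi
  have : par i = 1 := (zmod_two_cases _).resolve_left hi
  simp [twist_apply_apply, this, ksign_one_one]

theorem sub_twist_mem_homog (v : SV m k) : v - twist 1 v ∈ homog m k 1 := by
  intro i hi
  have : par i = 0 := (zmod_two_cases _).resolve_right hi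
  simp [twist_apply_apply, this, ksign_zero_right]

theorem exists_homog_add (v : SV m k) :
    ∃ v₀ ∈ homog m k 0, ∃ v₁ ∈ homog m k 1, v = v₀ + v₁ :=
  ⟨(1 / 2 : ℂ) • (v + twist 1 v), Submodule.smul_mem _ _ (add_twist_mem_homog v),
    (1 / 2 : ℂ) • (v - twist 1 v), Submodule.smul_mem _ _ (sub_twist_mem_homog v), by module⟩

/-- Absorbing the sign into `twist p` makes the invariance condition linear in v, so homogeneity is
no longer needed. -/
theorem osp_form {p : ZMod 2} {X : Module.End ℂ (SV m k)} (hX : X ∈ osp m k p) (v w : SV m k) :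
    form m k (X v) w = -form m k (twist p v) (X w) := by
  obtain ⟨v₀, h₀, v₁, h₁, rfl⟩ := exists_homog_add v
  simp only [map_add, LinearMap.add_apply, hX.2 _ _ h₀, hX.2 _ _ h₁, twist_apply p _ h₀,
    twist_apply p _ h₁, map_smul, LinearMap.smul_apply, smul_eq_mul]
  ring

theorem osp_zero_form {X : Module.End ℂ (SV m k)} (hX : X ∈ osp m k 0) (v w : SV m k) :
    form m k (X v) w = -form m k v (X w) := by
  rw [osp_form hX, twist_zero, Module.End.one_apply]

theorem glPart_twist {p : ZMod 2} {X : Module.End ℂ (SV m k)} (hX : X ∈ glPart m k p)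
    (v : SV m k) : twist 1 (X v) = ksign 1 p • X (twist 1 v) := by
  obtain ⟨v₀, h₀, v₁, h₁, rfl⟩ := exists_homog_add v
  simp only [map_add, twist_apply 1 _ h₀, twist_apply 1 _ h₁, twist_apply 1 _ (hX _ _ h₀),
    twist_apply 1 _ (hX _ _ h₁), ksign_add_right, ksign_zero_right, map_smul, smul_add, smul_smul]
  ring_nf

theorem mem_homog_of_twist {p : ZMod 2} {v : SV m k} (h : twist 1 v = ksign 1 p • v) :
    v ∈ homog m k p := by
  intro i hi
  have h1 := congrFun h i
  rw [twist_apply_apply, Pi.smul_apply, smul_eq_mul] at h1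
  rcases zmod_two_cases p with rfl | rfl
  · have : par i = 1 := (zmod_two_cases _).resolve_left hi
    rw [this, ksign_one_one, ksign_zero_right] at h1
    linear_combination (-1 / 2) * h1
  · have : par i = 0 := (zmod_two_cases _).resolve_right hi
    rw [this, ksign_one_one, ksign_zero_right] at h1
    linear_combination (1 / 2) * h1

/-- Turns the parity of an operator into a linear identity, which can be checked on a basis of
homogeneous vectors. -/
theorem mem_glPart_of_twist {p : ZMod 2} {X : Module.End ℂ (SV m k)}
    (h : ∀ v, twist 1 (X v) = ksign 1 p • X (twist 1 v)) : X ∈ glPart m k p := by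
  intro r v hv
  apply mem_homog_of_twist
  rw [h, twist_apply 1 _ hv, map_smul, smul_smul, ksign_add_right, mul_comm]

end FormBasics

/-! ### Identification of the super exterior square with the orthosymplectic algebra. -/

section TensorEnd

variable {m k : ℕ}

/-- The isomorphism `V ⊗ V ≃ End V` sending `v ⊗ w` to `z ↦ (w|z) v`. -/
noncomputable def tensorEnd (m k : ℕ) : (SV m k ⊗[ℂ] SV m k) ≃ₗ[ℂ] Module.End ℂ (SV m k) :=
  (TensorProduct.comm ℂ (SV m k) (SV m k)).trans
    ((TensorProduct.congr ((form m k).toDual form_nondegenerate)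
      (LinearEquiv.refl ℂ (SV m k))).trans
      (dualTensorHomEquiv ℂ (SV m k) (SV m k)))

theorem tensorEnd_tmul (v w z : SV m k) :
    tensorEnd m k (v ⊗ₜ[ℂ] w) z = form m k w z • v := by
  simp [tensorEnd, LinearMap.BilinForm.toDual_def]

/-- Conjugation by `twist p` multiplies an operator of parity r by (-1)^{pr}, so the right-hand side
is the superbracket extended linearly to operators that need not be homogeneous. -/
theorem tensorEnd_tensAct {p : ZMod 2} {X : Module.End ℂ (SV m k)} (hX : X ∈ osp m k p)
    (t : SV m k ⊗[ℂ] SV m k) :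
    tensorEnd m k (tensAct p X t) =
      X * tensorEnd m k t - twist p * tensorEnd m k t * twist p * X := by
  induction t with
  | zero => simp
  | add a b ha hb => rw [map_add, map_add, ha, hb, map_add]; noncomm_ring
  | tmul v w =>
    refine LinearMap.ext fun z => ?_
    simp only [tensAct, LinearMap.add_apply, TensorProduct.map_tmul, LinearMap.id_apply, map_add,
      tensorEnd_tmul, LinearMap.sub_apply, Module.End.mul_apply, map_smul, osp_form hX w z,
      form_twist]
    module

theorem commute_twist_of_osp_zero {T : Module.End ℂ (SV m k)} (hT : T ∈ osp m k 0) (p : ZMod 2) :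
    twist p * T * twist p = T := by
  refine LinearMap.ext fun v => ?_
  rcases zmod_two_cases p with rfl | rfl
  · simp [twist_zero]
  · simp [glPart_twist hT.1, twist_twist, ksign_zero_right]

theorem form_smul_mem_homog {p r s : ZMod 2} {v w z : SV m k} (hv : v ∈ homog m k p)
    (hw : w ∈ homog m k r) (hz : z ∈ homog m k s) :
    form m k w z • v ∈ homog m k (s + (p + r)) := by
  by_cases h : r = s
  · subst h
    have : r + (p + r) = p := by
      rw [add_comm p, ← add_assoc, CharTwo.add_self_eq_zero, zero_add]
    rw [this]
    exact Submodule.smul_mem _ _ hv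
  · rw [form_eq_zero_of_ne hw hz h, zero_smul]
    exact Submodule.zero_mem _

theorem ksign_mul_form {p r s : ZMod 2} {v w : SV m k} (hv : v ∈ homog m k p)
    (hw : w ∈ homog m k r) : ksign s p * form m k v w = ksign s r * form m k v w := by
  by_cases h : p = r
  · rw [h]
  · rw [form_eq_zero_of_ne hv hw h, mul_zero, mul_zero]

theorem tensorEnd_wedge {p r : ZMod 2} {v w : SV m k} (hv : v ∈ homog m k p)
    (hw : w ∈ homog m k r) :
    tensorEnd m k (v ⊗ₜ[ℂ] w - ksign p r • (w ⊗ₜ[ℂ] v)) ∈ osp m k (p + r) := by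
  refine ⟨fun s z hz => ?_, fun s z hz z' => ?_⟩
  · simp only [map_sub, map_smul, LinearMap.sub_apply, LinearMap.smul_apply, tensorEnd_tmul]
    refine Submodule.sub_mem _ (form_smul_mem_homog hv hw hz) (Submodule.smul_mem _ _ ?_)
    rw [add_comm p r]
    exact form_smul_mem_homog hw hv hz
  · simp only [map_sub, map_smul, LinearMap.sub_apply, LinearMap.smul_apply, tensorEnd_tmul,
      smul_eq_mul]
    rw [form_homog_comm hz hw, form_homog_comm hz hv, ksign_comm (p + r) s, ksign_add_right]
    have h1 := ksign_mul_form (s := p) hw hz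
    have h2 := ksign_mul_form (s := r) hv hz
    have h3 := ksign_mul_self s p
    have h4 := ksign_mul_self s r
    have h5 := ksign_mul_self p r
    rw [ksign_comm s p, ksign_comm s r, ksign_comm r p] at *
    linear_combination form m k v z' * ksign p r * h1 - form m k w z * form m k v z' * h5 -
      form m k v z' * form m k w z * ksign p s * ksign p r * h4 - form m k w z' * h2 +
      ksign r s * form m k w z' * form m k v z * h3

theorem tensorEnd_extSq {t : SV m k ⊗[ℂ] SV m k} (ht : t ∈ extSq m k) :
    tensorEnd m k t ∈ osp m k 0 ⊔ osp m k 1 := by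
  induction ht using Submodule.span_induction with
  | zero => simp
  | add a b _ _ ha hb => rw [map_add]; exact Submodule.add_mem _ ha hb
  | smul c a _ ha => rw [map_smul]; exact Submodule.smul_mem _ _ ha
  | mem t ht =>
    obtain ⟨p, r, v, hv, w, hw, rfl⟩ := ht
    have h := tensorEnd_wedge hv hw
    rcases zmod_two_cases (p + r) with h0 | h0 <;> rw [h0] at h
    · exact Submodule.mem_sup_left h
    · exact Submodule.mem_sup_right h

/-- The super flip on the even part of `V ⊗ V`. -/
noncomputable def evenFlip (m k : ℕ) : Module.End ℂ (SV m k ⊗[ℂ] SV m k) :=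
  TensorProduct.map (twist 1) LinearMap.id ∘ₗ (TensorProduct.comm ℂ (SV m k) (SV m k)).toLinearMap

theorem evenFlip_tmul (v w : SV m k) : evenFlip m k (v ⊗ₜ[ℂ] w) = twist 1 w ⊗ₜ[ℂ] v := by
  simp [evenFlip]

/-- The flip of tensors corresponds to taking adjoints with respect to the form. -/
theorem form_tensorEnd_evenFlip (t : SV m k ⊗[ℂ] SV m k) (z z' : SV m k) :
    form m k (tensorEnd m k t z) z' = form m k z (tensorEnd m k (evenFlip m k t) z') := by
  induction t with
  | zero => simp
  | add a b ha hb => simp only [map_add, LinearMap.add_apply, ha, hb]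
  | tmul v w =>
    rw [evenFlip_tmul, tensorEnd_tmul, tensorEnd_tmul, map_smul, map_smul, LinearMap.smul_apply,
      form_comm w z, smul_eq_mul, smul_eq_mul, mul_comm]

theorem tensorEnd_map_twist (t : SV m k ⊗[ℂ] SV m k) :
    tensorEnd m k (TensorProduct.map (twist 1) (twist 1) t) =
      twist 1 * tensorEnd m k t * twist 1 := by
  induction t with
  | zero => simp
  | add a b ha hb => rw [map_add, map_add, ha, hb, map_add]; noncomm_ring
  | tmul v w =>
    refine LinearMap.ext fun z => ?_
    simp only [TensorProduct.map_tmul, tensorEnd_tmul, Module.End.mul_apply, map_smul, form_twist]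

/-- Adding the image under `twist 1 ⊗ twist 1` doubles the even component of a tensor and removes
the odd one. On the even component `evenFlip` is the super flip, so what remains is a sum of wedges.
-/
theorem even_sub_flip_mem_extSq (t : SV m k ⊗[ℂ] SV m k) :
    (t - evenFlip m k t) + TensorProduct.map (twist 1) (twist 1) (t - evenFlip m k t) ∈
      extSq m k := by
  induction t with
  | zero => simp
  | add a b ha hb =>
    convert Submodule.add_mem _ ha hb using 1
    simp only [map_add, map_sub]
    abel
  | tmul v w =>
    obtain ⟨v₀, h₀, v₁, h₁, rfl⟩ := exists_homog_add v
    obtain ⟨w₀, k₀, w₁, k₁, rfl⟩ := exists_homog_add w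
    have e0 : v₀ ⊗ₜ[ℂ] w₀ - ksign 0 0 • (w₀ ⊗ₜ[ℂ] v₀) ∈ extSq m k :=
      Submodule.subset_span ⟨_, _, _, h₀, _, k₀, rfl⟩
    have e1 : v₁ ⊗ₜ[ℂ] w₁ - ksign 1 1 • (w₁ ⊗ₜ[ℂ] v₁) ∈ extSq m k :=
      Submodule.subset_span ⟨_, _, _, h₁, _, k₁, rfl⟩
    convert Submodule.add_mem _ (Submodule.smul_mem _ (2 : ℂ) e0)
      (Submodule.smul_mem _ (2 : ℂ) e1) using 1
    simp only [TensorProduct.add_tmul, TensorProduct.tmul_add, map_add, evenFlip_tmul,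
      map_sub, TensorProduct.map_tmul, twist_apply 1 _ h₀, twist_apply 1 _ h₁,
      twist_apply 1 _ k₀, twist_apply 1 _ k₁, ksign_one_one, ksign_zero_right, one_smul, neg_smul,
      TensorProduct.neg_tmul, TensorProduct.tmul_neg, neg_neg, map_neg]
    module

/-- Skewness of T says that the flip negates its tensor t, and evenness says that `twist 1 ⊗ twist
1` fixes t. -/
theorem tensorEnd_symm_mem_extSq {T : Module.End ℂ (SV m k)} (hT : T ∈ osp m k 0) :
    (tensorEnd m k).symm T ∈ extSq m k := by
  have h := even_sub_flip_mem_extSq ((tensorEnd m k).symm T)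
  have h1 : evenFlip m k ((tensorEnd m k).symm T) = -(tensorEnd m k).symm T := by
    apply (tensorEnd m k).injective
    rw [map_neg, LinearEquiv.apply_symm_apply]
    refine LinearMap.ext fun z' => eq_of_form_right fun z => ?_
    rw [← form_tensorEnd_evenFlip, LinearEquiv.apply_symm_apply, osp_zero_form hT,
      LinearMap.neg_apply, map_neg]
  have h2 : TensorProduct.map (twist 1) (twist 1) ((tensorEnd m k).symm T) =
      (tensorEnd m k).symm T := by
    apply (tensorEnd m k).injective
    rw [tensorEnd_map_twist, LinearEquiv.apply_symm_apply, commute_twist_of_osp_zero hT]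
  rw [h1, map_sub, map_neg, h2] at h
  -- Here t minus its flip is 2t, and symmetrising under the parity operator doubles it again, hence
  -- the factor 1/4.
  convert Submodule.smul_mem _ (1 / 4 : ℂ) h using 1
  module

end TensorEnd

/-! ### From equivariant maps to highest weight vectors of weight 2. -/

section Reduction

variable {m k : ℕ}

theorem end_lie_def (X Y : Module.End ℂ (SV m k)) : ⁅X, Y⁆ = X * Y - Y * X := rfl

theorem end_lie_add (X Y Z : Module.End ℂ (SV m k)) : ⁅X, Y + Z⁆ = ⁅X, Y⁆ + ⁅X, Z⁆ := by
  simp only [end_lie_def]; noncomm_ring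

theorem end_lie_smul (c : ℂ) (X Y : Module.End ℂ (SV m k)) : ⁅X, c • Y⁆ = c • ⁅X, Y⁆ := by
  simp only [end_lie_def, mul_smul_comm, smul_mul_assoc, smul_sub]

theorem end_smul_lie (c : ℂ) (X Y : Module.End ℂ (SV m k)) : ⁅c • X, Y⁆ = c • ⁅X, Y⁆ := by
  simp only [end_lie_def, mul_smul_comm, smul_mul_assoc, smul_sub]

theorem end_lie_neg (X Y : Module.End ℂ (SV m k)) : ⁅X, -Y⁆ = -⁅X, Y⁆ := by
  rw [← neg_one_smul ℂ Y, end_lie_smul]; exact neg_one_smul ℂ (X * Y - Y * X)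

theorem end_neg_lie (X Y : Module.End ℂ (SV m k)) : ⁅-X, Y⁆ = -⁅X, Y⁆ := by
  rw [← neg_one_smul ℂ X, end_smul_lie]; exact neg_one_smul ℂ (X * Y - Y * X)

theorem end_lie_zero (X : Module.End ℂ (SV m k)) : ⁅X, (0 : Module.End ℂ (SV m k))⁆ = 0 := by
  simp

theorem end_zero_lie (X : Module.End ℂ (SV m k)) : ⁅(0 : Module.End ℂ (SV m k)), X⁆ = 0 := by
  simp

theorem end_lie_self (X : Module.End ℂ (SV m k)) : ⁅X, X⁆ = 0 := by
  simp

theorem end_leibniz_lie (X Y Z : Module.End ℂ (SV m k)) :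
    ⁅X, ⁅Y, Z⁆⁆ = ⁅⁅X, Y⁆, Z⁆ + ⁅Y, ⁅X, Z⁆⁆ := by
  simp only [end_lie_def, mul_sub, sub_mul, mul_assoc]; abel

theorem osp_zero_lie {X Y : Module.End ℂ (SV m k)} (hX : X ∈ osp m k 0) (hY : Y ∈ osp m k 0) :
    ⁅X, Y⁆ ∈ osp m k 0 := by
  have := sbr_mem_osp hX hY
  rwa [sbr, ksign_zero_left, one_smul, add_zero, ← end_lie_def] at this

theorem tensorEnd_tensAct_zero {X : Module.End ℂ (SV m k)} (hX : X ∈ osp m k 0)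
    (t : SV m k ⊗[ℂ] SV m k) :
    tensorEnd m k (tensAct 0 X t) = ⁅X, tensorEnd m k t⁆ := by
  rw [tensorEnd_tensAct hX, twist_zero, one_mul, mul_one, end_lie_def]

/-- The even elements of `𝔬𝔰𝔭_{m|2k}` that are `𝔰`-highest weight vectors of weight `2` and commute
with `𝔤^♮`. -/
def adjHighest (e h f : Module.End ℂ (SV m k)) : Submodule ℂ (Module.End ℂ (SV m k)) where
  carrier := {T | T ∈ osp m k 0 ∧ ⁅e, T⁆ = 0 ∧ ⁅h, T⁆ = (2 : ℂ) • T ∧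
    ∀ p, ∀ X ∈ gnat e h f p, X * T = T * X}
  add_mem' := fun {a b} ha hb => ⟨(osp m k 0).add_mem ha.1 hb.1, by
    rw [end_lie_add, ha.2.1, hb.2.1, add_zero], by rw [end_lie_add, ha.2.2.1, hb.2.2.1, smul_add],
    fun p X hX => by rw [mul_add, add_mul, ha.2.2.2 p X hX, hb.2.2.2 p X hX]⟩
  zero_mem' := ⟨(osp m k 0).zero_mem, by simp, by simp, by simp⟩
  smul_mem' := fun c T hT => ⟨(osp m k 0).smul_mem c hT.1, by rw [end_lie_smul, hT.2.1, smul_zero],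
    by rw [end_lie_smul, hT.2.2.1, smul_comm], fun p X hX => by
      rw [mul_smul_comm, smul_mul_assoc, hT.2.2.2 p X hX]⟩

theorem homog_add_eq_zero {a b : Module.End ℂ (SV m k)} (ha : a ∈ glPart m k 0)
    (hb : b ∈ glPart m k 1) (h : a + b = 0) : a = 0 ∧ b = 0 := by
  have key : ∀ v, a v = 0 := by
    intro v
    have h1 := congrArg (twist 1) (LinearMap.congr_fun h v)
    have h2 := LinearMap.congr_fun h (twist 1 v)
    simp only [LinearMap.add_apply, map_add, glPart_twist ha, glPart_twist hb, ksign_one_one,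
      ksign_zero_right, LinearMap.zero_apply, map_zero] at h1 h2
    have h3 : a (twist 1 v) = 0 := by
      have : (2 : ℂ) • a (twist 1 v) = 0 := by
        linear_combination (norm := module) h1 + h2
      simpa using this
    rw [← twist_twist 1 (a v), glPart_twist ha, h3]; simp
  have ha0 : a = 0 := LinearMap.ext key
  exact ⟨ha0, by simpa [ha0] using h⟩

theorem glPart_mul {p r : ZMod 2} {X Y : Module.End ℂ (SV m k)} (hX : X ∈ glPart m k p)
    (hY : Y ∈ glPart m k r) : X * Y ∈ glPart m k (p + r) := by
  intro s v hv
  have := hX _ _ (hY s v hv)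
  rwa [add_assoc, add_comm r p] at this

theorem glPart_zero_lie {p : ZMod 2} {X Y : Module.End ℂ (SV m k)} (hX : X ∈ glPart m k 0)
    (hY : Y ∈ glPart m k p) : ⁅X, Y⁆ ∈ glPart m k p := by
  rw [end_lie_def]
  have h1 := glPart_mul hX hY
  have h2 := glPart_mul hY hX
  rw [zero_add] at h1
  rw [add_zero] at h2
  exact Submodule.sub_mem _ h1 h2

variable {e h f : Module.End ℂ (SV m k)}

theorem mem_lieSpan_iff (ht : IsSl2Triple h e f) (s : Module.End ℂ (SV m k)) :
    s ∈ LieSubalgebra.lieSpan ℂ (Module.End ℂ (SV m k)) {e, h, f} ↔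
      ∃ a b c : ℂ, s = a • e + b • f + c • h := by
  have hle : LieSubalgebra.lieSpan ℂ (Module.End ℂ (SV m k)) {e, h, f} ≤ ht.toLieSubalgebra ℂ := by
    rw [LieSubalgebra.lieSpan_le]
    intro x hx
    rw [SetLike.mem_coe, IsSl2Triple.mem_toLieSubalgebra_iff, ht.lie_e_f]
    rcases hx with rfl | rfl | rfl
    · exact ⟨1, 0, 0, by simp⟩
    · exact ⟨0, 0, 1, by simp⟩
    · exact ⟨0, 1, 0, by simp⟩
  constructor
  · intro hs
    have := hle hs
    rwa [IsSl2Triple.mem_toLieSubalgebra_iff, ht.lie_e_f] at this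
  · rintro ⟨a, b, c, rfl⟩
    have hsub := LieSubalgebra.subset_lieSpan (R := ℂ) (L := Module.End ℂ (SV m k))
      (s := {e, h, f})
    exact add_mem (add_mem (Submodule.smul_mem _ _ (hsub (by simp)))
      (Submodule.smul_mem _ _ (hsub (by simp)))) (Submodule.smul_mem _ _ (hsub (by simp)))

/-- `𝔰`, the span of the triple. -/
abbrev sl2Span (e h f : Module.End ℂ (SV m k)) : LieSubalgebra ℂ (Module.End ℂ (SV m k)) :=
  LieSubalgebra.lieSpan ℂ (Module.End ℂ (SV m k)) {e, h, f}

/-- The triple as elements of its span, in the order `e, f, h`. -/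
def sl2Vec (e h f : Module.End ℂ (SV m k)) : Fin 3 → sl2Span e h f :=
  ![⟨e, LieSubalgebra.subset_lieSpan (by simp)⟩, ⟨f, LieSubalgebra.subset_lieSpan (by simp)⟩,
    ⟨h, LieSubalgebra.subset_lieSpan (by simp)⟩]

/-- The vectors e, f, h are eigenvectors of ad h with eigenvalues 2, -2, 0. Applying ad h once and
twice to a relation separates them. -/
theorem sl2_linearIndependent (ht : IsSl2Triple h e f) {a b c : ℂ}
    (h0 : a • e + b • f + c • h = 0) : a = 0 ∧ b = 0 ∧ c = 0 := by
  have h1 : ⁅h, a • e + b • f + c • h⁆ = 0 := by rw [h0, end_lie_zero]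
  rw [end_lie_add, end_lie_add, end_lie_smul, end_lie_smul, end_lie_smul, ht.lie_h_e_smul ℂ, ht.lie_lie_smul_f ℂ,
    end_lie_self, smul_zero, add_zero] at h1
  have h2 : ⁅h, a • (2 : ℂ) • e + b • -((2 : ℂ) • f)⁆ = 0 := by rw [h1, end_lie_zero]
  simp only [end_lie_add, end_lie_smul, end_lie_neg, ht.lie_h_e_smul ℂ,
    ht.lie_lie_smul_f ℂ] at h2
  have ha : a • e = 0 := by
    linear_combination (norm := module) (1 / 4 : ℂ) • h1 + (1 / 8 : ℂ) • h2
  have hb : b • f = 0 := by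
    linear_combination (norm := module) (-1 / 4 : ℂ) • h1 + (1 / 8 : ℂ) • h2
  rw [ha, hb, zero_add, zero_add] at h0
  simpa [ht.e_ne_zero, ht.f_ne_zero, ht.h_ne_zero] using And.intro ha (And.intro hb h0)

/-- The basis `e, f, h` of `𝔰`. -/
noncomputable def sl2Basis (ht : IsSl2Triple h e f) : Module.Basis (Fin 3) ℂ (sl2Span e h f) :=
  Module.Basis.mk (v := sl2Vec e h f)
    (by
      rw [Fintype.linearIndependent_iff]
      intro g hg
      rw [Fin.sum_univ_three] at hg
      have := sl2_linearIndependent ht (congrArg Subtype.val hg)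
      intro i
      fin_cases i
      exacts [this.1, this.2.1, this.2.2])
    (by
      rintro ⟨s, hs⟩ -
      obtain ⟨a, b, c, rfl⟩ := (mem_lieSpan_iff ht s).1 hs
      have : (⟨a • e + b • f + c • h, hs⟩ : sl2Span e h f) =
        a • sl2Vec e h f 0 + b • sl2Vec e h f 1 + c • sl2Vec e h f 2 := rfl
      rw [this]
      refine add_mem (add_mem ?_ ?_) ?_ <;>
        exact Submodule.smul_mem _ _ (Submodule.subset_span ⟨_, rfl⟩))

theorem sl2_combination (ht : IsSl2Triple h e f) (s : sl2Span e h f) :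
    ∃ a b c : ℂ, s = a • sl2Vec e h f 0 + b • sl2Vec e h f 1 + c • sl2Vec e h f 2 := by
  obtain ⟨a, b, c, hs⟩ := (mem_lieSpan_iff ht s).1 s.2
  exact ⟨a, b, c, Subtype.ext hs⟩

theorem sl2Span_le_osp (ht : IsSl2Triple h e f) (he : e ∈ osp m k 0) (hh : h ∈ osp m k 0)
    (hf : f ∈ osp m k 0) (s : sl2Span e h f) : (s : Module.End ℂ (SV m k)) ∈ osp m k 0 := by
  obtain ⟨a, b, c, hs⟩ := (mem_lieSpan_iff ht s).1 s.2
  rw [hs]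
  exact add_mem (add_mem (Submodule.smul_mem _ _ he) (Submodule.smul_mem _ _ hf))
    (Submodule.smul_mem _ _ hh)

/-- A nonzero T is a primitive vector of weight 2 for the adjoint action, so ad f kills it after
three steps. -/
theorem sl2_ad_f_cubed (ht : IsSl2Triple h e f) {T : Module.End ℂ (SV m k)} (he : ⁅e, T⁆ = 0)
    (hh : ⁅h, T⁆ = (2 : ℂ) • T) : ⁅f, ⁅f, ⁅f, T⁆⁆⁆ = 0 := by
  by_cases hT : T = 0
  · simp [hT]
  have P : ht.HasPrimitiveVectorWith T (2 : ℂ) := ⟨hT, hh, he⟩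
  have := P.pow_toEnd_f_eq_zero_of_eq_nat (n := 2) (by norm_num)
  simpa [pow_succ] using this

/-- The equivariant map out of `𝔰` determined by a highest weight vector `T` of weight `2`. -/
noncomputable def adjMap (ht : IsSl2Triple h e f) (T : Module.End ℂ (SV m k)) :
    sl2Span e h f →ₗ[ℂ] Module.End ℂ (SV m k) :=
  -- In 𝔰 one has h = -[f,e] and f = (1/2)[f,h] = -(1/2)[f,[f,e]], which forces the images of f and
  -- h once e goes to T. The order of the basis is e, f, h.
  (sl2Basis ht).constr ℂ ![T, (-1 / 2 : ℂ) • ⁅f, ⁅f, T⁆⁆, -⁅f, T⁆]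

theorem adjMap_sl2Vec (ht : IsSl2Triple h e f) (T : Module.End ℂ (SV m k)) (i : Fin 3) :
    adjMap ht T (sl2Vec e h f i) = ![T, (-1 / 2 : ℂ) • ⁅f, ⁅f, T⁆⁆, -⁅f, T⁆] i := by
  have : sl2Vec e h f i = sl2Basis ht i := by simp [sl2Basis]
  rw [this, adjMap, Module.Basis.constr_basis]

theorem adjMap_lie (ht : IsSl2Triple h e f) {T : Module.End ℂ (SV m k)} (he : ⁅e, T⁆ = 0)
    (hh : ⁅h, T⁆ = (2 : ℂ) • T) (y s : sl2Span e h f) :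
    adjMap ht T ⁅y, s⁆ = ⁅(y : Module.End ℂ (SV m k)), adjMap ht T s⁆ := by
  have hf3 := sl2_ad_f_cubed ht he hh
  have hv := adjMap_sl2Vec ht T
  have v0 := hv 0
  have v1 := hv 1
  have v2 := hv 2
  simp only [Matrix.cons_val] at v0 v1 v2
  have c0 : (sl2Vec e h f 0 : Module.End ℂ (SV m k)) = e := rfl
  have c1 : (sl2Vec e h f 1 : Module.End ℂ (SV m k)) = f := rfl
  have c2 : (sl2Vec e h f 2 : Module.End ℂ (SV m k)) = h := rfl
  have b01 : ⁅sl2Vec e h f 0, sl2Vec e h f 1⁆ = sl2Vec e h f 2 := Subtype.ext ht.lie_e_f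
  have b10 : ⁅sl2Vec e h f 1, sl2Vec e h f 0⁆ = -sl2Vec e h f 2 := by rw [← lie_skew, b01]
  have b20 : ⁅sl2Vec e h f 2, sl2Vec e h f 0⁆ = (2 : ℂ) • sl2Vec e h f 0 :=
    Subtype.ext (ht.lie_h_e_smul ℂ)
  have b02 : ⁅sl2Vec e h f 0, sl2Vec e h f 2⁆ = -((2 : ℂ) • sl2Vec e h f 0) := by
    rw [← lie_skew, b20]
  have b21 : ⁅sl2Vec e h f 2, sl2Vec e h f 1⁆ = -((2 : ℂ) • sl2Vec e h f 1) :=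
    Subtype.ext (ht.lie_lie_smul_f ℂ)
  have b12 : ⁅sl2Vec e h f 1, sl2Vec e h f 2⁆ = (2 : ℂ) • sl2Vec e h f 1 := by
    rw [← lie_skew, b21, neg_neg]
  have hfT : ⁅h, ⁅f, T⁆⁆ = 0 := by
    rw [end_leibniz_lie, ht.lie_lie_smul_f ℂ, hh, end_neg_lie, end_smul_lie, end_lie_smul, neg_add_cancel]
  have hffT : ⁅h, ⁅f, ⁅f, T⁆⁆⁆ = -((2 : ℂ) • ⁅f, ⁅f, T⁆⁆) := by
    rw [end_leibniz_lie, ht.lie_lie_smul_f ℂ, hfT, end_neg_lie, end_smul_lie, end_lie_zero, add_zero]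
  have efT : ⁅e, ⁅f, T⁆⁆ = (2 : ℂ) • T := by
    rw [end_leibniz_lie, ht.lie_e_f, he, end_lie_zero, add_zero, hh]
  have effT : ⁅e, ⁅f, ⁅f, T⁆⁆⁆ = (2 : ℂ) • ⁅f, T⁆ := by
    rw [end_leibniz_lie, ht.lie_e_f, efT, end_lie_smul, hfT, zero_add]
  obtain ⟨a, b, c, rfl⟩ := sl2_combination ht y
  obtain ⟨a', b', c', rfl⟩ := sl2_combination ht s
  have hcoe : ((a • sl2Vec e h f 0 + b • sl2Vec e h f 1 + c • sl2Vec e h f 2 : sl2Span e h f) :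
      Module.End ℂ (SV m k)) = a • e + b • f + c • h := rfl
  rw [hcoe]
  simp only [add_lie, lie_add, smul_lie, lie_smul, lie_self, b01, b10, b20, b02, b21, b12, map_add,
    map_smul, map_neg, v0, v1, v2, map_zero]
  simp only [end_smul_lie, end_lie_smul, end_lie_neg, he, hh, hf3, hfT,
    hffT, efT, effT]
  module

theorem adjMap_mem_osp (ht : IsSl2Triple h e f) (hf : f ∈ osp m k 0) {T : Module.End ℂ (SV m k)}
    (hT : T ∈ osp m k 0) (s : sl2Span e h f) : adjMap ht T s ∈ osp m k 0 := by
  obtain ⟨a, b, c, rfl⟩ := sl2_combination ht s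
  simp only [map_add, map_smul, adjMap_sl2Vec, Matrix.cons_val]
  have h1 := osp_zero_lie hf hT
  exact add_mem (add_mem (Submodule.smul_mem _ _ hT) (Submodule.smul_mem _ _
    (Submodule.smul_mem _ _ (osp_zero_lie hf h1)))) (Submodule.smul_mem _ _ (neg_mem h1))

theorem adjMap_commute (ht : IsSl2Triple h e f) {T X : Module.End ℂ (SV m k)}
    (hX : ⁅X, f⁆ = 0) (hT : ⁅X, T⁆ = 0) (s : sl2Span e h f) : ⁅X, adjMap ht T s⁆ = 0 := by
  obtain ⟨a, b, c, rfl⟩ := sl2_combination ht s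
  have h1 : ⁅X, ⁅f, T⁆⁆ = 0 := by rw [end_leibniz_lie, hX, hT, end_zero_lie, end_lie_zero, add_zero]
  have h2 : ⁅X, ⁅f, ⁅f, T⁆⁆⁆ = 0 := by rw [end_leibniz_lie, hX, h1, end_zero_lie, end_lie_zero, add_zero]
  simp only [map_add, map_smul, adjMap_sl2Vec, Matrix.cons_val, end_lie_add, end_lie_smul,
    end_lie_neg, h1, h2, hT, smul_zero, neg_zero, add_zero]

/-- Evaluation at `e` of a homomorphism `ℂ ⊗ adj → Λ²V`, as an operator. -/
noncomputable def homEval (e h f : Module.End ℂ (SV m k)) :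
    homTrivAdj e h f →ₗ[ℂ] Module.End ℂ (SV m k) :=
  (tensorEnd m k).toLinearMap ∘ₗ (extSq m k).subtype ∘ₗ
    LinearMap.applyₗ (sl2Vec e h f 0) ∘ₗ (homTrivAdj e h f).subtype

theorem homEval_apply (φ : homTrivAdj e h f) :
    homEval e h f φ = tensorEnd m k (φ.1 (sl2Vec e h f 0)) := rfl

/-- Repeated application of ad f to e reaches h and f up to scalars, so e generates the adjoint
module. -/
theorem homEval_injective (ht : IsSl2Triple h e f) : Function.Injective (homEval e h f) := by
  intro φ ψ hφ
  have h0 : φ.1 (sl2Vec e h f 0) = ψ.1 (sl2Vec e h f 0) :=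
    Subtype.ext ((tensorEnd m k).injective hφ)
  have b10 : ⁅sl2Vec e h f 1, sl2Vec e h f 0⁆ = (-1 : ℂ) • sl2Vec e h f 2 := by
    rw [← lie_skew, neg_one_smul]; exact congrArg Neg.neg (Subtype.ext ht.lie_e_f)
  have b12 : ⁅sl2Vec e h f 1, sl2Vec e h f 2⁆ = (2 : ℂ) • sl2Vec e h f 1 := by
    rw [← lie_skew, neg_eq_iff_eq_neg]; exact Subtype.ext (ht.lie_lie_smul_f ℂ)
  have h2 : φ.1 (sl2Vec e h f 2) = ψ.1 (sl2Vec e h f 2) := by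
    have h1 := φ.2.1 (sl2Vec e h f 1) (sl2Vec e h f 0)
    rw [h0, ← ψ.2.1, b10, map_smul, map_smul] at h1
    exact smul_right_injective _ (by norm_num : (-1 : ℂ) ≠ 0) (Subtype.ext h1)
  have h1 : φ.1 (sl2Vec e h f 1) = ψ.1 (sl2Vec e h f 1) := by
    have h1 := φ.2.1 (sl2Vec e h f 1) (sl2Vec e h f 2)
    rw [h2, ← ψ.2.1, b12, map_smul, map_smul] at h1
    exact smul_right_injective _ (by norm_num : (2 : ℂ) ≠ 0) (Subtype.ext h1)
  refine Subtype.ext (LinearMap.ext fun s => ?_)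
  obtain ⟨a, b, c, rfl⟩ := sl2_combination ht s
  simp only [map_add, map_smul, h0, h1, h2]

/-- A homomorphism need not respect parity, so the image of e is a priori a sum of an even and an
odd element of 𝔬𝔰𝔭. The conditions from the even operators e, h and the even part of 𝔤^♮ split by
parity, and `hodd` discards the odd summand. Conversely, `adjMap` extends a highest weight vector to
all of 𝔰. -/
theorem range_homEval (ht : IsSl2Triple h e f) (he : e ∈ osp m k 0) (hh : h ∈ osp m k 0)
    (hf : f ∈ osp m k 0)
    (hodd : ∀ T ∈ osp m k 1, ⁅e, T⁆ = 0 → ⁅h, T⁆ = (2 : ℂ) • T →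
      (∀ X ∈ gnat e h f 0, X * T = T * X) → T = 0) :
    LinearMap.range (homEval e h f) = adjHighest e h f := by
  apply le_antisymm
  · rintro _ ⟨φ, rfl⟩
    set t := φ.1 (sl2Vec e h f 0) with htdef
    obtain ⟨T₀, hT₀, T₁, hT₁, hT⟩ := Submodule.mem_sup.1 (tensorEnd_extSq t.2)
    have heT : ⁅e, T₀ + T₁⁆ = 0 := by
      have := φ.2.1 (sl2Vec e h f 0) (sl2Vec e h f 0)
      rw [lie_self, map_zero] at this
      rw [hT, ← tensorEnd_tensAct_zero he]
      exact (congrArg (tensorEnd m k) this.symm).trans (map_zero _)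
    have hhT : ⁅h, T₀ + T₁⁆ = (2 : ℂ) • (T₀ + T₁) := by
      have := φ.2.1 (sl2Vec e h f 2) (sl2Vec e h f 0)
      have b20 : ⁅sl2Vec e h f 2, sl2Vec e h f 0⁆ = (2 : ℂ) • sl2Vec e h f 0 :=
        Subtype.ext (ht.lie_h_e_smul ℂ)
      rw [b20, map_smul] at this
      rw [hT, ← tensorEnd_tensAct_zero hh, ← map_smul]
      exact (congrArg (tensorEnd m k) this.symm)
    have hg : ∀ p, ∀ X ∈ gnat e h f p,
        X * (T₀ + T₁) - twist p * (T₀ + T₁) * twist p * X = 0 := by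
      intro p X hX
      rw [hT, ← tensorEnd_tensAct hX.1, φ.2.2 p X hX, map_zero]
    have hT₁0 : T₁ = 0 := by
      refine hodd T₁ hT₁ ?_ ?_ ?_
      · rw [end_lie_add] at heT
        exact (homog_add_eq_zero (glPart_zero_lie he.1 hT₀.1) (glPart_zero_lie he.1 hT₁.1) heT).2
      · have : (⁅h, T₀⁆ - (2 : ℂ) • T₀) + (⁅h, T₁⁆ - (2 : ℂ) • T₁) = 0 := by
          rw [end_lie_add] at hhT
          linear_combination (norm := module) hhT
        exact sub_eq_zero.1 (homog_add_eq_zero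
          (Submodule.sub_mem _ (glPart_zero_lie hh.1 hT₀.1) (Submodule.smul_mem _ _ hT₀.1))
          (Submodule.sub_mem _ (glPart_zero_lie hh.1 hT₁.1) (Submodule.smul_mem _ _ hT₁.1))
          this).2
      · intro X hX
        have := hg 0 X hX
        rw [twist_zero, one_mul, mul_one, ← end_lie_def, end_lie_add] at this
        have := (homog_add_eq_zero (glPart_zero_lie hX.1.1 hT₀.1)
          (glPart_zero_lie hX.1.1 hT₁.1) this).2
        rwa [end_lie_def, sub_eq_zero] at this
    rw [hT₁0, add_zero] at heT hhT hg hT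
    change tensorEnd m k t ∈ adjHighest e h f
    rw [← hT]
    refine ⟨hT₀, heT, hhT, fun p X hX => ?_⟩
    have := hg p X hX
    rwa [commute_twist_of_osp_zero hT₀, sub_eq_zero] at this
  · rintro T ⟨hT, heT, hhT, hg⟩
    refine ⟨⟨LinearMap.codRestrict (extSq m k) ((tensorEnd m k).symm.toLinearMap ∘ₗ adjMap ht T)
      fun s => tensorEnd_symm_mem_extSq (adjMap_mem_osp ht hf hT s), fun y s => ?_,
      fun p X hX s => ?_⟩, ?_⟩
    · apply (tensorEnd m k).injective
      simp only [LinearMap.codRestrict_apply, LinearMap.comp_apply, LinearEquiv.coe_coe,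
        LinearEquiv.apply_symm_apply,
        tensorEnd_tensAct_zero (sl2Span_le_osp ht he hh hf y)]
      exact adjMap_lie ht heT hhT y s
    · apply (tensorEnd m k).injective
      simp only [LinearMap.codRestrict_apply, LinearMap.comp_apply, LinearEquiv.coe_coe,
        LinearEquiv.apply_symm_apply, tensorEnd_tensAct hX.1, map_zero,
        commute_twist_of_osp_zero (adjMap_mem_osp ht hf hT s)]
      rw [← end_lie_def]
      exact adjMap_commute ht hX.2.2.2
        (by rw [end_lie_def, hg p X hX, sub_self]) s
    · rw [homEval_apply]
      simp only [LinearMap.codRestrict_apply, LinearMap.comp_apply, LinearEquiv.coe_coe,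
        LinearEquiv.apply_symm_apply, adjMap_sl2Vec, Matrix.cons_val]

theorem multTrivAdj_eq_finrank (ht : IsSl2Triple h e f) (he : e ∈ osp m k 0) (hh : h ∈ osp m k 0)
    (hf : f ∈ osp m k 0)
    (hodd : ∀ T ∈ osp m k 1, ⁅e, T⁆ = 0 → ⁅h, T⁆ = (2 : ℂ) • T →
      (∀ X ∈ gnat e h f 0, X * T = T * X) → T = 0) :
    multTrivAdj e h f = Module.finrank ℂ (adjHighest e h f) := by
  rw [multTrivAdj, ← LinearMap.finrank_range_of_inj (homEval_injective ht),
    range_homEval ht he hh hf hodd]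

end Reduction

/-- A homogeneous basis of `ℂ^{m|2k}` consisting of strings: the string `x` is the standard basis
of an irreducible `𝔰`-module of dimension `len x`. -/
structure StringBasis {m k : ℕ} (e h f : Module.End ℂ (SV m k)) (I : Type) where
  /-- The length of a string. -/
  len : I → ℕ
  /-- The parity of a string. -/
  parity : I → ZMod 2
  len_pos : ∀ x, 0 < len x
  /-- The underlying basis. -/
  basis : Module.Basis (Σ x : I, Fin (len x)) ℂ (SV m k)
  mem_homog : ∀ x j, basis ⟨x, j⟩ ∈ homog m k (parity x)
  h_basis : ∀ x (j : Fin (len x)),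
    h (basis ⟨x, j⟩) = ((len x : ℂ) - 1 - 2 * (j : ℕ)) • basis ⟨x, j⟩
  f_basis : ∀ x (j : Fin (len x)),
    f (basis ⟨x, j⟩) = if hj : (j : ℕ) + 1 < len x then basis ⟨x, ⟨j + 1, hj⟩⟩ else 0
  e_basis : ∀ x (j : Fin (len x)),
    e (basis ⟨x, j⟩) = (((j : ℕ) : ℂ) * ((len x : ℂ) - (j : ℕ))) •
      basis ⟨x, ⟨j - 1, lt_of_le_of_lt (Nat.sub_le _ _) j.2⟩⟩
  e_mem : e ∈ osp m k 0
  h_mem : h ∈ osp m k 0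
  f_mem : f ∈ osp m k 0

/-! ### Strings, their Gram matrix, and the matrices acting on multiplicity spaces. -/

namespace StringBasis

set_option linter.unusedSectionVars false

variable {m k : ℕ} {e h f : Module.End ℂ (SV m k)} {I : Type} (B : StringBasis e h f I)

/-- The `j`-th vector of the string `x`, zero beyond the end of the string. -/
noncomputable def vec (x : I) (j : ℕ) : SV m k :=
  if hj : j < B.len x then B.basis ⟨x, ⟨j, hj⟩⟩ else 0

/-- The coordinate along `vec x j`. -/
noncomputable def coord (x : I) (j : ℕ) : SV m k →ₗ[ℂ] ℂ :=
  if hj : j < B.len x then B.basis.coord ⟨x, ⟨j, hj⟩⟩ else 0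

theorem vec_of_lt {x : I} {j : ℕ} (hj : j < B.len x) : B.vec x j = B.basis ⟨x, ⟨j, hj⟩⟩ :=
  dif_pos hj

theorem vec_of_le {x : I} {j : ℕ} (hj : B.len x ≤ j) : B.vec x j = 0 :=
  dif_neg (not_lt.2 hj)

theorem coord_of_le {x : I} {j : ℕ} (hj : B.len x ≤ j) : B.coord x j = 0 :=
  dif_neg (not_lt.2 hj)

theorem vec_mem_homog (x : I) (j : ℕ) : B.vec x j ∈ homog m k (B.parity x) := by
  unfold vec
  split_ifs
  · exact B.mem_homog _ _
  · exact Submodule.zero_mem _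

theorem linearMap_ext {M : Type*} [AddCommMonoid M] [Module ℂ M] {S T : SV m k →ₗ[ℂ] M}
    (hST : ∀ x j, S (B.vec x j) = T (B.vec x j)) : S = T :=
  B.basis.ext fun ⟨x, j⟩ => by simpa [vec_of_lt B j.2] using hST x j

theorem eq_zero_of_coord {u : SV m k} (hu : ∀ x j, B.coord x j u = 0) : u = 0 := by
  rw [← B.basis.forall_coord_eq_zero_iff]
  rintro ⟨x, j⟩
  simpa [coord, j.2] using hu x j

theorem eq_of_coord {u v : SV m k} (huv : ∀ x j, B.coord x j u = B.coord x j v) : u = v :=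
  sub_eq_zero.1 (B.eq_zero_of_coord fun x j => by rw [map_sub, huv, sub_self])

theorem h_vec (x : I) (j : ℕ) : h (B.vec x j) = ((B.len x : ℂ) - 1 - 2 * j) • B.vec x j := by
  by_cases hj : j < B.len x
  · rw [vec_of_lt B hj, B.h_basis]
  · rw [vec_of_le B (not_lt.1 hj), map_zero, smul_zero]

/-- Extending strings by zero beyond their end removes the case distinction in the action of f. -/
theorem f_vec (x : I) (j : ℕ) : f (B.vec x j) = B.vec x (j + 1) := by
  by_cases hj : j < B.len x
  · rw [vec_of_lt B hj, B.f_basis]; rfl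
  · rw [vec_of_le B (not_lt.1 hj), map_zero, vec_of_le B (by omega)]

theorem e_vec_zero (x : I) : e (B.vec x 0) = 0 := by
  rw [vec_of_lt B (B.len_pos x), B.e_basis]; simp

theorem e_vec_succ (x : I) (j : ℕ) :
    e (B.vec x (j + 1)) = (((j : ℂ) + 1) * ((B.len x : ℂ) - (j + 1))) • B.vec x j := by
  rcases lt_trichotomy (j + 1) (B.len x) with hj | hj | hj
  · rw [vec_of_lt B hj, B.e_basis, vec_of_lt B (by omega : j < B.len x)]
    simp
  · rw [vec_of_le B hj.ge, map_zero, ← hj]; simp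
  · rw [vec_of_le B hj.le, map_zero, vec_of_le B (by omega), smul_zero]

theorem twist_vec (p : ZMod 2) (x : I) (j : ℕ) :
    twist p (B.vec x j) = ksign p (B.parity x) • B.vec x j :=
  twist_apply p _ (B.vec_mem_homog x j)

variable [DecidableEq I]

theorem coord_vec (x y : I) (i j : ℕ) :
    B.coord x i (B.vec y j) = if x = y ∧ i = j ∧ i < B.len x then 1 else 0 := by
  unfold coord vec
  by_cases hi : i < B.len x
  · by_cases hj : j < B.len y
    · rw [dif_pos hi, dif_pos hj, Module.Basis.coord_apply, Module.Basis.repr_self,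
        Finsupp.single_apply]
      by_cases hxy : x = y
      · subst hxy
        simp [hi, Fin.ext_iff, eq_comm]
      · have : ¬ ((⟨y, ⟨j, hj⟩⟩ : Σ x : I, Fin (B.len x)) = ⟨x, ⟨i, hi⟩⟩) := fun h0 =>
          hxy (congrArg Sigma.fst h0).symm
        simp [this, hxy]
    · rw [dif_neg hj, map_zero, if_neg]
      rintro ⟨rfl, rfl, -⟩
      exact hj hi
  · rw [dif_neg hi, if_neg (fun h0 => hi h0.2.2)]; rfl

theorem coord_vec_self {x : I} {i : ℕ} (hi : i < B.len x) : B.coord x i (B.vec x i) = 1 := by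
  rw [coord_vec, if_pos ⟨rfl, rfl, hi⟩]

theorem coord_vec_ne_string {x y : I} (hxy : x ≠ y) (i j : ℕ) :
    B.coord x i (B.vec y j) = 0 := by
  rw [coord_vec, if_neg fun h0 => hxy h0.1]

theorem coord_vec_ne_index (x y : I) {i j : ℕ} (hij : i ≠ j) :
    B.coord x i (B.vec y j) = 0 := by
  rw [coord_vec, if_neg fun h0 => hij h0.2.1]

theorem coord_h (x : I) (i : ℕ) (u : SV m k) :
    B.coord x i (h u) = ((B.len x : ℂ) - 1 - 2 * i) * B.coord x i u := by
  suffices B.coord x i ∘ₗ h = ((B.len x : ℂ) - 1 - 2 * i) • B.coord x i from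
    LinearMap.congr_fun this u
  refine B.linearMap_ext fun y j => ?_
  simp only [LinearMap.comp_apply, LinearMap.smul_apply, smul_eq_mul, h_vec, map_smul, coord_vec]
  by_cases h0 : x = y ∧ i = j ∧ i < B.len x
  · obtain ⟨rfl, rfl, -⟩ := h0; rfl
  · rw [if_neg h0, mul_zero, mul_zero]

theorem coord_e (x : I) (i : ℕ) (u : SV m k) :
    B.coord x i (e u) =
      (((i : ℂ) + 1) * ((B.len x : ℂ) - (i + 1))) * B.coord x (i + 1) u := by
  suffices B.coord x i ∘ₗ e =
      (((i : ℂ) + 1) * ((B.len x : ℂ) - (i + 1))) • B.coord x (i + 1) from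
    LinearMap.congr_fun this u
  refine B.linearMap_ext fun y j => ?_
  simp only [LinearMap.comp_apply, LinearMap.smul_apply, smul_eq_mul]
  rcases j with _ | j
  · rw [e_vec_zero, map_zero, coord_vec_ne_index B x y (Nat.succ_ne_zero i), mul_zero]
  · rw [e_vec_succ, map_smul, smul_eq_mul]
    by_cases h0 : x = y ∧ i = j
    · obtain ⟨rfl, rfl⟩ := h0
      simp only [coord_vec, true_and]
      rcases lt_trichotomy (i + 1) (B.len x) with h1 | h1 | h1
      · rw [if_pos h1, if_pos (by omega)]
      · rw [← h1]; simp
      · rw [if_neg (by omega), if_neg (by omega)]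
    · rw [coord_vec, coord_vec, if_neg (fun h1 => h0 ⟨h1.1, h1.2.1⟩),
        if_neg (fun h1 => h0 ⟨h1.1, by simpa using h1.2.1⟩), mul_zero, mul_zero]

/-- Since f is skew for the form, each step of f moved from left to right costs a sign. -/
theorem form_vec_shift (x y : I) (i j : ℕ) :
    form m k (B.vec x i) (B.vec y j) = (-1) ^ i * form m k (B.vec x 0) (B.vec y (i + j)) := by
  induction i generalizing j with
  | zero => simp
  | succ i ih =>
    rw [← f_vec, osp_zero_form B.f_mem, f_vec, ih, pow_succ, add_right_comm i 1 j]
    ring_nf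

/-- Since h is skew for the form, only vectors of opposite weight can pair nontrivially. -/
theorem form_vec_weight {x y : I} {i j : ℕ} (h0 : form m k (B.vec x i) (B.vec y j) ≠ 0) :
    B.len x + B.len y = 2 * (i + j + 1) := by
  have h1 := osp_zero_form B.h_mem (B.vec x i) (B.vec y j)
  rw [h_vec, h_vec, map_smul, map_smul, LinearMap.smul_apply, smul_eq_mul, smul_eq_mul] at h1
  have h2 : ((B.len x : ℂ) + B.len y - 2 * (i + j + 1)) * form m k (B.vec x i) (B.vec y j) = 0 := by
    linear_combination h1
  have h3 := (mul_eq_zero.1 h2).resolve_right h0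
  have h4 : ((B.len x + B.len y : ℕ) : ℂ) = (2 * (i + j + 1) : ℕ) := by
    push_cast
    linear_combination h3
  exact_mod_cast h4

/-- The Gram matrix of the strings: `(vec x 0 | vec y (len x - 1))` for strings of equal length. -/
noncomputable def gram : Matrix I I ℂ := Matrix.of fun x y =>
  if B.len x = B.len y then form m k (B.vec x 0) (B.vec y (B.len x - 1)) else 0

theorem gram_of_ne {x y : I} (hxy : B.len x ≠ B.len y) : B.gram x y = 0 := if_neg hxy

theorem gram_of_eq {x y : I} (hxy : B.len x = B.len y) :
    B.gram x y = form m k (B.vec x 0) (B.vec y (B.len x - 1)) := if_pos hxy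

/-- Strings of different lengths are orthogonal. For opposite weights, i + j is at least the smaller
length, so shifting all of f onto the shorter string runs past its end. -/
theorem form_vec (x y : I) (i j : ℕ) :
    form m k (B.vec x i) (B.vec y j) =
      if B.len x = B.len y ∧ i + j + 1 = B.len x then (-1) ^ i * B.gram x y else 0 := by
  split_ifs with h0
  · rw [form_vec_shift, gram_of_eq B h0.1, ← h0.2, Nat.add_sub_cancel]
  · by_contra h1
    have h2 := B.form_vec_weight h1
    rcases lt_trichotomy (B.len x) (B.len y) with h3 | h3 | h3
    · apply h1
      rw [form_vec_shift, show i + j = B.len x + (i + j - B.len x) by omega]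
      have := B.form_vec_shift x y (B.len x) (i + j - B.len x)
      rw [vec_of_le B le_rfl, map_zero, LinearMap.zero_apply] at this
      rw [(mul_eq_zero.1 this.symm).resolve_left (by simp), mul_zero]
    · exact h0 ⟨h3, by omega⟩
    · apply h1
      rw [form_vec_shift, vec_of_le B (by omega : B.len y ≤ i + j), map_zero, mul_zero]

theorem gram_ne_zero {x y : I} (h0 : B.gram x y ≠ 0) :
    B.len x = B.len y ∧ B.parity x = B.parity y := by
  have h1 : B.len x = B.len y := by
    by_contra h1; exact h0 (B.gram_of_ne h1)
  refine ⟨h1, ?_⟩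
  by_contra h2
  rw [gram_of_eq B h1] at h0
  exact h0 (form_eq_zero_of_ne (B.vec_mem_homog _ _) (B.vec_mem_homog _ _) h2)

/-- The sign of the form induced on the multiplicity space of the strings of the length and
parity of `x`. -/
noncomputable def sign (x : I) : ℂ := (-1) ^ (B.len x - 1) * ksign (B.parity x) (B.parity x)

theorem gram_symm (x y : I) : B.gram y x = B.sign x * B.gram x y := by
  by_cases h1 : B.len x = B.len y
  · by_cases h2 : B.parity x = B.parity y
    · have hl := B.len_pos x
      rw [gram_of_eq B h1.symm, form_homog_comm (B.vec_mem_homog _ _) (B.vec_mem_homog _ _),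
        form_vec, if_pos ⟨h1, by omega⟩, ← h2, ← h1, sign]
      ring
    · rw [not_imp_comm.1 (fun h0 => (B.gram_ne_zero h0).2) (Ne.symm h2),
        not_imp_comm.1 (fun h0 => (B.gram_ne_zero h0).2) h2, mul_zero]
  · rw [gram_of_ne B h1, gram_of_ne B (Ne.symm h1), mul_zero]

variable [Fintype I]

theorem form_vec_right {y : I} {i j : ℕ} (hij : i + j + 1 = B.len y) (u : SV m k) :
    form m k (B.vec y j) u = (-1) ^ j * ∑ x, B.gram y x * B.coord x i u := by
  suffices form m k (B.vec y j) = (-1 : ℂ) ^ j • ∑ x, B.gram y x • B.coord x i by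
    rw [this]; simp
  refine B.linearMap_ext fun z l => ?_
  simp only [LinearMap.smul_apply, LinearMap.sum_apply, smul_eq_mul, form_vec, coord_vec]
  by_cases hz : B.len y = B.len z
  · by_cases hl : i = l
    · subst hl
      rw [if_pos ⟨hz, by omega⟩, Finset.sum_eq_single z]
      · rw [if_pos ⟨rfl, rfl, by omega⟩, mul_one]
      · intro x _ hx
        rw [if_neg fun h0 => hx h0.1, mul_zero]
      · simp
    · rw [if_neg (by omega), Finset.sum_eq_zero, mul_zero]
      intro x _
      rw [if_neg fun h0 => hl h0.2.1, mul_zero]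
  · rw [if_neg fun h0 => hz h0.1, Finset.sum_eq_zero, mul_zero]
    intro x _
    by_cases hx : x = z
    · rw [hx, gram_of_ne B hz, zero_mul]
    · rw [if_neg fun h0 => hx h0.1, mul_zero]

theorem form_vec_left {z : I} {i l : ℕ} (hil : i + l + 1 = B.len z) (u : SV m k) :
    form m k u (B.vec z l) = (-1) ^ i * ∑ x, B.coord x i u * B.gram x z := by
  suffices LinearMap.flip (form m k) (B.vec z l) = (-1 : ℂ) ^ i • ∑ x, B.gram x z • B.coord x i by
    rw [← LinearMap.flip_apply (form m k), this]; simp [mul_comm]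
  refine B.linearMap_ext fun y j => ?_
  simp only [LinearMap.smul_apply, LinearMap.sum_apply, smul_eq_mul, form_vec, coord_vec,
    LinearMap.flip_apply]
  by_cases hz : B.len y = B.len z
  · by_cases hl : i = j
    · subst hl
      rw [if_pos ⟨hz, by omega⟩, Finset.sum_eq_single y]
      · rw [if_pos ⟨rfl, rfl, by omega⟩, mul_one]
      · intro x _ hx
        rw [if_neg fun h0 => hx h0.1, mul_zero]
      · simp
    · rw [if_neg (by omega), Finset.sum_eq_zero, mul_zero]
      intro x _
      rw [if_neg fun h0 => hl h0.2.1, mul_zero]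
  · rw [if_neg fun h0 => hz h0.1, Finset.sum_eq_zero, mul_zero]
    intro x _
    by_cases hx : x = y
    · rw [hx, gram_of_ne B hz, zero_mul]
    · rw [if_neg fun h0 => hx h0.1, mul_zero]

/-- A vector in the left kernel gives a combination of the top vectors of the strings that is
orthogonal to all of V, contradicting nondegeneracy. -/
theorem gram_det_ne_zero : B.gram.det ≠ 0 := by
  intro h0
  obtain ⟨a, ha, ha0⟩ := Matrix.exists_vecMul_eq_zero_iff.2 h0
  apply ha
  have key : ∑ x, a x • B.vec x 0 = 0 := by
    apply eq_zero_of_form_left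
    intro w
    suffices form m k (∑ x, a x • B.vec x 0) = 0 by rw [this]; rfl
    refine B.linearMap_ext fun z l => ?_
    rw [LinearMap.zero_apply, map_sum, LinearMap.sum_apply]
    by_cases hl : 0 + l + 1 = B.len z
    · have := congrFun ha0 z
      rw [Matrix.vecMul, dotProduct, Pi.zero_apply] at this
      rw [← this]
      refine Finset.sum_congr rfl fun x _ => ?_
      rw [map_smul, LinearMap.smul_apply, form_vec, smul_eq_mul]
      by_cases hx : B.len x = B.len z
      · rw [if_pos ⟨hx, by omega⟩, pow_zero, one_mul]
      · rw [if_neg fun h1 => hx h1.1, gram_of_ne B hx]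
    · refine Finset.sum_eq_zero fun x _ => ?_
      rw [map_smul, LinearMap.smul_apply, form_vec, if_neg, smul_zero]
      rintro ⟨h1, h2⟩
      omega
  funext x
  have h1 := congrArg (B.coord x 0) key
  rw [map_sum, map_zero, Finset.sum_eq_single x] at h1
  · simpa [coord_vec_self B (B.len_pos x)] using h1
  · intro y _ hy
    rw [map_smul, coord_vec_ne_string B (Ne.symm hy), smul_zero]
  · simp

/-- The operator acting on the multiplicity spaces by the matrix `N`. -/
noncomputable def op (N : Matrix I I ℂ) : Module.End ℂ (SV m k) :=
  B.basis.constr ℂ fun z => ∑ w, N w z.1 • B.vec w z.2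

/-- The matrix respects the lengths of the strings. -/
def IsBlock (N : Matrix I I ℂ) : Prop := ∀ w z, B.len w ≠ B.len z → N w z = 0

variable {B} {N : Matrix I I ℂ}

/-- The block condition keeps the formula valid beyond the end of a string, because only strings of
the same length enter the sum. -/
theorem op_vec (hN : B.IsBlock N) (z : I) (j : ℕ) :
    B.op N (B.vec z j) = ∑ w, N w z • B.vec w j := by
  by_cases hj : j < B.len z
  · rw [vec_of_lt B hj, op, Module.Basis.constr_basis]
  · rw [vec_of_le B (not_lt.1 hj), map_zero, Finset.sum_eq_zero]
    intro w _
    by_cases hw : B.len w = B.len z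
    · rw [vec_of_le B (by omega), smul_zero]
    · rw [hN w z hw, zero_smul]

theorem coord_op (hN : B.IsBlock N) (x : I) (i : ℕ) (u : SV m k) :
    B.coord x i (B.op N u) = ∑ w, N x w * B.coord w i u := by
  suffices B.coord x i ∘ₗ B.op N = ∑ w, N x w • B.coord w i by
    rw [← LinearMap.comp_apply, this]; simp
  refine B.linearMap_ext fun z j => ?_
  simp only [LinearMap.comp_apply, op_vec hN, map_sum, map_smul, smul_eq_mul, LinearMap.sum_apply,
    LinearMap.smul_apply, coord_vec]
  rw [Finset.sum_eq_single x, Finset.sum_eq_single z]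
  · by_cases hx : B.len x = B.len z
    · simp [hx]
    · rw [hN x z hx]; simp
  · intro w _ hw
    rw [if_neg fun h0 => hw h0.1, mul_zero]
  · simp
  · intro w _ hw
    rw [if_neg fun h0 => hw h0.1.symm, mul_zero]
  · simp

theorem op_lie_e (hN : B.IsBlock N) : ⁅B.op N, e⁆ = 0 := by
  rw [end_lie_def, sub_eq_zero]
  refine B.linearMap_ext fun z j => ?_
  rw [Module.End.mul_apply, Module.End.mul_apply, op_vec hN, map_sum]
  rcases j with _ | j
  · rw [e_vec_zero, map_zero, Finset.sum_eq_zero]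
    intro w _
    rw [map_smul, e_vec_zero, smul_zero]
  · rw [e_vec_succ, map_smul, op_vec hN, Finset.smul_sum]
    refine Finset.sum_congr rfl fun w _ => ?_
    rw [map_smul, e_vec_succ]
    by_cases hw : B.len w = B.len z
    · rw [hw, smul_comm]
    · rw [hN w z hw, zero_smul, zero_smul, smul_zero]

theorem op_lie_h (hN : B.IsBlock N) : ⁅B.op N, h⁆ = 0 := by
  rw [end_lie_def, sub_eq_zero]
  refine B.linearMap_ext fun z j => ?_
  rw [Module.End.mul_apply, Module.End.mul_apply, op_vec hN, map_sum, h_vec, map_smul, op_vec hN,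
    Finset.smul_sum]
  refine Finset.sum_congr rfl fun w _ => ?_
  rw [map_smul, h_vec]
  by_cases hw : B.len w = B.len z
  · rw [hw, smul_comm]
  · rw [hN w z hw, zero_smul, zero_smul, smul_zero]

theorem op_lie_f (hN : B.IsBlock N) : ⁅B.op N, f⁆ = 0 := by
  rw [end_lie_def, sub_eq_zero]
  refine B.linearMap_ext fun z j => ?_
  rw [Module.End.mul_apply, Module.End.mul_apply, op_vec hN, map_sum, f_vec, op_vec hN]
  exact Finset.sum_congr rfl fun w _ => by rw [map_smul, f_vec]

/-- The symmetry condition on `S` under which `S * gram` acts by an element of `𝔤^♮` of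
parity `p`. -/
structure IsSuperSkew (B : StringBasis e h f I) (p : ZMod 2) (S : Matrix I I ℂ) : Prop where
  block : B.IsBlock S
  parity : ∀ x y, S x y ≠ 0 → B.parity x + B.parity y = p
  skew : ∀ x y, S y x = -((-1) ^ (B.len x - 1) * ksign (B.parity x) (B.parity y)) * S x y

variable {p : ZMod 2} {S : Matrix I I ℂ}

theorem IsBlock.mul {N' : Matrix I I ℂ} (hN : B.IsBlock N) (hN' : B.IsBlock N') :
    B.IsBlock (N * N') := by
  intro w z hwz
  rw [Matrix.mul_apply]
  refine Finset.sum_eq_zero fun y _ => ?_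
  by_cases hw : B.len w = B.len y
  · rw [hN' y z (fun h0 => hwz (hw.trans h0)), mul_zero]
  · rw [hN w y hw, zero_mul]

theorem isBlock_gram : B.IsBlock B.gram := fun _ _ hxy => B.gram_of_ne hxy

theorem IsSuperSkew.mul_gram_parity (hS : B.IsSuperSkew p S) {w z : I}
    (h0 : (S * B.gram) w z ≠ 0) : B.parity w + B.parity z = p := by
  rw [Matrix.mul_apply] at h0
  obtain ⟨y, -, hy⟩ := Finset.exists_ne_zero_of_sum_ne_zero h0
  have h1 := hS.parity w y (left_ne_zero_of_mul hy)
  rwa [(B.gram_ne_zero (right_ne_zero_of_mul hy)).2] at h1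

/-- The matrix S is a super skew tensor on the multiplicity space, and multiplying by the Gram
matrix turns it into an operator, just as `tensorEnd` does for V. The commutators with e, h, f
vanish because their coefficients on a string depend only on its length and the position in it. -/
theorem IsSuperSkew.op_mem_gnat (hS : B.IsSuperSkew p S) :
    B.op (S * B.gram) ∈ gnat e h f p := by
  have hN : B.IsBlock (S * B.gram) := hS.block.mul isBlock_gram
  refine ⟨⟨mem_glPart_of_twist fun v => ?_, ?_⟩, op_lie_e hN, op_lie_h hN, op_lie_f hN⟩
  · suffices twist 1 ∘ₗ B.op (S * B.gram) = ksign 1 p • B.op (S * B.gram) ∘ₗ twist 1 from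
      LinearMap.congr_fun this v
    refine B.linearMap_ext fun z j => ?_
    simp only [LinearMap.comp_apply, LinearMap.smul_apply, twist_vec, map_smul, op_vec hN, map_sum,
      Finset.smul_sum]
    refine Finset.sum_congr rfl fun w _ => ?_
    by_cases h0 : (S * B.gram) w z = 0
    · simp [h0]
    · rw [← hS.mul_gram_parity h0, smul_smul, smul_smul, smul_smul, ksign_add_right]
      congr 1
      linear_combination (-(S * B.gram) w z * ksign 1 (B.parity w)) *
        ksign_mul_self 1 (B.parity z)
  · have key : ∀ v w, form m k (B.op (S * B.gram) v) w =
        -form m k (twist p v) (B.op (S * B.gram) w) := by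
      intro v w
      suffices form m k ∘ₗ B.op (S * B.gram) =
          -((form m k).compl₂ (B.op (S * B.gram)) ∘ₗ twist p) from
        LinearMap.congr_fun (LinearMap.congr_fun this v) w
      refine B.linearMap_ext fun z j => B.linearMap_ext fun w i => ?_
      simp only [LinearMap.comp_apply, LinearMap.neg_apply, LinearMap.compl₂_apply, twist_vec,
        map_smul, LinearMap.smul_apply, op_vec hN, map_sum, LinearMap.sum_apply, form_vec,
        smul_eq_mul]
      by_cases h0 : B.len z = B.len w ∧ j + i + 1 = B.len z
      · have h1 : ∀ x, (S * B.gram) x z *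
            (if B.len x = B.len w ∧ j + i + 1 = B.len x then (-1) ^ j * B.gram x w else 0) =
            (-1) ^ j * ((S * B.gram) x z * B.gram x w) := by
          intro x
          by_cases hx : B.len x = B.len z
          · rw [if_pos (by omega)]; ring
          · rw [hN x z hx]; simp
        have h2 : ∀ x, (S * B.gram) x w *
            (if B.len z = B.len x ∧ j + i + 1 = B.len z then (-1) ^ j * B.gram z x else 0) =
            (-1) ^ j * (B.gram z x * (S * B.gram) x w) := by
          intro x
          by_cases hx : B.len x = B.len w
          · rw [if_pos (by omega)]; ring
          · rw [hN x w hx]; simp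
        simp only [h1, h2, ← Finset.mul_sum]
        -- The positions in the strings contribute the same factor (-1)^j to both sides, so only an
        -- identity of matrices remains.
        suffices ∑ x, (S * B.gram) x z * B.gram x w =
            -(ksign p (B.parity z) * ∑ x, B.gram z x * (S * B.gram) x w) by
          rw [this]; ring
        simp only [Matrix.mul_apply, Finset.mul_sum, Finset.sum_mul, ← Finset.sum_neg_distrib]
        rw [Finset.sum_comm]
        refine Finset.sum_congr rfl fun x _ => Finset.sum_congr rfl fun y _ => ?_
        by_cases hzx : B.gram z x = 0
        · have : B.gram x z = 0 := by rw [gram_symm, hzx, mul_zero]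
          rw [this, hzx]; ring
        · by_cases hxy : S x y = 0
          · have : S y x = 0 := by rw [hS.skew, hxy, mul_zero]
            rw [this, hxy]; ring
          · obtain ⟨hl, hp⟩ := B.gram_ne_zero hzx
            rw [gram_symm B z x, hS.skew x y, ← hS.parity x y hxy, sign, hp, hl,
              ksign_comm (B.parity x + B.parity y), ksign_add_right]
            have h3 : ((-1 : ℂ) ^ (B.len x - 1)) ^ 2 = 1 := by
              rw [← pow_mul, mul_comm, pow_mul]; simp
            linear_combination (-(S x y * B.gram z x * B.gram y w *
              ksign (B.parity x) (B.parity y) * ksign (B.parity x) (B.parity x))) * h3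
      · rw [Finset.sum_eq_zero, Finset.sum_eq_zero, mul_zero, neg_zero]
        · intro x _
          by_cases hx : B.len x = B.len w
          · rw [if_neg (by omega), mul_zero]
          · rw [hN x w hx, zero_mul]
        · intro x _
          by_cases hx : B.len x = B.len z
          · rw [if_neg (by omega), mul_zero]
          · rw [hN x z hx, zero_mul]
    intro r v hv w
    rw [key, twist_apply p r hv, map_smul, LinearMap.smul_apply, smul_eq_mul]

end StringBasis

namespace StringBasis

set_option linter.unusedSectionVars false

/-! ### Operators commuting with the rank-two elements of 𝔤^♮. -/

section Commutant

variable {m k : ℕ} {e h f : Module.End ℂ (SV m k)} {I : Type} (B : StringBasis e h f I)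
  [DecidableEq I] [Fintype I]

/-- The matrix of coordinates along the `i`-th vectors of the images of the `j`-th vectors. -/
noncomputable def mat (T : Module.End ℂ (SV m k)) (i j : ℕ) : Matrix I I ℂ :=
  Matrix.of fun x y => B.coord x i (T (B.vec y j))

theorem mat_apply (T : Module.End ℂ (SV m k)) (i j : ℕ) (x y : I) :
    B.mat T i j x y = B.coord x i (T (B.vec y j)) := rfl

theorem eq_zero_of_mat {T : Module.End ℂ (SV m k)} (hT : ∀ i j x y, B.mat T i j x y = 0) :
    T = 0 :=
  B.linearMap_ext fun y j => B.eq_zero_of_coord fun x i => hT i j x y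

theorem mat_eq_zero_of_le_left (T : Module.End ℂ (SV m k)) {i : ℕ} (j : ℕ) {x : I} (y : I)
    (hi : B.len x ≤ i) : B.mat T i j x y = 0 := by
  rw [mat_apply, coord_of_le B hi, LinearMap.zero_apply]

theorem mat_eq_zero_of_le_right (T : Module.End ℂ (SV m k)) (i : ℕ) {j : ℕ} (x : I) {y : I}
    (hj : B.len y ≤ j) : B.mat T i j x y = 0 := by
  rw [mat_apply, vec_of_le B hj, map_zero, map_zero]

/-- The sign `s` for which `x ⊗ y - s y ⊗ x` defines an element of `𝔤^♮`. -/
noncomputable def pairSign (x y : I) : ℂ := (-1) ^ (B.len x - 1) * ksign (B.parity x) (B.parity y)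

/-- The matrix `x ⊗ y - s y ⊗ x` of an element of `𝔤^♮`. -/
noncomputable def skewUnit (x y : I) : Matrix I I ℂ :=
  Matrix.single x y 1 - Matrix.single y x (B.pairSign x y)

variable {B}

theorem pairSign_mul_self (x y : I) : B.pairSign x y * B.pairSign x y = 1 := by
  have h1 : ((-1 : ℂ) ^ (B.len x - 1)) ^ 2 = 1 := by rw [← pow_mul, mul_comm, pow_mul]; simp
  have h2 := ksign_mul_self (B.parity x) (B.parity y)
  rw [pairSign]
  linear_combination (ksign (B.parity x) (B.parity y)) ^ 2 * h1 + h2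

theorem pairSign_comm {x y : I} (hxy : B.len x = B.len y) : B.pairSign x y = B.pairSign y x := by
  rw [pairSign, pairSign, hxy, ksign_comm]

theorem isSuperSkew_skewUnit {x y : I} (hxy : B.len x = B.len y) :
    B.IsSuperSkew (B.parity x + B.parity y) (B.skewUnit x y) := by
  have entry : ∀ a b, B.skewUnit x y a b =
      (if x = a ∧ y = b then 1 else 0) - (if y = a ∧ x = b then B.pairSign x y else 0) := by
    intro a b
    simp [skewUnit, Matrix.single_apply]
  refine ⟨fun a b hab => ?_, fun a b hab => ?_, fun a b => ?_⟩
  · rw [entry, if_neg, if_neg, sub_zero]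
    · rintro ⟨rfl, rfl⟩; exact hab hxy.symm
    · rintro ⟨rfl, rfl⟩; exact hab hxy
  · rw [entry] at hab
    by_cases h1 : x = a ∧ y = b
    · rw [h1.1, h1.2]
    · by_cases h2 : y = a ∧ x = b
      · rw [h2.1, h2.2, add_comm]
      · rw [if_neg h1, if_neg h2, sub_zero] at hab
        exact absurd rfl hab
  · change B.skewUnit x y b a = -B.pairSign a b * B.skewUnit x y a b
    rw [entry, entry]
    by_cases h1 : x = a ∧ y = b
    · obtain ⟨rfl, rfl⟩ := h1
      have := B.pairSign_mul_self x y
      by_cases h2 : x = y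
      · subst h2; simp; linear_combination -this
      · simp [h2, Ne.symm h2]
    · by_cases h2 : y = a ∧ x = b
      · obtain ⟨rfl, rfl⟩ := h2
        have := B.pairSign_mul_self x y
        rw [pairSign_comm hxy.symm]
        by_cases h3 : x = y
        · exact absurd ⟨h3, h3.symm⟩ h1
        · simp [h3, Ne.symm h3, this]
      · rw [if_neg h1, if_neg h2, if_neg fun h0 => h2 ⟨h0.2, h0.1⟩,
          if_neg fun h0 => h1 ⟨h0.2, h0.1⟩]
        simp

theorem isUnit_gram_det : IsUnit B.gram.det := isUnit_iff_ne_zero.2 B.gram_det_ne_zero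

/-- These are the only elements of 𝔤^♮ needed to bound the commutant from above. -/
theorem op_skewUnit_mem_gnat {x y : I} (hxy : B.len x = B.len y) :
    B.op (B.skewUnit x y * B.gram) ∈ gnat e h f (B.parity x + B.parity y) :=
  (isSuperSkew_skewUnit hxy).op_mem_gnat

theorem mat_op_mul {N : Matrix I I ℂ} (hN : B.IsBlock N) (T : Module.End ℂ (SV m k)) (i j : ℕ) :
    B.mat (B.op N * T) i j = N * B.mat T i j := by
  ext x y
  rw [mat_apply, Module.End.mul_apply, coord_op hN, Matrix.mul_apply]
  rfl

theorem mat_mul_op {N : Matrix I I ℂ} (hN : B.IsBlock N) (T : Module.End ℂ (SV m k)) (i j : ℕ) :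
    B.mat (T * B.op N) i j = B.mat T i j * N := by
  ext x y
  rw [mat_apply, Module.End.mul_apply, op_vec hN, Matrix.mul_apply, map_sum, map_sum]
  refine Finset.sum_congr rfl fun w _ => ?_
  rw [map_smul, map_smul, smul_eq_mul, mul_comm]
  rfl

/-- The conjugate of a matrix by the Gram matrix. -/
noncomputable def conj (B : StringBasis e h f I) (A : Matrix I I ℂ) : Matrix I I ℂ :=
  B.gram * A * B.gram⁻¹

theorem conj_apply (A : Matrix I I ℂ) : B.conj A * B.gram = B.gram * A := by
  rw [conj, Matrix.mul_assoc, Matrix.nonsing_inv_mul _ isUnit_gram_det, Matrix.mul_one]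

theorem eq_inv_mul_conj (A : Matrix I I ℂ) : A = B.gram⁻¹ * (B.conj A * B.gram) := by
  rw [conj_apply, ← Matrix.mul_assoc, Matrix.nonsing_inv_mul _ isUnit_gram_det, Matrix.one_mul]

/-- After cancelling the Gram matrix on the right, the relation involves only matrix units. The
later constraints on A come from choosing the entry (w, u). -/
theorem skewUnit_commute {x y : I} {A : Matrix I I ℂ}
    (hA : B.skewUnit x y * B.gram * A = A * (B.skewUnit x y * B.gram)) (w u : I) :
    (if w = x then B.conj A y u else 0) - (if w = y then B.pairSign x y * B.conj A x u else 0) =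
      (if u = y then A w x else 0) - (if u = x then A w y * B.pairSign x y else 0) := by
  have h1 : B.skewUnit x y * B.conj A = A * B.skewUnit x y := by
    rw [conj, ← Matrix.mul_assoc, ← Matrix.mul_assoc, hA, Matrix.mul_assoc, Matrix.mul_assoc,
      Matrix.mul_nonsing_inv _ isUnit_gram_det, Matrix.mul_one]
  have h2 := congrFun (congrFun h1 w) u
  simpa [skewUnit, sub_mul, mul_sub, Matrix.sub_apply, eq_comm, Matrix.mul_apply, Matrix.single_apply, ite_and] using h2

/-- The indicator matrix of a class commutes with the Gram matrix, hence with its inverse. -/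
theorem gram_inv_block {γ : Type*} {τ : I → γ} (hτ : ∀ x y, B.gram x y ≠ 0 → τ x = τ y) {x y : I}
    (hxy : τ x ≠ τ y) : B.gram⁻¹ x y = 0 := by
  classical
  set D : Matrix I I ℂ := Matrix.diagonal fun z => if τ z = τ x then 1 else 0 with hD
  have h1 : D * B.gram = B.gram * D := by
    ext a b
    rw [hD, Matrix.diagonal_mul, Matrix.mul_diagonal]
    by_cases h0 : B.gram a b = 0
    · simp [h0]
    · rw [hτ a b h0, mul_comm]
  have h2 : B.gram⁻¹ * D = D * B.gram⁻¹ := by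
    calc B.gram⁻¹ * D = B.gram⁻¹ * (D * B.gram) * B.gram⁻¹ := by
          rw [Matrix.mul_assoc, Matrix.mul_assoc, Matrix.mul_nonsing_inv _ isUnit_gram_det,
            Matrix.mul_one]
      _ = D * B.gram⁻¹ := by
          rw [h1, ← Matrix.mul_assoc, Matrix.nonsing_inv_mul _ isUnit_gram_det, Matrix.one_mul]
  have h3 := congrFun (congrFun h2 x) y
  rw [hD, Matrix.mul_diagonal, Matrix.diagonal_mul, if_neg (Ne.symm hxy), if_pos rfl] at h3
  simpa using h3.symm

theorem mat_skewUnit_commute {T : Module.End ℂ (SV m k)} {x y : I} (hxy : B.len x = B.len y)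
    (hT : B.op (B.skewUnit x y * B.gram) * T = T * B.op (B.skewUnit x y * B.gram)) (i j : ℕ) :
    B.skewUnit x y * B.gram * B.mat T i j = B.mat T i j * (B.skewUnit x y * B.gram) := by
  have hN : B.IsBlock (B.skewUnit x y * B.gram) := (isSuperSkew_skewUnit hxy).block.mul isBlock_gram
  rw [← mat_op_mul hN, hT, mat_mul_op hN]

/-- If a class of strings has at least two members, an operator commuting with the corresponding
elements of `𝔤^♮` has no matrix entries between this class and its complement. -/
theorem mat_eq_zero_of_class {γ : Type*} {τ : I → γ} (hτ : ∀ x y, B.gram x y ≠ 0 → τ x = τ y)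
    (hlen : ∀ x y, τ x = τ y → B.len x = B.len y) {T : Module.End ℂ (SV m k)}
    (hT : ∀ x y, τ x = τ y →
      B.op (B.skewUnit x y * B.gram) * T = T * B.op (B.skewUnit x y * B.gram))
    {x x' u : I} (hx : x' ≠ x) (hx' : τ x' = τ x) (hu : τ u ≠ τ x) (i j : ℕ) :
    B.mat T i j u x = 0 ∧ B.mat T i j x u = 0 := by
  set A := B.mat T i j
  have hA : ∀ x y, τ x = τ y → B.skewUnit x y * B.gram * A = A * (B.skewUnit x y * B.gram) :=
    fun x y hxy => mat_skewUnit_commute (hlen x y hxy) (hT x y hxy) i j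
  constructor
  -- In the entry (u, x') every term except A u x vanishes.
  · have := skewUnit_commute (hA x x' hx'.symm) u x'
    rw [if_neg (fun h0 => hu (by rw [h0])), if_neg (fun h0 => hu (by rw [h0, hx'])), if_pos rfl,
      if_neg hx] at this
    simpa using this.symm
  -- The other direction is first seen for the conjugate of A. It then passes to A because the Gram
  -- matrix and its inverse preserve classes.
  · have h1 : ∀ y w, τ y = τ x → τ w ≠ τ x → B.conj A y w = 0 := by
      intro y w hy hw
      obtain ⟨y', hy', hyy⟩ : ∃ y', y' ≠ y ∧ τ y' = τ y := by
        by_cases h0 : x = y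
        · exact ⟨x', h0 ▸ hx, by rw [hx', h0]⟩
        · exact ⟨x, h0, hy.symm⟩
      have := skewUnit_commute (hA y' y hyy) y' w
      rw [if_pos rfl, if_neg hy', if_neg (fun h0 => hw (by rw [h0, hy])),
        if_neg (fun h0 => hw (by rw [h0, hyy, hy]))] at this
      simpa using this
    rw [eq_inv_mul_conj A, Matrix.mul_apply]
    refine Finset.sum_eq_zero fun y _ => ?_
    by_cases hy : τ x = τ y
    · rw [Matrix.mul_apply, Finset.sum_eq_zero, mul_zero]
      intro w _
      by_cases hw : τ w = τ u
      · rw [h1 y w hy.symm (by rw [hw]; exact hu), zero_mul]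
      · rw [not_imp_comm.1 (hτ w u) hw, mul_zero]
    · rw [gram_inv_block hτ hy, zero_mul]

theorem mat_weight {T : Module.End ℂ (SV m k)} (hT : ⁅h, T⁆ = (2 : ℂ) • T) {i j : ℕ} {x y : I}
    (h0 : B.mat T i j x y ≠ 0) : B.len x + 2 * j = B.len y + 2 * i + 2 := by
  have h1 := congrArg (B.coord x i) (LinearMap.congr_fun hT (B.vec y j))
  rw [end_lie_def, LinearMap.sub_apply, Module.End.mul_apply, Module.End.mul_apply, h_vec,
    map_smul, map_sub, coord_h, map_smul, LinearMap.smul_apply, map_smul, smul_eq_mul, smul_eq_mul,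
    ← mat_apply] at h1
  have h2 : ((B.len x : ℂ) + 2 * j - (B.len y + 2 * i + 2)) * B.mat T i j x y = 0 := by
    linear_combination h1
  have h3 := (mul_eq_zero.1 h2).resolve_right h0
  have h4 : ((B.len x + 2 * j : ℕ) : ℂ) = (B.len y + 2 * i + 2 : ℕ) := by
    push_cast
    linear_combination h3
  exact_mod_cast h4

/-- Comparing coordinates in e T = T e gives a recursion along the diagonals of entries with fixed i
- j. -/
theorem mat_succ_succ {T : Module.End ℂ (SV m k)} (hT : ⁅e, T⁆ = 0) (i j : ℕ) (x y : I) :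
    ((i + 1 : ℂ) * (B.len x - (i + 1))) * B.mat T (i + 1) (j + 1) x y =
      ((j + 1 : ℂ) * (B.len y - (j + 1))) * B.mat T i j x y := by
  have h1 := congrArg (B.coord x i) (LinearMap.congr_fun hT (B.vec y (j + 1)))
  rw [end_lie_def, LinearMap.sub_apply, Module.End.mul_apply, Module.End.mul_apply, e_vec_succ,
    map_smul, map_sub, coord_e, map_smul, LinearMap.zero_apply, map_zero, smul_eq_mul,
    sub_eq_zero] at h1
  exact h1

theorem mat_succ_zero {T : Module.End ℂ (SV m k)} (hT : ⁅e, T⁆ = 0) (i : ℕ) (x y : I) :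
    ((i + 1 : ℂ) * (B.len x - (i + 1))) * B.mat T (i + 1) 0 x y = 0 := by
  have h1 := congrArg (B.coord x i) (LinearMap.congr_fun hT (B.vec y 0))
  rwa [end_lie_def, LinearMap.sub_apply, Module.End.mul_apply, Module.End.mul_apply, e_vec_zero,
    map_zero, sub_zero, coord_e, LinearMap.zero_apply, map_zero] at h1

theorem mat_adjoint {T : Module.End ℂ (SV m k)} (hT : T ∈ osp m k 0) {i j i' l : ℕ} {y z : I}
    (hz : i + l + 1 = B.len z) (hy : i' + j + 1 = B.len y) :
    (-1) ^ i * ∑ x, B.mat T i j x y * B.gram x z =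
      -((-1) ^ j * ∑ x, B.gram y x * B.mat T i' l x z) := by
  have := osp_zero_form hT (B.vec y j) (B.vec z l)
  rwa [form_vec_left B hz, form_vec_right B hy] at this

theorem coord_eq_zero_of_homog {r : ZMod 2} {u : SV m k} (hu : u ∈ homog m k r) {x : I}
    (hx : B.parity x ≠ r) (i : ℕ) : B.coord x i u = 0 := by
  have h5 : B.coord x i (twist 1 u) = ksign 1 (B.parity x) * B.coord x i u := by
    suffices B.coord x i ∘ₗ twist 1 = ksign 1 (B.parity x) • B.coord x i from
      LinearMap.congr_fun this u
    refine B.linearMap_ext fun z l => ?_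
    simp only [LinearMap.comp_apply, twist_vec, map_smul, LinearMap.smul_apply, smul_eq_mul,
      coord_vec]
    by_cases hz : x = z
    · rw [hz]
    · rw [if_neg fun h6 => hz h6.1, mul_zero, mul_zero]
  rw [twist_apply 1 r hu, map_smul, smul_eq_mul] at h5
  rcases zmod_two_cases (B.parity x) with h1 | h1 <;> rcases zmod_two_cases r with h2 | h2
  · exact absurd (h1.trans h2.symm) hx
  · rw [h1, h2, ksign_one_one, ksign_zero_right] at h5
    linear_combination (-1 / 2) * h5
  · rw [h1, h2, ksign_one_one, ksign_zero_right] at h5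
    linear_combination (1 / 2) * h5
  · exact absurd (h1.trans h2.symm) hx

theorem mat_parity {p : ZMod 2} {T : Module.End ℂ (SV m k)} (hT : T ∈ glPart m k p) {i j : ℕ}
    {x y : I} (h0 : B.mat T i j x y ≠ 0) : B.parity x = B.parity y + p := by
  by_contra h1
  exact h0 (coord_eq_zero_of_homog (hT _ _ (B.vec_mem_homog y j)) h1 i)

theorem sign_eq_one_of_gram {x : I} (hx : B.gram x x ≠ 0) : B.sign x = 1 := by
  have := B.gram_symm x x
  exact mul_right_cancel₀ hx (by rw [one_mul]; exact this.symm)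

/-- A string that is the only one of its class has nonzero norm. -/
theorem gram_self_ne_zero {γ : Type*} {τ : I → γ} (hτ : ∀ x y, B.gram x y ≠ 0 → τ x = τ y) {x : I}
    (hx : ∀ x', τ x' = τ x → x' = x) : B.gram x x ≠ 0 := by
  intro h0
  have h1 : B.gram * B.gram⁻¹ = 1 := Matrix.mul_nonsing_inv _ isUnit_gram_det
  have h2 := congrFun (congrFun h1 x) x
  rw [Matrix.mul_apply, Matrix.one_apply_eq, Finset.sum_eq_zero] at h2
  · exact zero_ne_one h2
  · intro y _
    by_cases hy : y = x
    · rw [hy, h0, zero_mul]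
    · rw [not_imp_comm.1 (hτ x y) (fun h3 => hy (hx y h3.symm)), zero_mul]

theorem parity_eq_zero_iff {z : I} (hz : B.sign z = 1) : B.parity z = 0 ↔ Odd (B.len z) := by
  have hl := B.len_pos z
  rw [Nat.odd_iff]
  rw [sign] at hz
  rcases Nat.even_or_odd (B.len z - 1) with h1 | h1
  · rw [h1.neg_one_pow, one_mul] at hz
    have h2 := Nat.even_iff.1 h1
    refine ⟨fun _ => by omega, fun _ => ?_⟩
    refine (zmod_two_cases _).resolve_right fun h3 => ?_
    rw [h3, ksign_one_one] at hz
    norm_num at hz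
  · rw [h1.neg_one_pow] at hz
    have h2 := Nat.odd_iff.1 h1
    refine ⟨fun h3 => ?_, fun _ => by omega⟩
    rw [h3, ksign_zero_left] at hz
    norm_num at hz

theorem parity_eq_of_sign {x y : I} (hx : B.sign x = 1) (hy : B.sign y = 1)
    (hxy : (B.len x + B.len y) % 2 = 0) : B.parity x = B.parity y := by
  have h1 := parity_eq_zero_iff hx
  have h2 := parity_eq_zero_iff hy
  rw [Nat.odd_iff] at h1 h2
  rcases zmod_two_cases (B.parity x) with h3 | h3 <;> rcases zmod_two_cases (B.parity y) with h4 | h4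
  · rw [h3, h4]
  · have := h1.1 h3
    have := mt h2.2 (by rw [h4]; exact one_ne_zero)
    omega
  · have := h2.1 h4
    have := mt h1.2 (by rw [h3]; exact one_ne_zero)
    omega
  · rw [h3, h4]

/-- There are no odd highest weight vectors of weight `2` commuting with the even part
of `𝔤^♮`. -/
theorem odd_eq_zero (B : StringBasis e h f I) {T : Module.End ℂ (SV m k)} (hT : T ∈ osp m k 1)
    (hh : ⁅h, T⁆ = (2 : ℂ) • T) (hg : ∀ X ∈ gnat e h f 0, X * T = T * X) : T = 0 := by
  apply B.eq_zero_of_mat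
  intro i j x y
  by_contra h0
  have hτ : ∀ x y, B.gram x y ≠ 0 → (B.len x, B.parity x) = (B.len y, B.parity y) :=
    fun x y h1 => Prod.ext (B.gram_ne_zero h1).1 (B.gram_ne_zero h1).2
  have hlen : ∀ x y, (B.len x, B.parity x) = (B.len y, B.parity y) → B.len x = B.len y :=
    fun x y h1 => congrArg Prod.fst h1
  have hc : ∀ x y, (B.len x, B.parity x) = (B.len y, B.parity y) →
      B.op (B.skewUnit x y * B.gram) * T = T * B.op (B.skewUnit x y * B.gram) := by
    intro x y hxy
    have := op_skewUnit_mem_gnat (hlen x y hxy)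
    rw [show B.parity x = B.parity y from congrArg Prod.snd hxy, CharTwo.add_self_eq_zero] at this
    exact hg _ this
  have hpar : B.parity x ≠ B.parity y := by
    rw [mat_parity hT.1 h0]
    simp
  have htyp : (B.len x, B.parity x) ≠ (B.len y, B.parity y) := fun h1 =>
    hpar (congrArg Prod.snd h1)
  -- An odd T connects different classes, so a nonzero entry forces each of the two classes to
  -- consist of a single string.
  have hx : ∀ x', (B.len x', B.parity x') = (B.len x, B.parity x) → x' = x := by
    intro x' hx'
    by_contra h1
    exact h0 (mat_eq_zero_of_class hτ hlen hc h1 hx' htyp.symm i j).2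
  have hy : ∀ y', (B.len y', B.parity y') = (B.len y, B.parity y) → y' = y := by
    intro y' hy'
    by_contra h1
    exact h0 (mat_eq_zero_of_class hτ hlen hc h1 hy' htyp i j).1
  -- Single strings have nonzero norm, hence sign 1, so their parity is a function of the length mod
  -- 2. Weight 2 makes the two lengths congruent mod 2, which contradicts the difference of
  -- parities.
  have hw := mat_weight hh h0
  exact hpar (parity_eq_of_sign (sign_eq_one_of_gram (gram_self_ne_zero hτ hx))
    (sign_eq_one_of_gram (gram_self_ne_zero hτ hy)) (by omega))

end Commutant

end StringBasis
namespace StringBasis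

set_option linter.unusedSectionVars false

/-! ### Highest weight vectors are determined by finitely many entries. -/

section EvenCommutant

variable {m k : ℕ} {e h f : Module.End ℂ (SV m k)} {I : Type} {B : StringBasis e h f I}
  [DecidableEq I] [Fintype I] {T : Module.End ℂ (SV m k)}

theorem commute_skewUnit (hT : T ∈ adjHighest e h f) {x y : I} (hxy : B.len x = B.len y) :
    B.op (B.skewUnit x y * B.gram) * T = T * B.op (B.skewUnit x y * B.gram) :=
  hT.2.2.2 _ _ (op_skewUnit_mem_gnat hxy)

theorem gram_len {x y : I} (h0 : B.gram x y ≠ 0) : B.len x = B.len y := (B.gram_ne_zero h0).1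

theorem mat_eq_zero_of_len (hT : T ∈ adjHighest e h f) {x x' u : I} (hx : x' ≠ x)
    (hx' : B.len x' = B.len x) (hu : B.len u ≠ B.len x) (i j : ℕ) :
    B.mat T i j u x = 0 ∧ B.mat T i j x u = 0 :=
  mat_eq_zero_of_class (fun _ _ => gram_len) (fun _ _ h0 => h0)
    (fun _ _ => commute_skewUnit hT) hx hx' hu i j

/-- Between strings of equal length q, commuting with e makes the entries of T proportional to the
coefficients (i+1)(q-1-i) of e itself, whose value at i = 0 is q - 1. -/
theorem mat_succ_eq (hT : T ∈ adjHighest e h f) {x y : I} (hxy : B.len x = B.len y) {i : ℕ}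
    (hi : i + 1 < B.len x) :
    ((B.len x : ℂ) - 1) * B.mat T i (i + 1) x y =
      ((i + 1 : ℂ) * (B.len x - 1 - i)) * B.mat T 0 1 x y := by
  induction i with
  | zero => simp
  | succ i ih =>
    have h1 := mat_succ_succ (B := B) hT.2.1 i (i + 1) x y
    have h2 := ih (by omega)
    rw [← hxy] at h1
    have h3 : (i + 1 : ℂ) ≠ 0 := Nat.cast_add_one_ne_zero i
    have h4 : ((B.len x : ℂ) - 1 - i) ≠ 0 := by
      have : ((B.len x - 1 - i : ℕ) : ℂ) ≠ 0 := Nat.cast_ne_zero.2 (by omega)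
      rwa [Nat.cast_sub (by omega), Nat.cast_sub (by omega), Nat.cast_one] at this
    apply mul_left_cancel₀ (mul_ne_zero h3 h4)
    push_cast at *
    linear_combination ((B.len x : ℂ) - 1) * h1 + ((i : ℂ) + 1 + 1) * (B.len x - (i + 1 + 1)) * h2

/-- Both T and e are skew, so the matrix by which T acts on the multiplicity space is self-adjoint
for the Gram matrix. This excludes, for instance, the skew operators in the commutant of 𝔰𝔬₂. -/
theorem conj_eq_transpose (hT : T ∈ adjHighest e h f) {y z : I} (hyz : B.len y = B.len z)
    (hy : 2 ≤ B.len y) : B.conj (B.mat T 0 1) y z = B.mat T 0 1 z y := by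
  have key : ∀ w, B.len w = B.len y →
      ((B.mat T 0 1).transpose * B.gram) y w = (B.gram * B.mat T 0 1) y w := by
    intro w hw
    -- The adjoint of the entry at positions (0, 1) sits at positions (q-2, q-1), and the
    -- coefficients of e at the two ends of a string agree.
    have h1 := mat_adjoint (B := B) hT.1 (i := 0) (j := 1) (i' := B.len y - 2) (l := B.len y - 1)
      (y := y) (z := w) (by omega) (by omega)
    rw [pow_zero, one_mul, pow_one, neg_one_mul, neg_neg] at h1
    rw [Matrix.mul_apply, Matrix.mul_apply]
    refine h1.trans (Finset.sum_congr rfl fun x _ => ?_)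
    by_cases hx : B.len y = B.len x
    · have h2 := mat_succ_eq hT (hx.symm.trans hw.symm) (i := B.len y - 2) (by omega)
      rw [show B.len y - 2 + 1 = B.len y - 1 by omega, ← hx, Nat.cast_sub hy] at h2
      have h3 : ((B.len y : ℂ) - 1) ≠ 0 := by
        have : ((B.len y - 1 : ℕ) : ℂ) ≠ 0 := Nat.cast_ne_zero.2 (by omega)
        rwa [Nat.cast_sub (by omega), Nat.cast_one] at this
      congr 1
      apply mul_left_cancel₀ h3
      push_cast at h2
      linear_combination h2
    · rw [B.gram_of_ne hx, zero_mul, zero_mul]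
  have h1 : B.conj (B.mat T 0 1) y z = ((B.mat T 0 1).transpose * B.gram * B.gram⁻¹) y z := by
    rw [conj, Matrix.mul_apply, Matrix.mul_apply]
    refine Finset.sum_congr rfl fun w _ => ?_
    by_cases hw : B.len w = B.len z
    · rw [key w (hw.trans hyz.symm)]
    · rw [gram_inv_block (fun _ _ => gram_len) hw, mul_zero, mul_zero]
  rw [h1, Matrix.mul_assoc, Matrix.mul_nonsing_inv _ isUnit_gram_det, Matrix.mul_one,
    Matrix.transpose_apply]

/-- The entry (x, y) of the relation for x ⊗ y ∓ y ⊗ x compares the two diagonal entries, after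
self-adjointness removes the conjugation. -/
theorem mat_diag (hT : T ∈ adjHighest e h f) {x y : I} (hxy : B.len x = B.len y)
    (hx : 2 ≤ B.len x) : B.mat T 0 1 x x = B.mat T 0 1 y y := by
  by_cases h0 : x = y
  · rw [h0]
  have h1 := skewUnit_commute (mat_skewUnit_commute hxy (commute_skewUnit hT hxy) 0 1) x y
  rw [if_pos rfl, if_pos rfl, if_neg h0, if_neg (Ne.symm h0),
    conj_eq_transpose hT rfl (hxy ▸ hx), sub_zero, sub_zero] at h1
  exact h1.symm

/-- Let s be the common sign of the pairs (x, y) and (x, x), and a the entry. The element built from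
x and y gives a = -s a, and the one built from x alone gives a = s a, so 2a = 0. -/
theorem mat_offdiag (hT : T ∈ adjHighest e h f) {x y : I} (hxy : B.len x = B.len y)
    (hx : 2 ≤ B.len x) (h0 : x ≠ y) : B.mat T 0 1 y x = 0 := by
  by_contra hA
  have hp := mat_parity hT.1.1 hA
  rw [add_zero] at hp
  have h1 := skewUnit_commute (mat_skewUnit_commute hxy (commute_skewUnit hT hxy) 0 1) y y
  rw [if_pos rfl, if_pos rfl, if_neg h0.symm, if_neg h0.symm, conj_eq_transpose hT hxy hx,
    zero_sub, sub_zero] at h1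
  have h2 := skewUnit_commute (mat_skewUnit_commute rfl (commute_skewUnit hT (rfl : B.len x = _)) 0 1)
    y x
  rw [if_pos rfl, if_pos rfl, if_neg h0.symm, if_neg h0.symm, sub_zero,
    show B.pairSign x x = B.pairSign x y by rw [pairSign, pairSign, hp]] at h2
  apply hA
  linear_combination -(1 / 2) * h2 - (1 / 2) * h1

/-- Two strings, each the only one of its length, whose lengths differ by two. -/
def IsPair (B : StringBasis e h f I) (x y : I) : Prop :=
  B.len x = B.len y + 2 ∧ (∀ x', B.len x' = B.len x → x' = x) ∧ ∀ y', B.len y' = B.len y → y' = y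

/-- Both strings may be assumed alone in their lengths. Commutation with e propagates vanishing down
each diagonal from its first entry. Weights rule out entries (0, j+1), the top of the shorter string
goes only to a highest weight vector, and a nonzero corner entry would require lengths differing by
exactly 2. -/
theorem mat_eq_zero_of_lt (hT : T ∈ adjHighest e h f)
    (h2 : ∀ x y, B.IsPair x y → B.mat T 0 0 x y = 0) {x y : I} (hlt : B.len y < B.len x)
    (i j : ℕ) : B.mat T i j x y = 0 := by
  by_cases hx : ∀ x', B.len x' = B.len x → x' = x
  swap
  · push Not at hx
    obtain ⟨x', hx', hne⟩ := hx
    exact (mat_eq_zero_of_len hT hne hx' hlt.ne i j).2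
  by_cases hy : ∀ y', B.len y' = B.len y → y' = y
  swap
  · push Not at hy
    obtain ⟨y', hy', hne⟩ := hy
    exact (mat_eq_zero_of_len hT hne hy' hlt.ne' i j).1
  have hcoef : ∀ i : ℕ, i + 1 < B.len x → (i + 1 : ℂ) * (B.len x - (i + 1)) ≠ 0 := by
    intro i hi
    refine mul_ne_zero (Nat.cast_add_one_ne_zero i) ?_
    have : ((B.len x - (i + 1) : ℕ) : ℂ) ≠ 0 := Nat.cast_ne_zero.2 (by omega)
    rwa [Nat.cast_sub hi.le, Nat.cast_add, Nat.cast_one] at this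
  induction j generalizing i with
  | zero =>
    rcases i with _ | i
    · by_contra h0
      have hw := mat_weight hT.2.2.1 h0
      exact h0 (h2 x y ⟨by omega, hx, hy⟩)
    · by_cases hi : i + 1 < B.len x
      · exact (mul_eq_zero.1 (mat_succ_zero hT.2.1 i x y)).resolve_left (hcoef i hi)
      · exact B.mat_eq_zero_of_le_left T 0 y (not_lt.1 hi)
  | succ j ih =>
    rcases i with _ | i
    · by_contra h0
      have hw := mat_weight hT.2.2.1 h0
      omega
    · by_cases hi : i + 1 < B.len x
      · have := mat_succ_succ (B := B) hT.2.1 i j x y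
        rw [ih, mul_zero] at this
        exact (mul_eq_zero.1 this).resolve_left (hcoef i hi)
      · exact B.mat_eq_zero_of_le_left T _ y (not_lt.1 hi)

theorem adjHighest_eq_zero (B : StringBasis e h f I) (hT : T ∈ adjHighest e h f)
    (h1 : ∀ x, 2 ≤ B.len x → B.mat T 0 1 x x = 0)
    (h2 : ∀ x y, B.IsPair x y → B.mat T 0 0 x y = 0) : T = 0 := by
  apply B.eq_zero_of_mat
  intro i j x y
  rcases lt_trichotomy (B.len y) (B.len x) with hlt | heq | hlt
  · exact mat_eq_zero_of_lt hT h2 hlt i j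
  · by_contra h0
    have hw := mat_weight hT.2.2.1 h0
    obtain rfl : j = i + 1 := by omega
    have hi : i + 1 < B.len x := by
      by_contra hi
      exact h0 (B.mat_eq_zero_of_le_right T i x (by omega))
    have h3 := mat_succ_eq hT heq.symm hi
    have h4 : B.mat T 0 1 x y = 0 := by
      by_cases hxy : x = y
      · rw [← hxy]; exact h1 x (by omega)
      · exact mat_offdiag hT heq (by omega) (Ne.symm hxy)
    have h5 : ((B.len x : ℂ) - 1) ≠ 0 := by
      have : ((B.len x - 1 : ℕ) : ℂ) ≠ 0 := Nat.cast_ne_zero.2 (by omega)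
      rwa [Nat.cast_sub (by omega), Nat.cast_one] at this
    rw [h4, mul_zero] at h3
    exact h0 ((mul_eq_zero.1 h3).resolve_left h5)
  · by_cases hx : ∀ x', B.len x' = B.len x → x' = x
    swap
    · push Not at hx
      obtain ⟨x', hx', hne⟩ := hx
      exact (mat_eq_zero_of_len hT hne hx' hlt.ne' i j).2
    by_cases hi : i < B.len x
    swap
    · exact B.mat_eq_zero_of_le_left T j y (not_lt.1 hi)
    by_cases hj : j < B.len y
    swap
    · exact B.mat_eq_zero_of_le_right T i x (not_lt.1 hj)
    -- Entries from a longer string to a shorter one are the adjoints of entries in the opposite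
    -- direction, which already vanish.
    have h3 := mat_adjoint (B := B) hT.1 (i := i) (j := j) (i' := B.len y - 1 - j)
      (l := B.len x - 1 - i) (y := y) (z := x) (by omega) (by omega)
    rw [Finset.sum_eq_single x, Finset.sum_eq_zero, mul_zero, neg_zero] at h3
    · have h4 := gram_self_ne_zero (fun _ _ => gram_len) hx
      exact (mul_eq_zero.1 ((mul_eq_zero.1 h3).resolve_left (by simp))).resolve_right h4
    · intro w _
      by_cases hw : B.len y = B.len w
      · rw [mat_eq_zero_of_lt hT h2 (by omega), mul_zero]
      · rw [B.gram_of_ne hw, zero_mul]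
    · intro w _ hw
      rw [B.gram_of_ne fun h5 => hw (hx w h5), mul_zero]
    · simp

end EvenCommutant

end StringBasis
namespace StringBasis

set_option linter.unusedSectionVars false

/-! ### Construction of the highest weight vectors. -/

section Existence

variable {m k : ℕ} {e h f : Module.End ℂ (SV m k)} {I : Type} {B : StringBasis e h f I}
  [DecidableEq I] [Fintype I]

theorem mul_eq_mul_of_lie_eq_zero {X Y : Module.End ℂ (SV m k)} (h0 : ⁅X, Y⁆ = 0) :
    X * Y = Y * X := by
  rwa [end_lie_def, sub_eq_zero] at h0

theorem op_mul_op {N N' : Matrix I I ℂ} (hN : B.IsBlock N) (hN' : B.IsBlock N') :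
    B.op N * B.op N' = B.op (N * N') := by
  refine B.linearMap_ext fun z j => B.eq_of_coord fun x i => ?_
  rw [Module.End.mul_apply, coord_op hN, coord_op (hN.mul hN')]
  simp_rw [coord_op hN', Finset.mul_sum, Matrix.mul_apply, Finset.sum_mul]
  rw [Finset.sum_comm]
  simp_rw [mul_assoc]

/-- Every element of `𝔤^♮` acts by a matrix on the multiplicity spaces. -/
theorem gnat_eq_op (B : StringBasis e h f I) {p : ZMod 2} {X : Module.End ℂ (SV m k)}
    (hX : X ∈ gnat e h f p) : ∃ N : Matrix I I ℂ, B.IsBlock N ∧ X = B.op N := by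
  obtain ⟨-, he, hh, hf⟩ := hX
  rw [end_lie_def, sub_eq_zero] at he hh hf
  have he' : ∀ u, X (e u) = e (X u) := LinearMap.congr_fun he
  have hh' : ∀ u, X (h u) = h (X u) := LinearMap.congr_fun hh
  have hf' : ∀ u, X (f u) = f (X u) := LinearMap.congr_fun hf
  -- X maps a top vector to a vector killed by e, which has only top coordinates.
  have h1 : ∀ x i z, B.coord x (i + 1) (X (B.vec z 0)) = 0 := by
    intro x i z
    by_cases hi : i + 1 < B.len x
    · have := congrArg (B.coord x i) (he' (B.vec z 0))
      rw [e_vec_zero, map_zero, map_zero, coord_e] at this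
      refine (mul_eq_zero.1 this.symm).resolve_left (mul_ne_zero (Nat.cast_add_one_ne_zero i) ?_)
      have : ((B.len x - (i + 1) : ℕ) : ℂ) ≠ 0 := Nat.cast_ne_zero.2 (by omega)
      rwa [Nat.cast_sub hi.le, Nat.cast_add, Nat.cast_one] at this
    · rw [coord_of_le B (not_lt.1 hi), LinearMap.zero_apply]
  set N : Matrix I I ℂ := Matrix.of fun x z => B.coord x 0 (X (B.vec z 0)) with hNdef
  have hN : B.IsBlock N := by
    intro x z hxz
    have := congrArg (B.coord x 0) (hh' (B.vec z 0))
    rw [h_vec, map_smul, map_smul, coord_h, smul_eq_mul] at this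
    have h2 : ((B.len z : ℂ) - B.len x) * N x z = 0 := by
      rw [hNdef, Matrix.of_apply]
      push_cast at this
      linear_combination this
    refine (mul_eq_zero.1 h2).resolve_left (sub_ne_zero.2 ?_)
    exact_mod_cast Ne.symm hxz
  have h0 : ∀ z, X (B.vec z 0) = ∑ w, N w z • B.vec w 0 := by
    intro z
    refine B.eq_of_coord fun x i => ?_
    rw [map_sum, Finset.sum_eq_single x]
    · rcases i with _ | i
      · rw [map_smul, coord_vec_self B (B.len_pos x), smul_eq_mul, mul_one]; rfl
      · rw [h1, map_smul, coord_vec_ne_index B x x (Nat.succ_ne_zero i), smul_zero]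
    · intro w _ hw
      rw [map_smul, coord_vec_ne_string B (Ne.symm hw), smul_zero]
    · simp
  refine ⟨N, hN, B.linearMap_ext fun z j => ?_⟩
  rw [op_vec hN]
  induction j with
  | zero => exact h0 z
  | succ j ih =>
    rw [← f_vec, hf', ih, map_sum]
    exact Finset.sum_congr rfl fun w _ => by rw [map_smul, f_vec]

/-- The indicator matrix of the strings of length `q`. -/
noncomputable def lenProj (B : StringBasis e h f I) (q : ℕ) : Matrix I I ℂ :=
  Matrix.diagonal fun x => if B.len x = q then 1 else 0

theorem isBlock_lenProj (q : ℕ) : B.IsBlock (B.lenProj q) := by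
  intro w z hwz
  rw [lenProj, Matrix.diagonal_apply_ne]
  rintro rfl
  exact hwz rfl

theorem op_lenProj_vec (q : ℕ) (z : I) (j : ℕ) :
    B.op (B.lenProj q) (B.vec z j) = if B.len z = q then B.vec z j else 0 := by
  rw [op_vec (isBlock_lenProj q), Finset.sum_eq_single z]
  · rw [lenProj, Matrix.diagonal_apply_eq]
    split_ifs <;> simp
  · intro w _ hw
    rw [lenProj, Matrix.diagonal_apply_ne _ hw, zero_smul]
  · simp

theorem lenProj_comm {N : Matrix I I ℂ} (hN : B.IsBlock N) (q : ℕ) :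
    N * B.lenProj q = B.lenProj q * N := by
  ext x y
  rw [lenProj, Matrix.mul_diagonal, Matrix.diagonal_mul]
  by_cases hxy : B.len x = B.len y
  · rw [hxy, mul_comm]
  · rw [hN x y hxy, zero_mul, mul_zero]

theorem form_op_lenProj (q : ℕ) (u v : SV m k) :
    form m k (B.op (B.lenProj q) u) v = form m k u (B.op (B.lenProj q) v) := by
  suffices form m k ∘ₗ B.op (B.lenProj q) = (form m k).compl₂ (B.op (B.lenProj q)) from
    LinearMap.congr_fun (LinearMap.congr_fun this u) v
  refine B.linearMap_ext fun z j => B.linearMap_ext fun w i => ?_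
  rw [LinearMap.comp_apply, LinearMap.compl₂_apply, op_lenProj_vec, op_lenProj_vec]
  by_cases hzw : B.len z = B.len w
  · rw [hzw]; split_ifs <;> simp
  · have h0 : form m k (B.vec z j) (B.vec w i) = 0 := by
      rw [form_vec, if_neg fun h1 => hzw h1.1]
    split_ifs <;> simp [h0]

theorem op_mem_glPart_zero {N : Matrix I I ℂ} (hN : B.IsBlock N)
    (hp : ∀ x y, N x y ≠ 0 → B.parity x = B.parity y) : B.op N ∈ glPart m k 0 := by
  refine mem_glPart_of_twist fun v => ?_
  suffices twist 1 ∘ₗ B.op N = ksign 1 0 • B.op N ∘ₗ twist 1 from LinearMap.congr_fun this v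
  refine B.linearMap_ext fun z j => ?_
  simp only [LinearMap.comp_apply, twist_vec, map_smul, op_vec hN, map_sum,
    Finset.smul_sum, ksign_zero_right, one_smul]
  refine Finset.sum_congr rfl fun w _ => ?_
  by_cases h0 : N w z = 0
  · simp [h0]
  · rw [hp w z h0, smul_comm]

theorem mem_osp_zero {T : Module.End ℂ (SV m k)} (hT : T ∈ glPart m k 0)
    (h0 : ∀ u v, form m k (T u) v = -form m k u (T v)) : T ∈ osp m k 0 :=
  ⟨hT, fun r v _ w => by rw [h0, ksign_zero_left, one_mul]⟩

/-- The restriction of `e` to the strings of length `q` is a highest weight vector. -/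
theorem e_mul_lenProj_mem (B : StringBasis e h f I) (q : ℕ) (hhe : ⁅h, e⁆ = (2 : ℂ) • e) :
    e * B.op (B.lenProj q) ∈ adjHighest e h f := by
  have hbl := isBlock_lenProj (B := B) q
  have hce : B.op (B.lenProj q) * e = e * B.op (B.lenProj q) := mul_eq_mul_of_lie_eq_zero (op_lie_e hbl)
  have hch : B.op (B.lenProj q) * h = h * B.op (B.lenProj q) := mul_eq_mul_of_lie_eq_zero (op_lie_h hbl)
  have hgl : e * B.op (B.lenProj q) ∈ glPart m k 0 := by
    have h1 : B.op (B.lenProj q) ∈ glPart m k 0 := op_mem_glPart_zero hbl fun x y hxy => by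
      by_cases h0 : x = y
      · rw [h0]
      · exact absurd (Matrix.diagonal_apply_ne _ h0) hxy
    have := glPart_mul B.e_mem.1 h1
    rwa [add_zero] at this
  have hosp : e * B.op (B.lenProj q) ∈ osp m k 0 := by
    refine mem_osp_zero hgl fun u v => ?_
    rw [Module.End.mul_apply, osp_zero_form B.e_mem, form_op_lenProj, ← Module.End.mul_apply, hce]
  have he : ⁅e, e * B.op (B.lenProj q)⁆ = 0 := by
    rw [end_lie_def, mul_assoc, hce, sub_self]
  have hh : ⁅h, e * B.op (B.lenProj q)⁆ = (2 : ℂ) • (e * B.op (B.lenProj q)) := by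
    rw [end_lie_def] at hhe ⊢
    rw [mul_assoc, hch, ← mul_assoc, ← mul_assoc, ← sub_mul, hhe, smul_mul_assoc]
  refine ⟨hosp, he, hh, fun p X hX => ?_⟩
  have hXe : X * e = e * X := mul_eq_mul_of_lie_eq_zero hX.2.1
  obtain ⟨N, hN, rfl⟩ := B.gnat_eq_op hX
  rw [← mul_assoc, hXe, mul_assoc, mul_assoc, op_mul_op hN hbl, op_mul_op hbl hN, lenProj_comm hN]

/-- A string that is the only one of its length is killed by `𝔤^♮`. -/
theorem gnat_apply_vec {p : ZMod 2} {N : Matrix I I ℂ}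
    (hX : B.op N ∈ gnat e h f p) (hN : B.IsBlock N) {x : I}
    (hx : ∀ x', B.len x' = B.len x → x' = x) : N x x = 0 := by
  by_contra h0
  have hv : ∀ j, B.op N (B.vec x j) = N x x • B.vec x j := by
    intro j
    rw [op_vec hN, Finset.sum_eq_single x]
    · intro w _ hw
      rw [hN w x fun h1 => hw (hx w h1), zero_smul]
    · simp
  have hp : B.parity x = B.parity x + p := by
    apply mat_parity (B := B) hX.1.1 (i := 0) (j := 0) (x := x) (y := x)
    rwa [mat_apply, hv, map_smul, coord_vec_self B (B.len_pos x), smul_eq_mul, mul_one]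
  have hp0 : p = 0 := by simpa using hp
  subst hp0
  -- X is even and acts on the string as a scalar c. Skewness gives c·norm = -c·norm with nonzero
  -- norm.
  have h1 := osp_zero_form hX.1 (B.vec x 0) (B.vec x (B.len x - 1))
  rw [hv, hv, map_smul, map_smul, LinearMap.smul_apply, ← gram_of_eq B rfl, smul_eq_mul] at h1
  have h2 := gram_self_ne_zero (fun _ _ => gram_len) hx
  apply h0
  apply mul_right_cancel₀ h2
  linear_combination (1 / 2) * h1

/-- The operator exchanging the strings of a pair, of weight `2`. -/
noncomputable def pairOp (B : StringBasis e h f I) (x y : I) : Module.End ℂ (SV m k) :=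
  B.basis.constr ℂ fun z =>
    -- With L the length of y, the coefficients c_j = (L-j)(L+1-j) solve (L+2-j) c_j = (L-j)
    -- c_{j-1}, the recursion for commuting with e. The coefficients on x are then dictated by
    -- skewness for the form.
    if z.1 = y then (((B.len y : ℂ) - (z.2 : ℕ)) * (B.len y + 1 - (z.2 : ℕ))) • B.vec x z.2
    else if z.1 = x then
      (-(B.gram x x / B.gram y y) * ((z.2 : ℕ) * ((z.2 : ℕ) - 1))) • B.vec y (z.2 - 2)
    else 0

variable {x y : I}

theorem IsPair.ne (hp : B.IsPair x y) : x ≠ y := by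
  rintro rfl
  have := hp.1
  omega

theorem pairOp_vec_y (hp : B.IsPair x y) (j : ℕ) :
    B.pairOp x y (B.vec y j) =
      (((B.len y : ℂ) - j) * (B.len y + 1 - j)) • B.vec x j := by
  by_cases hj : j < B.len y
  · rw [vec_of_lt B hj, pairOp, Module.Basis.constr_basis, if_pos rfl]
  · rw [vec_of_le B (not_lt.1 hj), map_zero]
    -- The string x is longer by two, and the coefficient vanishes exactly at the two positions
    -- where y has ended but x has not.
    by_cases h1 : j = B.len y
    · rw [h1]; simp
    · by_cases h2 : j = B.len y + 1
      · rw [h2]; simp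
      · rw [vec_of_le B (by rw [hp.1]; omega), smul_zero]

/-- The factor j(j-1) vanishes at j = 0 and j = 1, where the natural subtraction `j - 2` truncates.
-/
theorem pairOp_vec_x (hp : B.IsPair x y) (j : ℕ) :
    B.pairOp x y (B.vec x j) =
      (-(B.gram x x / B.gram y y) * ((j : ℂ) * (j - 1))) • B.vec y (j - 2) := by
  by_cases hj : j < B.len x
  · rw [vec_of_lt B hj, pairOp, Module.Basis.constr_basis, if_neg hp.ne, if_pos rfl]
  · rw [vec_of_le B (not_lt.1 hj), map_zero, vec_of_le B (by have := hp.1; omega), smul_zero]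

theorem pairOp_vec_of_ne {z : I} (hx : z ≠ x) (hy : z ≠ y) (j : ℕ) :
    B.pairOp x y (B.vec z j) = 0 := by
  by_cases hj : j < B.len z
  · rw [vec_of_lt B hj, pairOp, Module.Basis.constr_basis, if_neg hy, if_neg hx]
  · rw [vec_of_le B (not_lt.1 hj), map_zero]

theorem IsPair.gram_x (hp : B.IsPair x y) : B.gram x x ≠ 0 :=
  gram_self_ne_zero (fun _ _ => gram_len) hp.2.1

theorem IsPair.gram_y (hp : B.IsPair x y) : B.gram y y ≠ 0 :=
  gram_self_ne_zero (fun _ _ => gram_len) hp.2.2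

theorem IsPair.parity_eq (hp : B.IsPair x y) : B.parity x = B.parity y :=
  parity_eq_of_sign (sign_eq_one_of_gram hp.gram_x) (sign_eq_one_of_gram hp.gram_y)
    (by have := hp.1; omega)

theorem form_pairOp_aux (hp : B.IsPair x y) (i j : ℕ) :
    form m k (B.pairOp x y (B.vec y j)) (B.vec x i) =
      -form m k (B.vec y j) (B.pairOp x y (B.vec x i)) := by
  rw [pairOp_vec_y hp, pairOp_vec_x hp, map_smul, map_smul, LinearMap.smul_apply, form_vec,
    form_vec, smul_eq_mul, smul_eq_mul]
  have h1 := hp.1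
  have h2 := hp.gram_y
  rcases i with _ | _ | i
  · by_cases h0 : j + 0 + 1 = B.len x
    · have h3 : (j : ℂ) = B.len y + 1 := by exact_mod_cast (by omega : j = B.len y + 1)
      rw [h3]; simp
    · rw [if_neg (fun h3 => h0 h3.2)]; simp
  · by_cases h0 : j + 1 + 1 = B.len x
    · have h3 : (j : ℂ) = B.len y := by exact_mod_cast (by omega : j = B.len y)
      rw [h3]; simp
    · rw [if_neg (fun h3 => h0 (by simpa using h3.2))]; simp
  · by_cases h0 : j + i + 1 = B.len y
    · rw [if_pos ⟨rfl, by omega⟩, if_pos ⟨rfl, by simpa using h0⟩]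
      have h3 : (B.len y : ℂ) = j + i + 1 := by exact_mod_cast h0.symm
      rw [h3]
      push_cast
      field_simp
      ring
    · rw [if_neg (by omega), if_neg (fun h3 => h0 (by simpa using h3.2))]
      simp

theorem form_pairOp (hp : B.IsPair x y) (u v : SV m k) :
    form m k (B.pairOp x y u) v = -form m k u (B.pairOp x y v) := by
  suffices form m k ∘ₗ B.pairOp x y = -(form m k).compl₂ (B.pairOp x y) from
    LinearMap.congr_fun (LinearMap.congr_fun this u) v
  have hne : B.len y ≠ B.len x := by have := hp.1; omega
  have hx : ∀ w, w ≠ x → ∀ i j, form m k (B.vec x i) (B.vec w j) = 0 := fun w hw i j => by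
    rw [form_vec, if_neg fun h0 => hw (hp.2.1 w h0.1.symm)]
  have hx' : ∀ w, w ≠ x → ∀ i j, form m k (B.vec w i) (B.vec x j) = 0 := fun w hw i j => by
    rw [form_vec, if_neg fun h0 => hw (hp.2.1 w h0.1)]
  have hy : ∀ w, w ≠ y → ∀ i j, form m k (B.vec y i) (B.vec w j) = 0 := fun w hw i j => by
    rw [form_vec, if_neg fun h0 => hw (hp.2.2 w h0.1.symm)]
  have hy' : ∀ w, w ≠ y → ∀ i j, form m k (B.vec w i) (B.vec y j) = 0 := fun w hw i j => by
    rw [form_vec, if_neg fun h0 => hw (hp.2.2 w h0.1)]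
  have hxy := hp.ne
  refine B.linearMap_ext fun z j => B.linearMap_ext fun w i => ?_
  rw [LinearMap.comp_apply, LinearMap.neg_apply, LinearMap.neg_apply, LinearMap.compl₂_apply]
  by_cases hzx : z = x
  · subst hzx
    by_cases hwz : w = z
    · subst hwz
      rw [pairOp_vec_x hp, pairOp_vec_x hp]
      simp [hx _ hxy.symm, hx' _ hxy.symm]
    · by_cases hwy : w = y
      · subst hwy
        -- Supersymmetry of the form reduces this to the opposite order. The two strings have the
        -- same parity, so the same sign appears on both sides.
        have h1 := B.form_pairOp_aux hp j i
        have hpar : ∀ l l' : ℕ, form m k (B.vec z l) (B.vec z l') =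
          ksign (B.parity z) (B.parity z) * form m k (B.vec z l') (B.vec z l) := fun l l' =>
            form_homog_comm (B.vec_mem_homog z l) (B.vec_mem_homog z l')
        have hpar' : ∀ l l' : ℕ, form m k (B.vec w l) (B.vec w l') =
          ksign (B.parity z) (B.parity z) * form m k (B.vec w l') (B.vec w l) := fun l l' => by
            rw [hp.parity_eq]
            exact form_homog_comm (B.vec_mem_homog w l) (B.vec_mem_homog w l')
        have h2 := ksign_mul_self (B.parity z) (B.parity z)
        rw [pairOp_vec_y hp, pairOp_vec_x hp, map_smul, map_smul, LinearMap.smul_apply,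
          smul_eq_mul, smul_eq_mul] at h1 ⊢
        rw [hpar, hpar'] at h1
        linear_combination ksign (B.parity z) (B.parity z) * h1 -
          (((B.len w : ℂ) - i) * (B.len w + 1 - i) * form m k (B.vec z j) (B.vec z i) -
            B.gram z z / B.gram w w * (j * (j - 1)) *
              form m k (B.vec w (j - 2)) (B.vec w i)) * h2
      · rw [pairOp_vec_x hp, pairOp_vec_of_ne hwz hwy]
        simp [hy w hwy]
  · by_cases hzy : z = y
    · subst hzy
      by_cases hwx : w = x
      · subst hwx; exact form_pairOp_aux hp i j
      · by_cases hwz : w = z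
        · subst hwz
          rw [pairOp_vec_y hp, pairOp_vec_y hp]
          simp [hx _ hwx, hx' _ hwx]
        · rw [pairOp_vec_y hp, pairOp_vec_of_ne hwx hwz]
          simp [hx w hwx]
    · rw [pairOp_vec_of_ne hzx hzy]
      by_cases hwx : w = x
      · subst hwx; rw [pairOp_vec_x hp]; simp [hy' z hzy]
      · by_cases hwy : w = y
        · subst hwy; rw [pairOp_vec_y hp]; simp [hx' z hzx]
        · rw [pairOp_vec_of_ne hwx hwy]; simp

theorem pairOp_mem (hp : B.IsPair x y) : B.pairOp x y ∈ adjHighest e h f := by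
  have hxy := hp.ne
  have hl : (B.len x : ℂ) = B.len y + 2 := by exact_mod_cast hp.1
  refine ⟨mem_osp_zero (mem_glPart_of_twist fun v => ?_) (form_pairOp hp), ?_, ?_, ?_⟩
  · suffices twist 1 ∘ₗ B.pairOp x y = ksign 1 0 • B.pairOp x y ∘ₗ twist 1 from
      LinearMap.congr_fun this v
    refine B.linearMap_ext fun z j => ?_
    simp only [LinearMap.comp_apply, twist_vec, map_smul, ksign_zero_right,
      one_smul]
    by_cases hzx : z = x
    · subst hzx
      rw [pairOp_vec_x hp, map_smul, twist_vec, hp.parity_eq, smul_comm]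
    · by_cases hzy : z = y
      · subst hzy
        rw [pairOp_vec_y hp, map_smul, twist_vec, hp.parity_eq, smul_comm]
      · rw [pairOp_vec_of_ne hzx hzy, map_zero, smul_zero]
  · rw [end_lie_def, sub_eq_zero]
    refine B.linearMap_ext fun z j => ?_
    rw [Module.End.mul_apply, Module.End.mul_apply]
    by_cases hzx : z = x
    · subst hzx
      rcases j with _ | _ | _ | j
      · rw [pairOp_vec_x hp, e_vec_zero, map_zero]; simp
      · rw [pairOp_vec_x hp, e_vec_succ, map_smul, map_smul, pairOp_vec_x hp]; simp
      · rw [pairOp_vec_x hp, e_vec_succ, map_smul, map_smul, pairOp_vec_x hp,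
          show 0 + 1 + 1 - 2 = 0 from rfl, e_vec_zero]
        simp
      · rw [pairOp_vec_x hp, e_vec_succ, map_smul, map_smul, pairOp_vec_x hp,
          show j + 1 + 1 + 1 - 2 = j + 1 by omega, e_vec_succ, show j + 2 - 2 = j by omega,
          smul_smul, smul_smul, hl]
        push_cast
        congr 1
        ring
    · by_cases hzy : z = y
      · subst hzy
        rcases j with _ | j
        · rw [pairOp_vec_y hp, map_smul, e_vec_zero, e_vec_zero]; simp
        · rw [pairOp_vec_y hp, e_vec_succ, map_smul, map_smul, pairOp_vec_y hp, e_vec_succ,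
            smul_smul, smul_smul, hl]
          push_cast
          congr 1
          ring
      · rw [pairOp_vec_of_ne hzx hzy, map_zero]
        rcases j with _ | j
        · rw [e_vec_zero, map_zero]
        · rw [e_vec_succ, map_smul, pairOp_vec_of_ne hzx hzy, smul_zero]
  · rw [end_lie_def]
    refine B.linearMap_ext fun z j => ?_
    rw [LinearMap.sub_apply, Module.End.mul_apply, Module.End.mul_apply, LinearMap.smul_apply,
      h_vec, map_smul]
    by_cases hzx : z = x
    · subst hzx
      rcases j with _ | _ | j
      · rw [pairOp_vec_x hp]; simp
      · rw [pairOp_vec_x hp]; simp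
      · rw [pairOp_vec_x hp, map_smul, h_vec, show j + 1 + 1 - 2 = j by omega, hl]
        push_cast
        module
    · by_cases hzy : z = y
      · subst hzy
        rw [pairOp_vec_y hp, map_smul, h_vec, hl]
        module
      · rw [pairOp_vec_of_ne hzx hzy]; simp
  · intro p X hX
    obtain ⟨N, hN, rfl⟩ := B.gnat_eq_op hX
    -- Both strings are alone in their lengths, so the rows and columns of N at x and y vanish, and
    -- both products with `pairOp` are zero.
    have hNx : ∀ w, N w x = 0 ∧ N x w = 0 := by
      intro w
      by_cases hw : w = x
      · rw [hw, gnat_apply_vec hX hN hp.2.1]; exact ⟨rfl, rfl⟩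
      · exact ⟨hN w x fun h0 => hw (hp.2.1 w h0), hN x w fun h0 => hw (hp.2.1 w h0.symm)⟩
    have hNy : ∀ w, N w y = 0 ∧ N y w = 0 := by
      intro w
      by_cases hw : w = y
      · rw [hw, gnat_apply_vec hX hN hp.2.2]; exact ⟨rfl, rfl⟩
      · exact ⟨hN w y fun h0 => hw (hp.2.2 w h0), hN y w fun h0 => hw (hp.2.2 w h0.symm)⟩
    have kx : ∀ j, B.op N (B.vec x j) = 0 := fun j => by
      rw [op_vec hN]; exact Finset.sum_eq_zero fun w _ => by rw [(hNx w).1, zero_smul]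
    have ky : ∀ j, B.op N (B.vec y j) = 0 := fun j => by
      rw [op_vec hN]; exact Finset.sum_eq_zero fun w _ => by rw [(hNy w).1, zero_smul]
    refine B.linearMap_ext fun z j => ?_
    rw [Module.End.mul_apply, Module.End.mul_apply]
    have hR : B.pairOp x y (B.op N (B.vec z j)) = 0 := by
      rw [op_vec hN, map_sum]
      refine Finset.sum_eq_zero fun w _ => ?_
      by_cases hwx : w = x
      · rw [hwx, (hNx z).2, zero_smul, map_zero]
      · by_cases hwy : w = y
        · rw [hwy, (hNy z).2, zero_smul, map_zero]
        · rw [map_smul, pairOp_vec_of_ne hwx hwy, smul_zero]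
    rw [hR]
    by_cases hzx : z = x
    · subst hzx
      rw [pairOp_vec_x hp, map_smul, ky, smul_zero]
    · by_cases hzy : z = y
      · subst hzy
        rw [pairOp_vec_y hp, map_smul, kx, smul_zero]
      · rw [pairOp_vec_of_ne hzx hzy, map_zero]

end Existence

end StringBasis
namespace StringBasis

set_option linter.unusedSectionVars false

/-! ### Dimension count and comparison with the formula. -/

section Count

variable {m k : ℕ} {e h f : Module.End ℂ (SV m k)} {I : Type} {B : StringBasis e h f I}
  [DecidableEq I] [Fintype I]

/-- The lengths greater than `1` that occur. -/
def bigLengths (B : StringBasis e h f I) : Finset ℕ :=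
  (Finset.univ.image B.len).filter fun q => 1 < q

open Classical in
/-- The set of pairs. -/
noncomputable def pairs (B : StringBasis e h f I) : Finset (I × I) :=
  Finset.univ.filter fun x => B.IsPair x.1 x.2

theorem exists_len {q : ℕ} (hq : q ∈ B.bigLengths) : ∃ x, B.len x = q := by
  obtain ⟨x, -, hx⟩ := Finset.mem_image.1 (Finset.mem_filter.1 hq).1
  exact ⟨x, hx⟩

theorem mem_pairs {x : I × I} : x ∈ B.pairs ↔ B.IsPair x.1 x.2 := by
  simp [pairs]

/-- The matrix entries that determine a highest weight vector of weight `2`. -/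
noncomputable def entries (B : StringBasis e h f I) :
    adjHighest e h f →ₗ[ℂ] (B.bigLengths ⊕ B.pairs → ℂ) where
  toFun T := Sum.elim
    (fun q => B.mat T.1 0 1 (exists_len q.2).choose (exists_len q.2).choose)
    fun x => B.mat T.1 0 0 x.1.1 x.1.2
  map_add' S T := by
    funext a
    rcases a with q | x <;> simp [mat_apply]
  map_smul' c T := by
    funext a
    rcases a with q | x <;> simp [mat_apply]

theorem entries_injective : Function.Injective B.entries := by
  intro S T hST
  have hsub : S.1 - T.1 ∈ adjHighest e h f := Submodule.sub_mem _ S.2 T.2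
  refine Subtype.ext (sub_eq_zero.1 (adjHighest_eq_zero B hsub (fun x hx => ?_) fun x y hp => ?_))
  · have hq : B.len x ∈ B.bigLengths :=
      Finset.mem_filter.2 ⟨Finset.mem_image_of_mem _ (Finset.mem_univ x), hx⟩
    -- The diagonal entry does not depend on the chosen string of the given length.
    rw [mat_diag hsub (exists_len hq).choose_spec.symm hx, mat_apply, LinearMap.sub_apply, map_sub,
      sub_eq_zero]
    exact congrFun hST (Sum.inl ⟨_, hq⟩)
  · rw [mat_apply, LinearMap.sub_apply, map_sub, sub_eq_zero]
    exact congrFun hST (Sum.inr ⟨(x, y), mem_pairs.2 hp⟩)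

theorem exists_entries_eq_single (hhe : ⁅h, e⁆ = (2 : ℂ) • e) (a : B.bigLengths ⊕ B.pairs) :
    ∃ T, ∃ c : ℂ, c ≠ 0 ∧ B.entries T = Pi.single a c := by
  classical
  rcases a with ⟨q, hq⟩ | ⟨⟨x, y⟩, hp⟩
  · have hq1 : 1 < q := (Finset.mem_filter.1 hq).2
    -- The coefficient of e from position 1 to position 0 in a string of length q is q - 1.
    refine ⟨⟨_, e_mul_lenProj_mem B q hhe⟩, (q : ℂ) - 1, ?_, ?_⟩
    · rw [sub_ne_zero]; exact_mod_cast hq1.ne'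
    funext a
    rcases a with ⟨q', hq'⟩ | ⟨⟨x, y⟩, hp⟩
    · have hx := (exists_len hq').choose_spec
      set x := (exists_len hq').choose
      change B.coord x 0 ((e * B.op (B.lenProj q)) (B.vec x 1)) = _
      rw [Module.End.mul_apply, op_lenProj_vec, hx]
      by_cases h0 : q' = q
      · subst h0
        rw [if_pos rfl, Pi.single_eq_same, show B.vec x 1 = B.vec x (0 + 1) from rfl, e_vec_succ,
          map_smul, coord_vec_self B (B.len_pos x), hx]
        simp
      · rw [if_neg h0, Pi.single_eq_of_ne, map_zero, map_zero]
        intro h1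
        exact h0 (congrArg Subtype.val (Sum.inl_injective h1))
    · rw [Pi.single_eq_of_ne (by simp)]
      change B.coord x 0 ((e * B.op (B.lenProj q)) (B.vec y 0)) = 0
      rw [Module.End.mul_apply, op_lenProj_vec]
      split_ifs
      · rw [e_vec_zero, map_zero]
      · rw [map_zero, map_zero]
  · have hp' := mem_pairs.1 hp
    -- This is the coefficient of `pairOp` at position 0 of the shorter string.
    refine ⟨⟨_, pairOp_mem hp'⟩, (B.len y : ℂ) * (B.len y + 1), ?_, ?_⟩
    · exact mul_ne_zero (Nat.cast_ne_zero.2 (B.len_pos y).ne') (Nat.cast_add_one_ne_zero _)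
    funext a
    rcases a with ⟨q', hq'⟩ | ⟨⟨x', y'⟩, hp1⟩
    · rw [Pi.single_eq_of_ne (by simp)]
      set z := (exists_len hq').choose
      change B.coord z 0 (B.pairOp x y (B.vec z 1)) = 0
      by_cases hzx : z = x
      · rw [hzx, pairOp_vec_x hp']; simp
      · by_cases hzy : z = y
        · rw [hzy, pairOp_vec_y hp', map_smul, coord_vec_ne_string B (Ne.symm hp'.ne), smul_zero]
        · rw [pairOp_vec_of_ne hzx hzy, map_zero]
    · have hp1' := mem_pairs.1 hp1
      change B.coord x' 0 (B.pairOp x y (B.vec y' 0)) = _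
      by_cases hy : y' = y
      · subst hy
        obtain rfl : x' = x := hp'.2.1 x' (hp1'.1.trans hp'.1.symm)
        rw [Pi.single_eq_same, pairOp_vec_y hp', map_smul, coord_vec_self B (B.len_pos x')]
        simp
      · rw [Pi.single_eq_of_ne fun h1 => hy
          (congrArg (fun z => z.1.2) (Sum.inr_injective h1))]
        by_cases hx : y' = x
        · rw [hx, pairOp_vec_x hp']; simp
        · rw [pairOp_vec_of_ne hx hy, map_zero]

theorem entries_surjective (hhe : ⁅h, e⁆ = (2 : ℂ) • e) : Function.Surjective B.entries := by
  classical
  intro g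
  choose T c hc hT using exists_entries_eq_single (B := B) hhe
  refine ⟨∑ a, (g a / c a) • T a, ?_⟩
  rw [map_sum]
  funext b
  rw [Finset.sum_apply, Finset.sum_eq_single b]
  · rw [map_smul, hT, Pi.smul_apply, Pi.single_eq_same, smul_eq_mul, div_mul_cancel₀ _ (hc b)]
  · intro a _ ha
    rw [map_smul, hT, Pi.smul_apply, Pi.single_eq_of_ne (Ne.symm ha), smul_zero]
  · simp

theorem finrank_adjHighest (B : StringBasis e h f I) (hhe : ⁅h, e⁆ = (2 : ℂ) • e) :
    Module.finrank ℂ (adjHighest e h f) = B.bigLengths.card + B.pairs.card := by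
  rw [(LinearEquiv.ofBijective B.entries ⟨entries_injective, entries_surjective hhe⟩).finrank_eq,
    Module.finrank_fintype_fun_eq_card, Fintype.card_sum, Fintype.card_coe, Fintype.card_coe]

/-- The number of strings of length `q` and parity `p`. -/
def mult (B : StringBasis e h f I) (q : ℕ) (p : ZMod 2) : ℕ :=
  (Finset.univ.filter fun x => B.len x = q ∧ B.parity x = p).card

theorem mult_pos_iff {q : ℕ} {p : ZMod 2} :
    0 < B.mult q p ↔ ∃ x, B.len x = q ∧ B.parity x = p := by
  simp [mult, Finset.card_pos, Finset.Nonempty]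

theorem mult_of_unique {x : I} (hx : ∀ x', B.len x' = B.len x → x' = x) (p : ZMod 2) :
    B.mult (B.len x) p = if p = B.parity x then 1 else 0 := by
  split_ifs with hp
  · rw [mult, Finset.card_eq_one]
    refine ⟨x, ?_⟩
    ext x'
    simp only [Finset.mem_filter, Finset.mem_univ, true_and, Finset.mem_singleton]
    exact ⟨fun h0 => hx x' h0.1, fun h0 => by rw [h0, hp]; exact ⟨rfl, rfl⟩⟩
  · rw [← Nat.le_zero, ← not_lt, mult_pos_iff]
    rintro ⟨x', h1, h2⟩
    exact hp (by rw [← h2, hx x' h1])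

theorem exists_unique_of_mult {q : ℕ} {p r : ZMod 2} (hpr : p ≠ r) (h1 : B.mult q p = 1)
    (h0 : B.mult q r = 0) :
    ∃ x, B.len x = q ∧ B.parity x = p ∧ ∀ x', B.len x' = B.len x → x' = x := by
  obtain ⟨x, hx⟩ := Finset.card_eq_one.1 h1
  have hmem : ∀ x', (B.len x' = q ∧ B.parity x' = p) ↔ x' = x := fun x' => by
    simpa using (Finset.ext_iff.1 hx x')
  obtain ⟨hl, hp⟩ := (hmem x).2 rfl
  refine ⟨x, hl, hp, fun x' hx' => (hmem x').1 ⟨hx'.trans hl, ?_⟩⟩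
  by_contra h2
  have h3 : B.parity x' = r := by
    rcases zmod_two_cases (B.parity x') with h4 | h4 <;> rcases zmod_two_cases p with h5 | h5 <;>
      rcases zmod_two_cases r with h6 | h6 <;> simp_all
  have := mult_pos_iff.2 ⟨x', hx'.trans hl, h3⟩
  omega

/-- A pair is recorded by its two lengths. Both strings have nonzero norm, hence sign 1, and this is
the origin of the conditions "odd" for even strings and "even" for odd strings, as well as of the
equality of parities. -/
theorem card_pairs (B : StringBasis e h f I) {α β : Multiset ℕ}
    (hα : ∀ q, α.count q = B.mult q 0) (hβ : ∀ q, β.count q = B.mult q 1) :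
    B.pairs.card =
      ((distinctParts α β ×ˢ distinctParts α β).filter fun x =>
        x.1 = x.2 + 2 ∧ α.count x.1 = 1 ∧ α.count x.2 = 1 ∧ β.count x.1 = 0 ∧ β.count x.2 = 0 ∧
          Odd x.1 ∧ Odd x.2).card +
      ((distinctParts α β ×ˢ distinctParts α β).filter fun x =>
        x.1 = x.2 + 2 ∧ β.count x.1 = 1 ∧ β.count x.2 = 1 ∧ α.count x.1 = 0 ∧ α.count x.2 = 0 ∧
          Even x.1 ∧ Even x.2).card := by
  classical
  have hD : ∀ q, 1 ≤ α.count q ∨ 1 ≤ β.count q → q ∈ distinctParts α β := by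
    intro q hq
    simp only [distinctParts, Finset.mem_union, Multiset.mem_toFinset, ← Multiset.one_le_count_iff_mem]
    exact hq
  rw [← Finset.card_union_of_disjoint]
  · refine Finset.card_bij (fun x _ => (B.len x.1, B.len x.2)) ?_ ?_ ?_
    · rintro ⟨x, y⟩ hp
      replace hp := mem_pairs.1 hp
      have sx := sign_eq_one_of_gram hp.gram_x
      have sy := sign_eq_one_of_gram hp.gram_y
      have hpar := hp.parity_eq
      have mx := mult_of_unique hp.2.1
      have my := mult_of_unique hp.2.2
      have ox := parity_eq_zero_iff sx
      have oy := parity_eq_zero_iff sy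
      dsimp only at mx my ox oy hpar ⊢
      rw [Finset.mem_union, Finset.mem_filter, Finset.mem_filter, Finset.mem_product]
      simp only [hα, hβ, mx, my, ← hpar]
      rw [← hpar] at oy
      rcases zmod_two_cases (B.parity x) with h0 | h0
      · left
        refine ⟨⟨hD _ (Or.inl ?_), hD _ (Or.inl ?_)⟩, hp.1, ?_⟩
        · rw [hα, mx, if_pos h0.symm]
        · rw [hα, my, ← hpar, if_pos h0.symm]
        · rw [h0]
          exact ⟨rfl, rfl, rfl, rfl, ox.1 h0, oy.1 h0⟩
      · right
        refine ⟨⟨hD _ (Or.inr ?_), hD _ (Or.inr ?_)⟩, hp.1, ?_⟩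
        · rw [hβ, mx, if_pos h0.symm]
        · rw [hβ, my, ← hpar, if_pos h0.symm]
        · rw [h0] at ox oy ⊢
          rw [← Nat.not_odd_iff_even, ← Nat.not_odd_iff_even]
          exact ⟨rfl, rfl, rfl, rfl, fun h1 => one_ne_zero (ox.2 h1),
            fun h1 => one_ne_zero (oy.2 h1)⟩
    · rintro ⟨x, y⟩ hp ⟨x', y'⟩ - hxy
      replace hp := mem_pairs.1 hp
      rw [hp.2.1 x' (congrArg Prod.fst hxy).symm, hp.2.2 y' (congrArg Prod.snd hxy).symm]
    · rintro ⟨q, q'⟩ hq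
      rw [Finset.mem_union, Finset.mem_filter, Finset.mem_filter] at hq
      simp only [hα, hβ] at hq
      rcases hq with ⟨-, hq, h1, h2, h3, h4, -⟩ | ⟨-, hq, h1, h2, h3, h4, -⟩
      · obtain ⟨x, hx, -, ux⟩ := exists_unique_of_mult zero_ne_one h1 h3
        obtain ⟨y, hy, -, uy⟩ := exists_unique_of_mult zero_ne_one h2 h4
        exact ⟨(x, y), mem_pairs.2 ⟨by rw [hx, hy, hq], ux, uy⟩, by rw [hx, hy]⟩
      · obtain ⟨x, hx, -, ux⟩ := exists_unique_of_mult one_ne_zero h1 h3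
        obtain ⟨y, hy, -, uy⟩ := exists_unique_of_mult one_ne_zero h2 h4
        exact ⟨(x, y), mem_pairs.2 ⟨by rw [hx, hy, hq], ux, uy⟩, by rw [hx, hy]⟩
  · rw [Finset.disjoint_filter]
    rintro x - h1 h2
    have := h1.2.1
    have := h2.2.2.2.1
    omega

theorem finrank_adjHighest_eq_multFormula (B : StringBasis e h f I) (hhe : ⁅h, e⁆ = (2 : ℂ) • e)
    {α β : Multiset ℕ} (hα : ∀ q, α.count q = B.mult q 0) (hβ : ∀ q, β.count q = B.mult q 1) :
    Module.finrank ℂ (adjHighest e h f) = multFormula α β := by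
  rw [finrank_adjHighest B hhe, card_pairs B hα hβ, multFormula, add_assoc]
  congr 2
  rw [bigLengths]
  congr 1
  ext q
  simp only [Finset.mem_image, Finset.mem_univ, true_and, distinctParts, Finset.mem_union,
    Multiset.mem_toFinset, ← Multiset.count_pos, hα, hβ, mult_pos_iff]
  constructor
  · rintro ⟨x, hx⟩
    rcases zmod_two_cases (B.parity x) with h0 | h0
    · exact Or.inl ⟨x, hx, h0⟩
    · exact Or.inr ⟨x, hx, h0⟩
  · rintro (⟨x, hx, -⟩ | ⟨x, hx, -⟩) <;> exact ⟨x, hx⟩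

end Count

end StringBasis

/-! ### Passing from a pair of partitions to a basis of strings. -/

section OfEncodes

variable {m k : ℕ} {e h f : Module.End ℂ (SV m k)}

theorem isCompl_homog : IsCompl (homog m k 0) (homog m k 1) := by
  refine ⟨Submodule.disjoint_def.2 fun v h0 h1 => ?_, codisjoint_iff.2 (eq_top_iff.2 ?_)⟩
  · funext i
    rcases zmod_two_cases (par i) with hi | hi
    · exact h1 i (by rw [hi]; exact zero_ne_one)
    · exact h0 i (by rw [hi]; exact one_ne_zero)
  · rintro v -
    obtain ⟨v₀, h₀, v₁, h₁, rfl⟩ := exists_homog_add v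
    exact Submodule.add_mem_sup h₀ h₁

theorem count_eq_card_filter (s : Multiset ℕ) (q : ℕ) :
    s.count q = (Finset.univ.filter fun x : s => x.1 = q).card := by
  conv_lhs => rw [← Multiset.map_univ_coe s]
  rw [Multiset.count_map, Finset.card_def, Finset.filter_val]
  simp only [eq_comm]

theorem exists_stringBasis (he : e ∈ osp m k 0) (hh : h ∈ osp m k 0) (hf : f ∈ osp m k 0)
    {α β : Multiset ℕ} (hα : Encodes e h f 0 α) (hβ : Encodes e h f 1 β)
    (pα : ∀ q ∈ α, 0 < q) (pβ : ∀ q ∈ β, 0 < q) :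
    ∃ B : StringBasis e h f (α ⊕ β), (∀ q, α.count q = B.mult q 0) ∧
      ∀ q, β.count q = B.mult q 1 := by
  obtain ⟨b₀, hb₀⟩ := hα
  obtain ⟨b₁, hb₁⟩ := hβ
  let len : α ⊕ β → ℕ := Sum.elim (fun x => x.1) fun x => x.1
  let b : Module.Basis (Σ x : α ⊕ β, Fin (len x)) ℂ (SV m k) :=
    ((b₀.prod b₁).map (Submodule.prodEquivOfIsCompl _ _ isCompl_homog)).reindex
      (Equiv.sumSigmaDistrib fun x => Fin (len x)).symm
  have hb0 : ∀ (x : α) (j : Fin (len (Sum.inl x))), b ⟨Sum.inl x, j⟩ = b₀ ⟨x, j⟩ := by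
    intro x j
    refine (Module.Basis.reindex_apply _ _ _).trans ((Module.Basis.map_apply _ _ _).trans ?_)
    change ((b₀.prod b₁ (Sum.inl ⟨x, j⟩)).1 + (b₀.prod b₁ (Sum.inl ⟨x, j⟩)).2 : SV m k) = _
    rw [Module.Basis.prod_apply_inl_fst, Module.Basis.prod_apply_inl_snd]
    simp
  have hb1 : ∀ (x : β) (j : Fin (len (Sum.inr x))), b ⟨Sum.inr x, j⟩ = b₁ ⟨x, j⟩ := by
    intro x j
    refine (Module.Basis.reindex_apply _ _ _).trans ((Module.Basis.map_apply _ _ _).trans ?_)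
    change ((b₀.prod b₁ (Sum.inr ⟨x, j⟩)).1 + (b₀.prod b₁ (Sum.inr ⟨x, j⟩)).2 : SV m k) = _
    rw [Module.Basis.prod_apply_inr_fst, Module.Basis.prod_apply_inr_snd]
    simp
  refine ⟨{ len := len, parity := Sum.elim (fun _ => 0) fun _ => 1, len_pos := ?_, basis := b,
            mem_homog := ?_, h_basis := ?_, f_basis := ?_, e_basis := ?_, e_mem := he,
            h_mem := hh, f_mem := hf }, ?_, ?_⟩
  · rintro (x | x)
    · exact pα _ (Multiset.coe_mem)
    · exact pβ _ (Multiset.coe_mem)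
  · rintro (x | x) j
    · rw [hb0]; exact (b₀ _).2
    · rw [hb1]; exact (b₁ _).2
  · rintro (x | x) j
    · rw [hb0]; exact (hb₀ x j).1
    · rw [hb1]; exact (hb₁ x j).1
  · rintro (x | x) j
    · rw [hb0]
      refine (hb₀ x j).2.1.trans ?_
      by_cases hj : (j : ℕ) + 1 < x.1
      · have hj' : (j : ℕ) + 1 < len (Sum.inl x) := hj
        rw [dif_pos hj, dif_pos hj']
        exact (hb0 _ _).symm
      · have hj' : ¬ (j : ℕ) + 1 < len (Sum.inl x) := hj
        rw [dif_neg hj, dif_neg hj']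
    · rw [hb1]
      refine (hb₁ x j).2.1.trans ?_
      by_cases hj : (j : ℕ) + 1 < x.1
      · have hj' : (j : ℕ) + 1 < len (Sum.inr x) := hj
        rw [dif_pos hj, dif_pos hj']
        exact (hb1 _ _).symm
      · have hj' : ¬ (j : ℕ) + 1 < len (Sum.inr x) := hj
        rw [dif_neg hj, dif_neg hj']
  · rintro (x | x) j
    · rw [hb0, hb0]; exact (hb₀ x j).2.2
    · rw [hb1, hb1]; exact (hb₁ x j).2.2
  · intro q
    rw [count_eq_card_filter, StringBasis.mult,
      ← Finset.card_map (Function.Embedding.inl : α ↪ α ⊕ β)]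
    congr 1
    ext (x | x) <;> simp [len]
  · intro q
    rw [count_eq_card_filter, StringBasis.mult,
      ← Finset.card_map (Function.Embedding.inr : β ↪ α ⊕ β)]
    congr 1
    ext (x | x) <;> simp [len]

end OfEncodes

namespace StringBasis

set_option linter.unusedSectionVars false

/-! ### Skew multiplicity spaces and odd elements of square zero. -/

section SkewClasses

variable {m k : ℕ} {e h f : Module.End ℂ (SV m k)} {I : Type} {B : StringBasis e h f I}
  [DecidableEq I] [Fintype I]

theorem sign_eq (B : StringBasis e h f I) (x : I) :
    B.sign x = if B.parity x = 0 ↔ Odd (B.len x) then 1 else -1 := by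
  have hl := B.len_pos x
  have hpar : Even (B.len x - 1) ↔ Odd (B.len x) := by
    rw [Nat.even_iff, Nat.odd_iff]; omega
  rw [sign]
  rcases zmod_two_cases (B.parity x) with hp | hp <;> by_cases ho : Odd (B.len x)
  · simp [hp, ho, (hpar.2 ho).neg_one_pow, ksign_zero_left]
  · simp [hp, ho, (Nat.not_even_iff_odd.1 (mt hpar.1 ho)).neg_one_pow, ksign_zero_left]
  · simp [hp, ho, (hpar.2 ho).neg_one_pow, ksign_one_one]
  · simp [hp, ho, (Nat.not_even_iff_odd.1 (mt hpar.1 ho)).neg_one_pow, ksign_one_one]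

/-- The strings of given length and parity on which the form is skew-symmetric are even in
number. -/
theorem even_mult (B : StringBasis e h f I) {q : ℕ} {p : ZMod 2} (hqp : ¬(p = 0 ↔ Odd q)) :
    Even (B.mult q p) := by
  let P : I → Prop := fun x => B.len x = q ∧ B.parity x = p
  have : DecidablePred P := fun x => inferInstanceAs (Decidable (_ ∧ _))
  let G : Matrix {x // P x} {x // P x} ℂ := B.gram.submatrix Subtype.val Subtype.val
  -- The Gram matrix pairs only strings of equal length and parity, so a kernel vector of the
  -- submatrix extended by zero is a kernel vector of the whole matrix.
  have hdet : G.det ≠ 0 := by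
    intro h0
    obtain ⟨v, hv, hv0⟩ := Matrix.exists_mulVec_eq_zero_iff.2 h0
    let w : I → ℂ := fun x => if hx : P x then v ⟨x, hx⟩ else 0
    have hw : B.gram.mulVec w = 0 := by
      funext x
      have hsum : B.gram.mulVec w x = ∑ y : {y // P y}, B.gram x y * v y := by
        have hvw : ∑ y : {y // P y}, B.gram x y * v y = ∑ y : {y // P y}, B.gram x y * w y :=
          Finset.sum_congr rfl fun y _ => by rw [show w y = v y from dif_pos y.2]
        rw [hvw, ← Finset.sum_subtype (Finset.univ.filter P) (by simp) fun y => B.gram x y * w y,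
          Finset.sum_filter_of_ne]
        · rfl
        · intro y _ hy
          by_contra hy'
          exact hy (by rw [show w y = 0 from dif_neg hy', mul_zero])
      rw [hsum]
      by_cases hx : P x
      · exact congrFun hv0 ⟨x, hx⟩
      · refine Finset.sum_eq_zero fun y _ => ?_
        rw [mul_eq_zero]
        left
        by_contra h1
        have h2 := B.gram_ne_zero h1
        exact hx ⟨h2.1.trans y.2.1, h2.2.trans y.2.2⟩
    have hw0 : w = 0 := by
      by_contra h1
      exact B.gram_det_ne_zero (Matrix.exists_mulVec_eq_zero_iff.1 ⟨w, h1, hw⟩)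
    apply hv
    funext x
    exact (dif_pos x.2).symm.trans (congrFun hw0 x)
  have hskew : G.transpose = -G := by
    ext x y
    change B.gram y x = -B.gram x y
    rw [B.gram_symm, sign_eq, x.2.1, x.2.2, if_neg hqp, neg_one_mul]
  -- A skew-symmetric matrix of odd size would have determinant equal to its own negative.
  have hd : G.det = (-1) ^ B.mult q p * G.det := by
    conv_lhs => rw [← Matrix.det_transpose, hskew, Matrix.det_neg]
    rw [Fintype.card_subtype, mult]
    congr!
  by_contra hodd
  rw [(Nat.not_even_iff_odd.1 hodd).neg_one_pow] at hd
  exact hdet (by linear_combination (1 / 2) * hd)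

theorem IsSuperSkew.add {p : ZMod 2} {S S' : Matrix I I ℂ} (hS : B.IsSuperSkew p S)
    (hS' : B.IsSuperSkew p S') : B.IsSuperSkew p (S + S') := by
  refine ⟨fun x y hxy => ?_, fun x y hxy => ?_, fun x y => ?_⟩
  · rw [Matrix.add_apply, hS.block x y hxy, hS'.block x y hxy, add_zero]
  · by_cases h0 : S x y = 0
    · rw [Matrix.add_apply, h0, zero_add] at hxy
      exact hS'.parity x y hxy
    · exact hS.parity x y h0
  · rw [Matrix.add_apply, Matrix.add_apply, hS.skew, hS'.skew, mul_add]

theorem IsSuperSkew.smul {p : ZMod 2} {S : Matrix I I ℂ} (hS : B.IsSuperSkew p S) (c : ℂ) :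
    B.IsSuperSkew p (c • S) := by
  refine ⟨fun x y hxy => ?_, fun x y hxy => ?_, fun x y => ?_⟩
  · rw [Matrix.smul_apply, hS.block x y hxy, smul_zero]
  · exact hS.parity x y fun h0 => hxy (by rw [Matrix.smul_apply, h0, smul_zero])
  · rw [Matrix.smul_apply, Matrix.smul_apply, hS.skew, smul_eq_mul, smul_eq_mul]
    ring

/-- If a ≠ 0, the quadratic formula over ℂ gives s = -b + d and t = a with d² = b² - ac. -/
theorem exists_isotropic (a b c : ℂ) :
    ∃ s t : ℂ, (s ≠ 0 ∨ t ≠ 0) ∧ a * s ^ 2 + 2 * b * s * t + c * t ^ 2 = 0 := by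
  by_cases ha : a = 0
  · exact ⟨1, 0, Or.inl one_ne_zero, by rw [ha]; ring⟩
  · obtain ⟨d, hd⟩ := IsAlgClosed.exists_pow_nat_eq (b ^ 2 - a * c) two_pos
    exact ⟨-b + d, a, Or.inr ha, by linear_combination a * hd⟩

/-- If the strings of length `q` contain two of symmetric and one of skew-symmetric type, the
odd part of `𝔤^♮` contains a nonzero operator of square zero. -/
theorem exists_odd_sq_zero {x₁ x₂ y : I} (hne : x₁ ≠ x₂) (h2 : B.len x₂ = B.len x₁)
    (hy : B.len y = B.len x₁) (p2 : B.parity x₂ = B.parity x₁) (s1 : B.sign x₁ = 1)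
    (sy : B.sign y = -1) : ∃ X ∈ gnat e h f 1, X * X = 0 ∧ X ≠ 0 := by
  have py : B.parity x₁ + B.parity y = 1 := by
    rw [sign, ← hy] at s1
    rw [sign] at sy
    rcases zmod_two_cases (B.parity x₁) with h3 | h3 <;>
      rcases zmod_two_cases (B.parity y) with h4 | h4 <;> rw [h3] at s1 <;> rw [h4] at sy <;>
      rw [h3, h4]
    · rw [s1] at sy; norm_num at sy
    · exact zero_add 1
    · exact add_zero 1
    · rw [s1] at sy; norm_num at sy
  have hpy : B.parity x₁ ≠ B.parity y := by
    intro h0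
    rw [h0] at py
    rcases zmod_two_cases (B.parity y) with h4 | h4 <;> rw [h4] at py <;> exact absurd py (by decide)
  obtain ⟨s, t, hst, hq⟩ := exists_isotropic (B.gram x₁ x₁) (B.gram x₁ x₂) (B.gram x₂ x₂)
  have h21 : B.gram x₂ x₁ = B.gram x₁ x₂ := by rw [B.gram_symm, s1, one_mul]
  have hyy : B.gram y y = 0 := by
    have := B.gram_symm y y
    rw [sy] at this
    linear_combination (1 / 2) * this
  have hsk1 := isSuperSkew_skewUnit hy.symm
  have hsk2 := isSuperSkew_skewUnit (h2.trans hy.symm)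
  rw [py] at hsk1
  rw [p2, py] at hsk2
  have hS := (hsk1.smul s).add (hsk2.smul t)
  set S := s • B.skewUnit x₁ y + t • B.skewUnit x₂ y with hSdef
  -- The operator is the wedge of an isotropic vector a in the symmetric space with a vector u in
  -- the skew space. All pairings among a and u vanish, so S G S = 0 for the Gram matrix G.
  let a : I → ℂ := s • Pi.single x₁ 1 + t • Pi.single x₂ 1
  let u : I → ℂ := Pi.single y 1
  have hSa : S = Matrix.vecMulVec a u - B.pairSign x₁ y • Matrix.vecMulVec u a := by
    have hps : B.pairSign x₂ y = B.pairSign x₁ y := by rw [pairSign, pairSign, h2, p2]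
    rw [hSdef, skewUnit, skewUnit, hps, Matrix.add_vecMulVec, Matrix.vecMulVec_add,
      Matrix.smul_vecMulVec, Matrix.smul_vecMulVec, Matrix.vecMulVec_smul, Matrix.vecMulVec_smul]
    simp only [u, ← Matrix.single_eq_single_vecMulVec_single]
    have hsc : ∀ z : I, Matrix.single y z (B.pairSign x₁ y) =
        B.pairSign x₁ y • Matrix.single y z (1 : ℂ) := fun z => by
      rw [Matrix.smul_single, smul_eq_mul, mul_one]
    rw [hsc, hsc]
    module
  have g0 : ∀ x, B.parity x = B.parity x₁ → B.gram x y = 0 := fun x hx => by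
    by_contra h0
    exact hpy (hx.symm.trans (B.gram_ne_zero h0).2)
  have g0' : ∀ x, B.parity x = B.parity x₁ → B.gram y x = 0 := fun x hx => by
    by_contra h0
    exact hpy (hx.symm.trans (B.gram_ne_zero h0).2.symm)
  have haa : Matrix.vecMul a B.gram ⬝ᵥ a = 0 := by
    simp [a, Matrix.add_vecMul, Matrix.smul_vecMul, h21]
    linear_combination hq
  have hau : Matrix.vecMul a B.gram ⬝ᵥ u = 0 := by
    simp [a, u, Matrix.add_vecMul, Matrix.smul_vecMul, g0 _ rfl, g0 _ p2]
  have hua : Matrix.vecMul u B.gram ⬝ᵥ a = 0 := by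
    simp [a, u, g0' _ rfl, g0' _ p2]
  have huu : Matrix.vecMul u B.gram ⬝ᵥ u = 0 := by
    simp [u, hyy]
  have hN : B.IsBlock (S * B.gram) := hS.block.mul isBlock_gram
  refine ⟨_, hS.op_mem_gnat, ?_, fun h0 => ?_⟩
  · rw [op_mul_op hN hN, ← Matrix.mul_assoc]
    have : S * B.gram * S = 0 := by
      rw [hSa, sub_mul, Matrix.smul_mul, Matrix.vecMulVec_mul, Matrix.vecMulVec_mul, sub_mul,
        mul_sub, Matrix.smul_mul, mul_sub, Matrix.mul_smul, Matrix.mul_smul,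
        Matrix.vecMulVec_mul_vecMulVec, Matrix.vecMulVec_mul_vecMulVec,
        Matrix.vecMulVec_mul_vecMulVec, Matrix.vecMulVec_mul_vecMulVec, haa, hau, hua, huu]
      simp
    rw [this, zero_mul]
    refine B.linearMap_ext fun z j => ?_
    rw [op_vec (show B.IsBlock 0 from fun _ _ _ => rfl)]
    simp
  · have hS0 : S = 0 := by
      have h3 : S * B.gram = 0 := by
        ext w z
        have h4 : B.coord w 0 (B.op (S * B.gram) (B.vec z 0)) = 0 := by
          rw [h0, LinearMap.zero_apply, map_zero]
        by_cases hwz : B.len w = B.len z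
        · rw [coord_op hN, Finset.sum_eq_single z, coord_vec_self B (B.len_pos z), mul_one] at h4
          · exact h4
          · intro w' _ hw'
            rw [coord_vec_ne_string B hw', mul_zero]
          · simp
        · exact hN w z hwz
      rw [← Matrix.mul_nonsing_inv_cancel_right B.gram S isUnit_gram_det, h3, Matrix.zero_mul]
    have hx1 : x₁ ≠ y := fun h5 => hpy (by rw [h5])
    have hx2 : x₂ ≠ y := fun h5 => hpy (by rw [← h5, p2])
    rw [hSa] at hS0
    have e1 := congrFun (congrFun hS0 x₁) y
    have e2 := congrFun (congrFun hS0 x₂) y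
    rw [Matrix.sub_apply, Matrix.smul_apply, Matrix.vecMulVec_apply, Matrix.vecMulVec_apply] at e1 e2
    rcases hst with hs | ht
    · exact hs (by simpa [a, u, hx1, hne] using e1)
    · exact ht (by simpa [a, u, hx2, hne.symm] using e2)

theorem mult_le_one_or_mult_eq_zero (hsq : ∀ X ∈ gnat e h f 1, X * X = 0 → X = 0) {q : ℕ}
    {p r : ZMod 2} (hp : p = 0 ↔ Odd q) (hr : ¬(r = 0 ↔ Odd q)) :
    B.mult q p ≤ 1 ∨ B.mult q r = 0 := by
  by_contra! hcon
  obtain ⟨h1, h2⟩ := hcon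
  obtain ⟨x₁, hx₁, x₂, hx₂, hne⟩ := Finset.one_lt_card.1 h1
  obtain ⟨y, hy, hyr⟩ := mult_pos_iff.1 (Nat.pos_of_ne_zero h2)
  obtain ⟨hl1, hp1⟩ := (Finset.mem_filter.1 hx₁).2
  obtain ⟨hl2, hp2⟩ := (Finset.mem_filter.1 hx₂).2
  obtain ⟨X, hX, hXX, hX0⟩ := exists_odd_sq_zero (B := B) hne (hl2.trans hl1.symm)
    (hy.trans hl1.symm) (hp2.trans hp1.symm) (by rw [sign_eq, hl1, hp1, if_pos hp])
    (by rw [sign_eq, hy, hyr, if_neg hr])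
  exact hX0 (hsq X hX hXX)

end SkewClasses

end StringBasis

/-! ### Odd elements of square zero in sums of a reductive algebra and copies of 𝔬𝔰𝔭_{1|2r}. -/

section OspOne

/-- The even part of ℂ^{1|2r} is a line spanned by u, and Y is determined by w = Yu, since Yv =
(v|w)u for odd v. Then Y²v = (v|w)w, and if this vanishes for all odd v, nondegeneracy gives w = 0.
-/
theorem eq_zero_of_sq_eq_zero_osp_one {r : ℕ} {Y : Module.End ℂ (SV 1 r)} (hY : Y ∈ osp 1 r 1)
    (hYY : Y * Y = 0) : Y = 0 := by
  let u : SV 1 r := Pi.single (Sum.inl 0) 1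
  have hu : u ∈ homog 1 r 0 := by
    intro i hi
    rcases i with i | i
    · exact absurd rfl hi
    · simp [u]
  have huv : ∀ v, form 1 r v u = v (Sum.inl 0) := by
    intro v
    simp [form_apply, u]
  have heven : ∀ v ∈ homog 1 r 0, v = v (Sum.inl 0) • u := by
    intro v hv
    funext i
    rcases i with i | i
    · simp [u, Subsingleton.elim i 0]
    · rw [hv _ (by exact one_ne_zero)]
      simp [u]
  have hodd : ∀ v ∈ homog 1 r 1, Y v = form 1 r v (Y u) • u := by
    intro v hv
    rw [heven (Y v) (hY.1 1 v hv), ← huv (Y v), hY.2 1 v hv, ksign_one_one, neg_one_mul, neg_neg]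
  have hw : Y u ∈ homog 1 r 1 := by simpa using hY.1 0 u hu
  have hw0 : Y u = 0 := by
    by_contra h0
    apply h0
    refine eq_zero_of_form_right fun v => ?_
    obtain ⟨v₀, h₀, v₁, h₁, rfl⟩ := exists_homog_add v
    rw [map_add, LinearMap.add_apply, form_eq_zero_of_ne h₀ hw zero_ne_one, zero_add]
    have h2 : Y (Y v₁) = 0 := LinearMap.congr_fun hYY v₁
    rw [hodd v₁ h₁, map_smul] at h2
    exact (smul_eq_zero.1 h2).resolve_right h0
  refine LinearMap.ext fun v => ?_
  obtain ⟨v₀, h₀, v₁, h₁, rfl⟩ := exists_homog_add v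
  rw [map_add, heven v₀ h₀, map_smul, hodd v₁ h₁, hw0]
  simp

theorem sbr_self {m k : ℕ} (X : Module.End ℂ (SV m k)) : sbr 1 1 X X = (2 : ℂ) • (X * X) := by
  rw [sbr, ksign_one_one]
  module

theorem sbr_one_one {m k : ℕ} (X Y : Module.End ℂ (SV m k)) : sbr 1 1 X Y = X * Y + Y * X := by
  rw [sbr, ksign_one_one]
  module

/-- The isomorphism preserves only brackets, but for odd X the condition X² = 0 is [X,X] = 0. -/
theorem IsoOspOne.eq_zero_of_sq_eq_zero {m k r : ℕ}
    {L : ZMod 2 → Submodule ℂ (Module.End ℂ (SV m k))} (hL : IsoOspOne L r)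
    {X : Module.End ℂ (SV m k)} (hX : X ∈ L 1) (hXX : X * X = 0) : X = 0 := by
  obtain ⟨φ, hφ⟩ := hL
  obtain ⟨Y, hY⟩ := (φ 1).surjective ⟨X, hX⟩
  have h1 := hφ 1 1 Y Y
  rw [hY, sbr_self, hXX, smul_zero, ZeroMemClass.coe_eq_zero, LinearEquiv.map_eq_zero_iff] at h1
  have h2 : sbr 1 1 (Y : Module.End ℂ (SV 1 r)) Y = 0 := congrArg Subtype.val h1
  rw [sbr_self, smul_eq_zero_iff_right two_ne_zero] at h2
  have h3 : Y = 0 := Subtype.ext (eq_zero_of_sq_eq_zero_osp_one Y.2 h2)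
  rw [h3, map_zero] at hY
  exact (congrArg Subtype.val hY).symm

theorem IsoOspOne.sq_mem {m k r : ℕ}
    {L : ZMod 2 → Submodule ℂ (Module.End ℂ (SV m k))} (hL : IsoOspOne L r)
    {X : Module.End ℂ (SV m k)} (hX : X ∈ L 1) : X * X ∈ L (1 + 1) := by
  obtain ⟨φ, hφ⟩ := hL
  obtain ⟨Y, hY⟩ := (φ 1).surjective ⟨X, hX⟩
  have h1 := hφ 1 1 Y Y
  rw [hY, sbr_self] at h1
  have h2 : (2 : ℂ) • (X * X) ∈ L (1 + 1) := h1 ▸ (φ (1 + 1) (ospBr Y Y)).2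
  exact (Submodule.smul_mem_iff _ two_ne_zero).1 h2

theorem iSupIndep_eq_zero_of_sum {ι R M : Type*} [Fintype ι] [Ring R] [AddCommGroup M]
    [Module R M] {p : ι → Submodule R M} (hp : iSupIndep p) {v : ι → M} (hv : ∀ i, v i ∈ p i)
    (h0 : ∑ i, v i = 0) (i : ι) : v i = 0 := by
  classical
  refine Submodule.disjoint_def.1 (hp i) _ (hv i) ?_
  rw [← Finset.add_sum_erase _ _ (Finset.mem_univ i)] at h0
  rw [eq_neg_of_add_eq_zero_left h0]
  refine Submodule.neg_mem _ (Submodule.sum_mem _ fun j hj => ?_)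
  exact Submodule.mem_iSup_of_mem j (Submodule.mem_iSup_of_mem (Finset.ne_of_mem_erase hj) (hv j))

/-- Odd components in different summands anticommute, so X² is the sum of the squares of the
components. These squares lie in independent summands and therefore vanish one by one. -/
theorem IsReductivePlusOspOne.eq_zero_of_sq_eq_zero {m k : ℕ}
    {L : ZMod 2 → Submodule ℂ (Module.End ℂ (SV m k))} (hL : IsReductivePlusOspOne L)
    {X : Module.End ℂ (SV m k)} (hX : X ∈ L 1) (hXX : X * X = 0) : X = 0 := by
  obtain ⟨s, A, hA, hcomm, hnone, -, hsome⟩ := hL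
  rw [← (hA 1).2, Submodule.mem_iSup_iff_exists_finsupp] at hX
  obtain ⟨Z, hZ, rfl⟩ := hX
  rw [Finsupp.sum_fintype _ _ fun _ => rfl] at hXX ⊢
  have hZ0 : Z none = 0 := by
    have := hZ none
    rwa [hnone, Submodule.mem_bot] at this
  have hcross : ∀ o o', o ≠ o' → Z o * Z o' + Z o' * Z o = 0 := fun o o' ho => by
    rw [← sbr_one_one]; exact hcomm o o' ho 1 1 _ (hZ o) _ (hZ o')
  have hsum : ∑ o, Z o * Z o = 0 := by
    have h1 : ∑ o, ∑ o', (Z o * Z o' + Z o' * Z o) = ∑ o, (2 : ℂ) • (Z o * Z o) := by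
      refine Finset.sum_congr rfl fun o _ => ?_
      rw [Finset.sum_eq_single o (fun o' _ ho => hcross o o' ho.symm) (by simp), two_smul]
    have h2 : ∑ o, ∑ o', (Z o * Z o' + Z o' * Z o) = 0 := by
      simp only [Finset.sum_add_distrib]
      rw [Finset.sum_comm (f := fun o o' => Z o' * Z o), ← Finset.sum_mul_sum, hXX, add_zero]
    rw [h2, ← Finset.smul_sum] at h1
    exact (smul_eq_zero_iff_right two_ne_zero).1 h1.symm
  have hmem : ∀ o, Z o * Z o ∈ A o (1 + 1) := by
    rintro (_ | c)
    · rw [hZ0, mul_zero]; exact Submodule.zero_mem _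
    · obtain ⟨r, hr⟩ := hsome c
      exact hr.sq_mem (hZ _)
  have hsq := iSupIndep_eq_zero_of_sum (hA (1 + 1)).1 hmem hsum
  refine Finset.sum_eq_zero fun o _ => ?_
  rcases o with _ | c
  · exact hZ0
  · obtain ⟨r, hr⟩ := hsome c
    exact hr.eq_zero_of_sq_eq_zero (hZ _) (hsq _)

end OspOne

/-! ### Multiplicity one and the list of partitions. -/

section Combinatorics

theorem eq_replicate_add_replicate {γ : Multiset ℕ} {q : ℕ} (hq : 1 < q)
    (hγ : ∀ x ∈ γ, x = q ∨ x = 1) : γ = pw q (γ.count q) + pw 1 (γ.count 1) := by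
  ext x
  rw [Multiset.count_add, Multiset.count_replicate, Multiset.count_replicate]
  by_cases hx : x ∈ γ
  · rcases hγ x hx with rfl | rfl
    · rw [if_pos rfl, if_neg hq.ne, add_zero]
    · rw [if_neg hq.ne', if_pos rfl, zero_add]
  · rw [Multiset.count_eq_zero_of_notMem hx]
    split_ifs with h1 h2 h2
    · exact absurd (h1.trans h2.symm) hq.ne'
    · rw [h1, Multiset.count_eq_zero_of_notMem hx]
    · rw [h2, Multiset.count_eq_zero_of_notMem hx]
    · rfl

variable {m k : ℕ} {α β : Multiset ℕ}

theorem exists_eq_of_card_eq_one (pα : ∀ q ∈ α, 0 < q) (pβ : ∀ q ∈ β, 0 < q)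
    (hcard : ((distinctParts α β).filter fun q => 1 < q).card = 1) :
    ∃ q a r b s, 2 ≤ q ∧ α = pw q a + pw 1 r ∧ β = pw q b + pw 1 s ∧ 1 ≤ a + b := by
  obtain ⟨q, hq⟩ := Finset.card_eq_one.1 hcard
  have hmem : ∀ x, ((x ∈ α ∨ x ∈ β) ∧ 1 < x) ↔ x = q := fun x => by
    simpa [distinctParts] using Finset.ext_iff.1 hq x
  obtain ⟨hq1, hq2⟩ := (hmem q).2 rfl
  refine ⟨q, α.count q, α.count 1, β.count q, β.count 1, hq2,
    eq_replicate_add_replicate hq2 fun x hx => ?_, eq_replicate_add_replicate hq2 fun x hx => ?_, ?_⟩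
  · by_cases h1 : 1 < x
    · exact Or.inl ((hmem x).1 ⟨Or.inl hx, h1⟩)
    · have := pα x hx
      exact Or.inr (by omega)
  · by_cases h1 : 1 < x
    · exact Or.inl ((hmem x).1 ⟨Or.inr hx, h1⟩)
    · have := pβ x hx
      exact Or.inr (by omega)
  · rcases hq1 with h1 | h1
    · have := Multiset.count_pos.2 h1; omega
    · have := Multiset.count_pos.2 h1; omega

/-- When at most one part exceeds 1, a pair (q, q') with q = q' + 2 must be (3, 1). This leaves α =
(3, 1) and β empty, so k = 0 and m = 4, against `hs`. -/
theorem multFormula_eq_one_iff (hs : k = 0 → 4 < m) (pα : ∀ q ∈ α, 0 < q) (pβ : ∀ q ∈ β, 0 < q)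
    (sα : α.sum = m) (sβ : β.sum = 2 * k) :
    multFormula α β = 1 ↔ ((distinctParts α β).filter fun q => 1 < q).card = 1 := by
  have hpos : ∀ x ∈ distinctParts α β, 0 < x := by
    intro x hx
    rcases Finset.mem_union.1 hx with hx | hx
    · exact pα x (Multiset.mem_toFinset.1 hx)
    · exact pβ x (Multiset.mem_toFinset.1 hx)
  unfold multFormula
  set D := distinctParts α β with hD
  set P := (D ×ˢ D).filter fun x => x.1 = x.2 + 2 ∧ α.count x.1 = 1 ∧ α.count x.2 = 1 ∧
    β.count x.1 = 0 ∧ β.count x.2 = 0 ∧ Odd x.1 ∧ Odd x.2 with hP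
  set Q := (D ×ˢ D).filter fun x => x.1 = x.2 + 2 ∧ β.count x.1 = 1 ∧ β.count x.2 = 1 ∧
    α.count x.1 = 0 ∧ α.count x.2 = 0 ∧ Even x.1 ∧ Even x.2 with hQ
  -- The case of no part greater than 1 is included because the total could otherwise equal 1
  -- through a pair alone.
  have hle : ((D.filter fun q => 1 < q).card = 0 ∨ (D.filter fun q => 1 < q).card = 1) →
      P = ∅ ∧ Q = ∅ := by
    intro hc
    have hcard : (D.filter fun q => 1 < q).card ≤ 1 := by omega
    have hone := Finset.card_le_one.1 hcard
    have hsmall : ∀ x ∈ D ×ˢ D, x.1 = x.2 + 2 → x.2 = 1 := by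
      intro x hx h1
      obtain ⟨hx1, hx2⟩ := Finset.mem_product.1 hx
      have h2 := hpos _ hx2
      by_contra h3
      have := hone x.1 (Finset.mem_filter.2 ⟨hx1, by omega⟩) x.2
        (Finset.mem_filter.2 ⟨hx2, by omega⟩)
      omega
    constructor
    · refine Finset.eq_empty_of_forall_notMem fun x hx => ?_
      obtain ⟨hx, h1, h2, h3, h4, h5, -⟩ := Finset.mem_filter.1 hx
      have h6 := hsmall x hx h1
      have h7 : x.1 = 3 := by omega
      rw [h6] at h3 h5
      rw [h7] at h2 h4
      obtain ⟨hx1, -⟩ := Finset.mem_product.1 hx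
      rw [h7] at hx1
      have hc1 : (D.filter fun q => 1 < q).card = 1 := by
        refine hc.resolve_left fun h8 => ?_
        exact Finset.notMem_empty 3
          (Finset.card_eq_zero.1 h8 ▸ Finset.mem_filter.2 ⟨hx1, by norm_num⟩)
      obtain ⟨q, a, r, b, s, hq, rfl, rfl, -⟩ := exists_eq_of_card_eq_one pα pβ hc1
      have hq3 : q = 3 := by
        by_contra h8
        rw [Multiset.count_add, Multiset.count_replicate, Multiset.count_replicate, if_neg h8] at h2
        simp at h2
      subst hq3
      simp [Multiset.count_replicate] at h2 h3 h4 h5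
      subst h2 h3 h4 h5
      simp at sα sβ
      have := hs (by omega)
      omega
    · refine Finset.eq_empty_of_forall_notMem fun x hx => ?_
      obtain ⟨hx, h1, -, -, -, -, -, h2⟩ := Finset.mem_filter.1 hx
      rw [hsmall x hx h1] at h2
      exact absurd h2 (by decide)
  constructor
  · intro h1
    have h2 := hle (by omega)
    rw [h2.1, h2.2] at h1
    simpa using h1
  · intro h1
    have h2 := hle (Or.inr h1)
    rw [h2.1, h2.2, h1]
    simp

theorem card_eq_one_of_isListed {n : ℕ} (h0 : IsListed m n α β) :
    ((distinctParts α β).filter fun q => 1 < q).card = 1 := by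
  obtain ⟨q, l, r, hq, hl, h0⟩ := h0
  rw [Finset.card_eq_one]
  refine ⟨q, ?_⟩
  ext x
  have h1 : x ∈ distinctParts α β ↔ x ∈ α ∨ x ∈ β := by
    rw [distinctParts, Finset.mem_union, Multiset.mem_toFinset, Multiset.mem_toFinset]
  rw [Finset.mem_filter, Finset.mem_singleton, h1]
  have hl0 : l ≠ 0 := by omega
  rcases h0 with h0 | h0 | h0 | h0 | h0 | h0 | h0 | h0 | h0 | h0 | h0 | h0 <;>
  · rw [h0.1, h0.2.1]
    simp only [Multiset.mem_add, Multiset.mem_replicate, Multiset.notMem_zero,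
      Multiset.mem_singleton, or_false, false_or]
    omega

/-- Write α = (q^a, 1^r) and β = (q^b, 1^s). There are four possibilities at q: b = 0; a = 0; both
positive with q even, so b = 1 and a even; both positive with q odd, so a = 1 and b even. At the
part 1 there are three: s = 0, r = 0, r = 1. The products are the twelve families. -/
theorem isListed_of_card_eq_one (hs : k = 0 → 4 < m) (pα : ∀ q ∈ α, 0 < q) (pβ : ∀ q ∈ β, 0 < q)
    (sα : α.sum = m) (sβ : β.sum = 2 * k) (eα : ∀ q, Even q → Even (α.count q))
    (eβ : ∀ q, Odd q → Even (β.count q)) (xo : ∀ q, Odd q → α.count q ≤ 1 ∨ β.count q = 0)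
    (xe : ∀ q, Even q → β.count q ≤ 1 ∨ α.count q = 0)
    (hcard : ((distinctParts α β).filter fun q => 1 < q).card = 1) :
    IsListed m (2 * k) α β := by
  obtain ⟨q, a, r, b, s, hq, rfl, rfl, hab⟩ := exists_eq_of_card_eq_one pα pβ hcard
  have c1 : ∀ a r, (pw q a + pw 1 r).count q = a := fun a r => by
    rw [Multiset.count_add, Multiset.count_replicate_self, Multiset.count_replicate,
      if_neg (by omega), add_zero]
  have c2 : ∀ a r, (pw q a + pw 1 r).count 1 = r := fun a r => by
    rw [Multiset.count_add, Multiset.count_replicate_self, Multiset.count_replicate,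
      if_neg (by omega), zero_add]
  replace eα := eα q
  have eβ1 := eβ 1 odd_one
  replace eβ := eβ q
  have xo1 := xo 1 odd_one
  replace xo := xo q
  replace xe := xe q
  simp only [c1, c2] at eα eβ eβ1 xo xo1 xe
  simp only [Multiset.sum_add, Multiset.sum_replicate, smul_eq_mul, mul_one] at sα sβ
  have hr : s = 0 ∨ r = 0 ∨ r = 1 := by omega
  have z : ∀ x, pw x 0 = 0 := fun x => Multiset.replicate_zero x
  rcases Nat.eq_zero_or_pos b with rfl | hb
  · rcases hr with rfl | rfl | rfl
    · refine ⟨q, a, r, hq, by omega, Or.inl ⟨rfl, by simp [z], eα, hs (by omega)⟩⟩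
    · refine ⟨q, a, s, hq, by omega, Or.inr <| Or.inr <| Or.inl ⟨by simp [z], ?_, eα⟩⟩
      rw [z, zero_add, show s = 2 * k by omega]
    · refine ⟨q, a, s, hq, by omega, Or.inr <| Or.inr <| Or.inr <| Or.inl ⟨by simp, ?_, eα⟩⟩
      rw [z, zero_add, show s = 2 * k by omega]
  rcases Nat.eq_zero_or_pos a with rfl | ha
  · rcases hr with rfl | rfl | rfl
    · refine ⟨q, b, r, hq, by omega,
        Or.inr <| Or.inr <| Or.inr <| Or.inr <| Or.inl ⟨?_, by simp [z], eβ⟩⟩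
      rw [z, zero_add, show r = m by omega]
    · exact ⟨q, b, s, hq, by omega, Or.inr <| Or.inl ⟨by simp [z], rfl, eβ, eβ1⟩⟩
    · exact ⟨q, b, s, hq, by omega, Or.inr <| Or.inr <| Or.inr <| Or.inr <| Or.inr <| Or.inl
        ⟨by simp [z], rfl, eβ, eβ1⟩⟩
  rcases Nat.even_or_odd q with hqe | hqo
  · obtain rfl : b = 1 := by have := xe hqe; omega
    have ea := eα hqe
    rcases hr with rfl | rfl | rfl
    · exact ⟨q, a, r, hq, by omega, Or.inr <| Or.inr <| Or.inr <| Or.inr <| Or.inr <| Or.inr <|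
        Or.inr <| Or.inr <| Or.inl ⟨rfl, by simp [z], ea, hqe⟩⟩
    · exact ⟨q, a, s, hq, by omega, Or.inr <| Or.inr <| Or.inr <| Or.inr <| Or.inr <| Or.inr <|
        Or.inr <| Or.inl ⟨by simp [z], by simp, hqe, ea, eβ1⟩⟩
    · exact ⟨q, a, s, hq, by omega, Or.inr <| Or.inr <| Or.inr <| Or.inr <| Or.inr <| Or.inr <|
        Or.inr <| Or.inr <| Or.inr <| Or.inr <| Or.inl ⟨by simp, by simp, hqe, ea, eβ1⟩⟩
  · obtain rfl : a = 1 := by have := xo hqo; omega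
    have eb := eβ hqo
    rcases hr with rfl | rfl | rfl
    · exact ⟨q, b, r, hq, by omega, Or.inr <| Or.inr <| Or.inr <| Or.inr <| Or.inr <| Or.inr <|
        Or.inl ⟨by simp, by simp [z], eb, hqo⟩⟩
    · exact ⟨q, b, s, hq, by omega, Or.inr <| Or.inr <| Or.inr <| Or.inr <| Or.inr <| Or.inr <|
        Or.inr <| Or.inr <| Or.inr <| Or.inr <| Or.inr ⟨by simp [z], rfl, eb, hqo, eβ1⟩⟩
    · exact ⟨q, b, s, hq, by omega, Or.inr <| Or.inr <| Or.inr <| Or.inr <| Or.inr <| Or.inr <|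
        Or.inr <| Or.inr <| Or.inr <| Or.inl ⟨by simp, rfl, eb, hqo, eβ1⟩⟩

end Combinatorics

end OspW

/-! ### The theorem. -/

theorem mainTheorem7 (m k : ℕ) (hsimple : k = 0 → 4 < m)
    (e h f : Module.End ℂ (OspW.SV m k))
    (he : e ∈ OspW.osp m k 0) (hh : h ∈ OspW.osp m k 0) (hf : f ∈ OspW.osp m k 0)
    (htriple : IsSl2Triple h e f)
    (α : Nat.Partition m) (β : Nat.Partition (2 * k))
    (hα : OspW.Encodes e h f 0 α.parts) (hβ : OspW.Encodes e h f 1 β.parts)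
    (hnat : OspW.IsReductivePlusOspOne (OspW.gnat e h f)) :
    OspW.multTrivAdj e h f = OspW.multFormula α.parts β.parts ∧
    (OspW.multTrivAdj e h f = 1 ↔ OspW.IsListed m (2 * k) α.parts β.parts) := by
  classical
  obtain ⟨B, hα', hβ'⟩ := OspW.exists_stringBasis he hh hf hα hβ (fun _ => α.parts_pos)
    fun _ => β.parts_pos
  have hmult : OspW.multTrivAdj e h f = OspW.multFormula α.parts β.parts := by
    rw [OspW.multTrivAdj_eq_finrank htriple he hh hf fun T hT _ hh' hg =>
      OspW.StringBasis.odd_eq_zero B hT hh' hg]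
    exact B.finrank_adjHighest_eq_multFormula (htriple.lie_h_e_smul ℂ) hα' hβ'
  -- The structure of 𝔤^♮ is used only through this property.
  have hsq : ∀ X ∈ OspW.gnat e h f 1, X * X = 0 → X = 0 := fun X hX =>
    hnat.eq_zero_of_sq_eq_zero hX
  refine ⟨hmult, ?_⟩
  rw [hmult, OspW.multFormula_eq_one_iff hsimple (fun _ => α.parts_pos) (fun _ => β.parts_pos)
    α.parts_sum β.parts_sum]
  refine ⟨OspW.isListed_of_card_eq_one hsimple (fun _ => α.parts_pos) (fun _ => β.parts_pos)
    α.parts_sum β.parts_sum (fun q hq => ?_) (fun q hq => ?_) (fun q hq => ?_) fun q hq => ?_,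
    OspW.card_eq_one_of_isListed⟩
  · rw [hα']
    exact B.even_mult (by simpa using hq)
  · rw [hβ']
    exact B.even_mult (by simpa using hq)
  · rw [hα', hβ']
    exact OspW.StringBasis.mult_le_one_or_mult_eq_zero hsq (by simpa using hq) (by simpa using hq)
  · rw [hα', hβ']
    exact OspW.StringBasis.mult_le_one_or_mult_eq_zero hsq (by simpa using hq) (by simpa using hq)
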